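/- **External-memory model.** External memory is an array of records partitioned into blocks of $B$ consecutive records; internal memory holds $M$ records, namely a constant number (16) of registers and $\lfloor (M-16)/B\rfloor$ blocks, managed by least-recently-used replacement. Records can be read and modified only while their block is in internal memory. The cost is the number of *block transfers*, i.e. of copyings of a block from external into internal memory. **Graveyard hashing** with load parameter $t\ge 2$. Let $H:U\to[0,1)$ be a uniform, fully independent random hash function; in a table of $n$ slots $0,\dots,n-1$ the key $u$ has hash $h_n(u)=\lfloor nH(u)\rfloor$. Each slot is free or holds a key or a tombstone. Linear probing is ordered: in every run (with wrap-around) keys and tombstones are sorted by hash (equal hashes: by $H$). A query for $u$ examines slots $h_n(u),h_n(u)+1,\dots$ until it finds $u$, an item of greater hash, or a free slot; a deletion replaces $u$, if found, by a tombstone with the same hash; an insertion finds the place where $u$ belongs in the run, puts $u$ there (unless it is present already) and shifts the items from there on right by one, up to the first tombstone or free slot, which it uses up. After every $\max(1,\lfloor n/(4t)\rfloor)$ insertions and deletions the table is rebuilt: all tombstones are removed, a table with $N$ keys is resized to $n=N+\lfloor N/(t-1)\rfloor+3$ slots (load factor about $1-1/t$), and one artificial tombstone is inserted for each of the hashes $2ti-1$,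 $1\le i\le \lfloor n/(2t)\rfloor$. The rebuild is done by a constant number of sequential sweeps that write the new table to a fresh area of external memory and erase the old one. Initially the table is empty and the first block of each of the two memory areas used is in internal memory. The *load factor* is the fraction of the slots of the table that hold keys. **Theorem.** There is an absolute constant $C>0$ such that the following holds for all real $x,r\ge 1$ such that $B=rx$ is an integer, all $M\ge CB$, and every sequence of queries, insertions and deletions (fixed independently of the hash function, over any universe $U$ of keys), executed by graveyard hashing with load parameter $t=2\lceil x\rceil$ starting from the empty table. 1. With probability one, after each number $k$ of operations: the table stores exactly the keys then present, each once, and no record outside its slots is in use; the next operation correctly determines whether its key is present; the load factor is at most $1-\frac{1}{Cx}$, and it is at least $1-\frac1x$ whenever at least $Cx$ keys are present. (So the load factor is maintained at $1-1/\Theta(x)$; with much fewer than $x$ keys no number of slots has such a load factor.) 2. Each operation, not counting a rebuild that follows it, incurs at most $1+\frac{C}{r}$ block transfers in expectation. 3. With probability one, for every $k$, all rebuilds during the first $k$ operations together incur at most $\frac{C}{r}\,k$ block transfers; that is, rebuilds cost $O(1/r)$ amortized block transfers per operation. -/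

import Mathlib

open MeasureTheory ProbabilityTheory

/-! External memory, and graveyard hashing (ordered linear probing with artificial tombstones)
running in it, with dynamic resizing. -/

namespace Graveyard

/-- Contents of one slot: free, a live key, the tombstone left by the deletion of a key, or an
artificial tombstone with a given hash (a slot number). -/
inductive Slot (U : Type*) where
  | free
  | key (u : U)
  | tomb (u : U)
  | grave (a : ℕ)

/-- `B`: records per block; `M`: records of internal memory; `t`: load parameter
(the table is rebuilt at load factor about `1 - 1/t`); `H`: the hash function, with values in
`[0,1)`.  In a table of `n` slots, numbered `0, …, n-1`, the key `u` hashes to `⌊n * H u⌋`. -/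
structure Env (U : Type*) where
  B : ℕ
  M : ℕ
  t : ℕ
  H : U → ℝ

/-- State of the memory.  The address space consists of two areas, each an infinite array of
records; block `(a, j)` consists of the records `j * B, …, j * B + B - 1` of area `a`.
`cell` gives the current contents of the records (the internal copy, if there is one; writing back
an evicted block is not a block transfer, only copying into internal memory is), `cache` lists the
blocks held in internal memory, the most recently used one first, and `loads` counts the block
transfers so far. -/
structure Mem (U : Type*) where
  cell : Bool → ℕ → Slot U
  cache : List (Bool × ℕ)
  loads : ℕ

/-- Number of blocks that internal memory holds, after setting aside 16 records for the constant
number of registers used below. -/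
def Env.frames {U : Type*} (E : Env U) : ℕ := (E.M - 16) / E.B

/-- Access to record `p` of area `a`: its block is brought into internal memory, unless it is
there, replacing the least recently used block if internal memory is full. -/
def touch {U : Type*} (E : Env U) (a : Bool) (p : ℕ) (m : Mem U) : Mem U :=
  if (a, p / E.B) ∈ m.cache then
    { m with cache := (a, p / E.B) :: m.cache.erase (a, p / E.B) }
  else
    { m with cache := ((a, p / E.B) :: m.cache).take E.frames, loads := m.loads + 1 }

/-- Write `s` to record `p` of area `a`. -/
def write {U : Type*} (E : Env U) (a : Bool) (p : ℕ) (s : Slot U) (m : Mem U) : Mem U :=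
  { touch E a p m with cell := Function.update m.cell a (Function.update (m.cell a) p s) }

/-! ### The order of the items in a run -/

/-- The unrounded hash, in a table of `n` slots, of a key or tombstone (`0` for a free slot, which
is never used). -/
noncomputable def Env.val {U : Type*} (E : Env U) (n : ℕ) : Slot U → ℝ
  | .free => 0
  | .key u => E.H u * n
  | .tomb u => E.H u * n
  | .grave a => a

/-- The hash (a slot number) of a key or tombstone. -/
noncomputable def Env.home {U : Type*} (E : Env U) (n : ℕ) (s : Slot U) : ℕ := ⌊E.val n s⌋₊

/-- Distance, with wrap-around, from the hash of the item `s` to the slot `p` in which it lies. -/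
noncomputable def Env.offset {U : Type*} (E : Env U) (n p : ℕ) (s : Slot U) : ℕ :=
  (p + n - E.home n s) % n

/-- The item `s`, seen in the slot at distance `i` after the hash of `u`, has a smaller hash than
`u`.  Comparing distances to a common slot compares hashes correctly across the end of the table;
equal hashes are compared before rounding. -/
def Env.Smaller {U : Type*} (E : Env U) (n : ℕ) (u : U) (i : ℕ) (s : Slot U) : Prop :=
  i < E.offset n (E.home n (.key u) + i) s ∨
    (E.offset n (E.home n (.key u) + i) s = i ∧ E.val n s < E.val n (.key u))

/-- Likewise: the item `s` has a greater hash than `u`. -/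
def Env.Greater {U : Type*} (E : Env U) (n : ℕ) (u : U) (i : ℕ) (s : Slot U) : Prop :=
  E.offset n (E.home n (.key u) + i) s < i ∨
    (E.offset n (E.home n (.key u) + i) s = i ∧ E.val n (.key u) < E.val n s)

/-! ### Queries, insertions and deletions in a table of `n` slots stored in area `a` -/

open Classical in
/-- Examine the slots at distances `i, i + 1, …` after the hash of `u` (at most `fuel` of them),
until finding `u`, or an item with greater hash, or a free slot; the position of `u`, if found. -/
noncomputable def find {U : Type*} (E : Env U) (a : Bool) (n : ℕ) (u : U) :
    (fuel i : ℕ) → Mem U → Mem U × Option ℕ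
  | 0, _, m => (m, none)
  | fuel + 1, i, m =>
    let p := (E.home n (.key u) + i) % n
    let m' := touch E a p m
    match m.cell a p with
    | .free => (m', none)
    | s =>
      if s = .key u then (m', some p)
      else if E.Greater n u i s then (m', none)
      else find E a n u fuel (i + 1) m'

/-- Put `s` into slot `p`, shifting the items from `p` on to the right by one until finding a
tombstone or a free slot, whose place is used. -/
def shift {U : Type*} (E : Env U) (a : Bool) (n : ℕ) : (fuel p : ℕ) → Slot U → Mem U → Mem U
  | 0, _, _, m => m
  | fuel + 1, p, s, m =>
    match m.cell a p with
    | .key v => shift E a n fuel ((p + 1) % n) (.key v) (write E a p s m)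
    | _ => write E a p s m

open Classical in
/-- Examine the slots at distances `i, i + 1, …` after the hash of `u` until finding the place where
`u` belongs: the first slot that is free or whose item does not have a smaller hash.  Insert `u`
there, unless it is already present.  The answer says whether it was. -/
noncomputable def insertFrom {U : Type*} (E : Env U) (a : Bool) (n : ℕ) (u : U) :
    (fuel i : ℕ) → Mem U → Mem U × Bool
  | 0, _, m => (m, false)
  | fuel + 1, i, m =>
    let p := (E.home n (.key u) + i) % n
    let m' := touch E a p m
    match m.cell a p with
    | .free => (shift E a n n p (.key u) m', false)
    | s =>
      if s = .key u then (m', true)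
      else if E.Smaller n u i s then insertFrom E a n u fuel (i + 1) m'
      else (shift E a n n p (.key u) m', false)

/-! ### Rebuilds -/

/-- Number of slots of a table that is rebuilt with `N` keys. -/
def Env.size {U : Type*} (E : Env U) (N : ℕ) : ℕ := N + N / (E.t - 1) + 3

/-- Number of insertions and deletions until the next rebuild of a table with `n` slots. -/
def Env.window {U : Type*} (E : Env U) (n : ℕ) : ℕ := max 1 (n / (4 * E.t))

/-- State of a sweep that lays out a new table: the memory, the next position available, and the
number of artificial tombstones placed so far. -/
structure Layout (U : Type*) where
  mem : Mem U
  next : ℕ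
  graves : ℕ

/-- Lay out the item `s` with hash `h` in the first available position of a table of `n` slots in
area `a`; if `wet` is false, only the position is computed and nothing is written. -/
def put {U : Type*} (E : Env U) (wet : Bool) (a : Bool) (n h : ℕ) (s : Slot U) (L : Layout U) :
    Layout U :=
  { L with
    mem := if wet then write E a (max L.next h % n) s L.mem else L.mem
    next := max L.next h + 1 }

/-- Lay out the remaining artificial tombstones with hash below `lim` (at most `fuel` of them).
Their hashes are the numbers `2 * t * i - 1`, `i = 1, 2, …, n / (2 * t)`. -/
def putGraves {U : Type*} (E : Env U) (wet : Bool) (a : Bool) (n lim : ℕ) :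
    (fuel : ℕ) → Layout U → Layout U
  | 0, L => L
  | fuel + 1, L =>
    let h := 2 * E.t * (L.graves + 1) - 1
    if h < lim then
      let L' := put E wet a n h (.grave h) L
      putGraves E wet a n lim fuel { L' with graves := L.graves + 1 }
    else L

/-- Read slot `p` of the old table (`n` slots, area `a`).  If it holds a key that lies past the
wrap-around (for `wrapped` true), respectively before it (for `wrapped` false), lay out that key in
the new table (`n'` slots, other area), after all artificial tombstones that precede it. -/
noncomputable def visit {U : Type*} (E : Env U) (wet : Bool) (a : Bool) (n n' : ℕ)
    (wrapped : Bool) (L : Layout U) (p : ℕ) : Layout U :=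
  let L' : Layout U := { L with mem := touch E a p L.mem }
  match L.mem.cell a p with
  | .key u =>
    if decide (p < E.home n (.key u)) = wrapped then
      put E wet (!a) n' (E.home n' (.key u)) (.key u)
        (putGraves E wet (!a) n' (E.home n' (.key u) + 1) n' L')
    else L'
  | _ => L'

/-- One sweep over the keys of the old table, in the order of their hashes. -/
noncomputable def sweep {U : Type*} (E : Env U) (wet : Bool) (a : Bool) (n n' : ℕ)
    (L : Layout U) : Layout U :=
  putGraves E wet (!a) n' n' n'
    ((List.range n).foldl (visit E wet a n n' true)
      ((List.range n).foldl (visit E wet a n n' false) L))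

/-- The data structure: memory, area and number of slots of the current table, number of keys
stored, number of insertions and deletions left until the next rebuild. -/
structure Table (U : Type*) where
  mem : Mem U
  area : Bool
  n : ℕ
  count : ℕ
  left : ℕ

/-- Rebuild and resize.  A first sweep over the old table finds out how many items of the new table
wrap around its end; a second one writes the new table, into the other area, leaving room for them
at the front.  Finally the old table is erased. -/
noncomputable def rebuild {U : Type*} (E : Env U) (T : Table U) : Table U :=
  let n' := E.size T.count
  let L := sweep E false T.area T.n n' ⟨T.mem, 0, 0⟩
  let L' := sweep E true T.area T.n n' ⟨L.mem, L.next - n', 0⟩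
  { mem := (List.range T.n).foldl (fun m p => write E T.area p .free m) L'.mem
    area := !T.area
    n := n'
    count := T.count
    left := E.window n' }

/-! ### Sequences of operations -/

inductive Op (U : Type*) where
  | query (u : U)
  | insert (u : U)
  | delete (u : U)

/-- The key on which an operation takes place. -/
def Op.key {U : Type*} : Op U → U
  | .query u => u
  | .insert u => u
  | .delete u => u

/-- Perform one operation (without the rebuild that may follow it).  The answer says whether the key
was present before the operation. -/
noncomputable def perform {U : Type*} (E : Env U) (T : Table U) : Op U → Table U × Bool
  | .query u =>
    let f := find E T.area T.n u T.n 0 T.mem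
    ({ T with mem := f.1 }, f.2.isSome)
  | .insert u =>
    let f := insertFrom E T.area T.n u T.n 0 T.mem
    ({ T with
        mem := f.1
        count := if f.2 then T.count else T.count + 1
        left := T.left - 1 }, f.2)
  | .delete u =>
    let f := find E T.area T.n u T.n 0 T.mem
    match f.2 with
    | none => ({ T with mem := f.1, left := T.left - 1 }, false)
    | some p =>
      ({ T with
          mem := write E T.area p (.tomb u) f.1
          count := T.count - 1
          left := T.left - 1 }, true)

/-- Rebuild if the rebuild window is over. -/
noncomputable def maintain {U : Type*} (E : Env U) (T : Table U) : Table U :=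
  if T.left = 0 then rebuild E T else T

/-- The empty table.  The first block of each area is in internal memory. -/
def Env.empty {U : Type*} (E : Env U) : Table U where
  mem := { cell := fun _ _ => .free, cache := [(false, 0), (true, 0)], loads := 0 }
  area := false
  n := E.size 0
  count := 0
  left := E.window (E.size 0)

/-- State after the first `k` operations of the sequence `S`, starting from the empty table. -/
noncomputable def run {U : Type*} (E : Env U) (S : ℕ → Op U) : ℕ → Table U
  | 0 => E.empty
  | k + 1 => maintain E (perform E (run E S k) (S k)).1

/-- Answer to operation number `k`. -/
noncomputable def answer {U : Type*} (E : Env U) (S : ℕ → Op U) (k : ℕ) : Bool :=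
  (perform E (run E S k) (S k)).2

/-- Block transfers incurred by operation number `k`, not counting a rebuild that follows it. -/
noncomputable def opCost {U : Type*} (E : Env U) (S : ℕ → Op U) (k : ℕ) : ℕ :=
  (perform E (run E S k) (S k)).1.mem.loads - (run E S k).mem.loads

/-- Block transfers incurred by the rebuild after operation number `k` (`0` if there is none). -/
noncomputable def rebuildCost {U : Type*} (E : Env U) (S : ℕ → Op U) (k : ℕ) : ℕ :=
  (run E S (k + 1)).mem.loads - (perform E (run E S k) (S k)).1.mem.loads

/-- The set of keys present after the first `k` operations. -/
def contents {U : Type*} [DecidableEq U] (S : ℕ → Op U) : ℕ → Finset U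
  | 0 => ∅
  | k + 1 =>
    match S k with
    | .query _ => contents S k
    | .insert u => insert u (contents S k)
    | .delete u => (contents S k).erase u

/-- The table stores exactly the keys in `X`, each of them once, in its `n` slots; no memory outside
those slots is in use. -/
def Table.Stores {U : Type*} (T : Table U) (X : Finset U) : Prop :=
  (∀ u ∈ X, ∃! p, T.mem.cell T.area p = .key u) ∧
  (∀ u p, T.mem.cell T.area p = .key u → u ∈ X) ∧
  (∀ a p, T.mem.cell a p ≠ .free → a = T.area ∧ p < T.n)

open Classical in
/-- The fraction of the slots of the table that are taken by keys. -/
noncomputable def Table.loadFactor {U : Type*} (T : Table U) : ℝ :=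
  (((Finset.range T.n).filter fun p => ∃ u, T.mem.cell T.area p = .key u).card : ℝ) / T.n

/-- `H` is a uniform and fully independent random hash function with values in `[0,1)`. -/
structure IsIdealHash {U Ω : Type*} [MeasurableSpace Ω] (P : Measure Ω) (H : U → Ω → ℝ) :
    Prop where
  measurable : ∀ u, Measurable (H u)
  mem_Ico : ∀ u ω, H u ω ∈ Set.Ico (0 : ℝ) 1
  uniform : ∀ u, P.map (H u) = volume.restrict (Set.Ico (0 : ℝ) 1)
  indep : iIndepFun H P

end Graveyard

/-!
Graveyard hashing at load factor `1 - 1 / Θ(x)` with `O(1 / r)` excess block transfers.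

**Ordered tables.** The ordering of linear probing is a local condition (`Ordered`): an item that
is not in the slot of its hash has a smaller item right before it. By `Ordered.chain` it determines
the comparison of all items between the hash and the position of an item, so that a key occurs once
and searches find it. Insertions and deletions preserve the ordering (`Insertion.ordered`,
`Ordered.congr_val`). A rebuild reads the keys in sorted order (`keys_sorted`), merges them with
the artificial tombstones (`plan_spec`), and lays out the sorted list starting behind the room
needed by the items that wrap around, which yields an ordered table again (`ordered_lay`,
`rebuild_spec`). All this needs hash values in general position, which they are with probability
one (`IsIdealHash.ae_generic`).

**Long operations.** Consider an interval that ends at any slot and begins at an artificial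
tombstone still present. No insertion shifts items past that tombstone, so if it uses up a
tombstone that hashes to the interval, its key hashes to the interval as well
(`Insertion.offset_le_of_grave`). Hence the number of items hashing to the interval does not fall
until the next rebuild; this is the field `arcs` of the invariant `Inv`. It follows
(`Inv.long_operation`) that an operation passes many slots only if many items hash to an interval
ending at the slot halfway, or if as many keys new since the last rebuild hash to such an interval
as it had artificial tombstones, or if the table is tiny.

**Expected cost.** Both events say that a `backlog` is large: the largest excess of the number of
items hashing to an interval over a rate times its length. For all items the rate exceeds the load
by at least `1 / (4 * t)`, for the new keys the rate `3 / (8 * t)` exceeds it by a constant factor.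
Lindley's recursion, squared, and the fact that the distribution of the backlog is the same at all
slots bound the expectation of the backlog (`sum_backlog_le`): it is `O(t)` for all items and
`O(1)` for the new keys. Since a backlog of the new keys comes from intervals `t` times as long,
both mean that `O(t)` slots are passed in expectation. Given the hashes of the other keys, the hash
of the key `u` of the operation is uniform, so that each step to the next slot crosses a block
boundary with probability at most `2 / B`; this gives `O(t / B) = O(1 / r)` block transfers
(`sum_passCost_le`, `lintegral_opCost_le`). The size of the table and the set of keys concerned are
determined by the operations alone (`epoch`), so they are independent of the hash function.

**Rebuilds.** A rebuild scans the two areas, one block of each at a time. A potential (`pot`) that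
counts which of the two current blocks are missing from internal memory pays for the block
transfers, so that a rebuild costs `O(n / B)`, without an additive constant: a table within the
first blocks of the areas, which are in internal memory initially, is rebuilt free of charge
(`rebuild_cost`). Divided by the `Ω(n / t)` insertions and deletions before the rebuild this is
`O(t / B)` per operation (`Inv.rebuild_amortized`, `sum_rebuildCost_le`).
-/

namespace Graveyard

section

variable {U : Type*} {E : Env U} {n : ℕ}

/-! ### Offsets -/

lemma offset_lt (hn : 0 < n) (p : ℕ) (s : Slot U) : E.offset n p s < n := Nat.mod_lt _ hn

lemma home_add_offset {s : Slot U} (hs : E.home n s < n) (p : ℕ) :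
    E.home n s + E.offset n p s ≡ p [MOD n] := by
  have h1 : E.offset n p s ≡ p + n - E.home n s [MOD n] := Nat.mod_modEq _ _
  have h2 := h1.add_left (E.home n s)
  rw [show E.home n s + (p + n - E.home n s) = p + n by omega] at h2
  exact h2.trans (by simp [Nat.ModEq])

lemma offset_eq {s : Slot U} (hs : E.home n s < n) {p o : ℕ} (ho : o < n)
    (h : E.home n s + o ≡ p [MOD n]) : E.offset n p s = o := by
  have h1 := (home_add_offset hs p).trans h.symm
  exact Nat.ModEq.eq_of_lt_of_lt (Nat.ModEq.add_left_cancel' _ h1) (offset_lt (by omega) _ _) ho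

lemma offset_congr {s : Slot U} (hs : E.home n s < n) {p q : ℕ} (h : p ≡ q [MOD n]) :
    E.offset n p s = E.offset n q s :=
  offset_eq hs (offset_lt (by omega) _ _) ((home_add_offset hs q).trans h.symm)

lemma offset_add {s : Slot U} (hs : E.home n s < n) {p k : ℕ} (h : E.offset n p s + k < n) :
    E.offset n (p + k) s = E.offset n p s + k := by
  refine offset_eq hs h ?_
  rw [← add_assoc]
  exact (home_add_offset hs p).add_right k

lemma offset_of_home_add {s : Slot U} (hs : E.home n s < n) {b i : ℕ} (hb : E.home n s = b)
    (hi : i < n) : E.offset n (b + i) s = i :=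
  offset_eq hs hi (by rw [hb])

lemma home_eq_of_offset_eq {s s' : Slot U} (hs : E.home n s < n) (hs' : E.home n s' < n) {p : ℕ}
    (h : E.offset n p s = E.offset n p s') : E.home n s = E.home n s' := by
  have h1 := (home_add_offset hs p).trans (home_add_offset hs' p).symm
  rw [h] at h1
  exact Nat.ModEq.eq_of_lt_of_lt (Nat.ModEq.add_right_cancel' _ h1) hs hs'

lemma offset_eq_of_home_eq {s s' : Slot U} (h : E.home n s = E.home n s') (p : ℕ) :
    E.offset n p s = E.offset n p s' := by simp [Env.offset, h]

/-- Every slot is met by going around the table once from any starting point. -/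
lemma exists_add_modEq (hn : 0 < n) (b p : ℕ) : ∃ k < n, b + k ≡ p [MOD n] := by
  refine ⟨(p + n - b % n) % n, Nat.mod_lt _ hn, ?_⟩
  have hb := Nat.mod_lt b hn
  have h1 : (p + n - b % n) % n ≡ p + n - b % n [MOD n] := Nat.mod_modEq _ _
  have h2 := (Nat.mod_modEq b n).symm.add h1
  rw [show b % n + (p + n - b % n) = p + n by omega] at h2
  exact h2.trans (by simp [Nat.ModEq])

lemma add_mod_inj {b i j : ℕ} (hi : i < n) (hj : j < n) (h : (b + i) % n = (b + j) % n) :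
    i = j :=
  Nat.ModEq.eq_of_lt_of_lt (Nat.ModEq.add_left_cancel' b h) hi hj

/-! ### Ordered tables -/

/-- The item `s` in slot `p` comes before the item `s'` in slot `q`.  Slots are numbered along an
unrolled copy of the table, in which the hash of `s` is `p - offset`; items of equal hash are
compared by unrounded hash. -/
def Env.Precedes (E : Env U) (n p : ℕ) (s : Slot U) (q : ℕ) (s' : Slot U) : Prop :=
  E.offset n q s' + p < E.offset n p s + q ∨
    (E.offset n q s' + p = E.offset n p s + q ∧ E.val n s < E.val n s')

lemma Env.Precedes.trans {p q r : ℕ} {s s' s'' : Slot U} (h : E.Precedes n p s q s')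
    (h' : E.Precedes n q s' r s'') : E.Precedes n p s r s'' := by
  rcases h with h | ⟨h, hv⟩ <;> rcases h' with h' | ⟨h', hv'⟩
  · left; omega
  · left; omega
  · left; omega
  · right; exact ⟨by omega, hv.trans hv'⟩

lemma Env.Precedes.le {p q : ℕ} {s s' : Slot U} (h : E.Precedes n p s q s') :
    E.offset n q s' + p ≤ E.offset n p s + q := by
  rcases h with h | ⟨h, -⟩ <;> omega

/-- The contents `c` of a table of `n` slots obey the ordering of linear probing: an item outside
the slot to which it hashes is preceded, in the slot before, by a strictly smaller item.  This local
condition yields all comparisons between distant slots (`Ordered.chain`).  Strictness includes that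
unrounded hashes do not repeat. -/
structure Ordered (E : Env U) (n : ℕ) (c : ℕ → Slot U) : Prop where
  home_lt : ∀ p, E.home n (c p) < n
  step : ∀ p, c ((p + 1) % n) ≠ .free → E.offset n (p + 1) (c ((p + 1) % n)) ≠ 0 →
    c (p % n) ≠ .free ∧ E.Precedes n p (c (p % n)) (p + 1) (c ((p + 1) % n))

namespace Ordered

variable {c : ℕ → Slot U}

lemma pos (h : Ordered E n c) : 0 < n := lt_of_le_of_lt (Nat.zero_le _) (h.home_lt 0)

/-- All slots between the hash of an item and its position hold smaller items. -/
lemma chain (h : Ordered E n c) {p q : ℕ} (hpq : p < q) (hq : c (q % n) ≠ .free)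
    (ho : q ≤ p + E.offset n q (c (q % n))) :
    c (p % n) ≠ .free ∧ E.Precedes n p (c (p % n)) q (c (q % n)) := by
  obtain ⟨k, rfl⟩ := Nat.exists_eq_add_of_lt hpq
  clear hpq
  induction k with
  | zero => exact h.step p hq (by simp at ho ⊢; omega)
  | succ k ih =>
    obtain ⟨h1, h2⟩ := h.step (p + k + 1) hq (by
      rw [show p + (k + 1) + 1 = p + k + 1 + 1 by ring] at ho; omega)
    have := h2.le
    rw [show p + (k + 1) + 1 = p + k + 1 + 1 by ring] at ho ⊢
    obtain ⟨h3, h4⟩ := ih h1 (by omega)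
    exact ⟨h3, h4.trans h2⟩

/-- Along the unrolled table the hashes of the items do not decrease. If slot `p` is free, the
inequality still holds, as the item in slot `q` then hashes to a slot after `p`. -/
lemma offset_growth (h : Ordered E n c) {p q : ℕ} (hpq : p ≤ q) (hq : c (q % n) ≠ .free) :
    E.offset n q (c (q % n)) + p ≤ E.offset n p (c (p % n)) + q := by
  rcases hpq.eq_or_lt with rfl | hlt
  · omega
  by_cases ho : q ≤ p + E.offset n q (c (q % n))
  · exact (h.chain hlt hq ho).2.le
  · omega

/-- An item behind a free slot hashes to a slot behind it. -/
lemma offset_lt_of_free (h : Ordered E n c) {z q : ℕ} (hz : c (z % n) = .free) (hzq : z < q)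
    (hq : c (q % n) ≠ .free) : E.offset n q (c (q % n)) + z < q := by
  by_contra hcon
  exact (h.chain hzq hq (by omega)).1 hz

lemma exists_free (h : Ordered E n c) (hf : ∃ z, c (z % n) = .free) (b : ℕ) :
    ∃ k < n, c ((b + k) % n) = .free := by
  obtain ⟨z, hz⟩ := hf
  obtain ⟨k, hk, hkz⟩ := exists_add_modEq h.pos b z
  exact ⟨k, hk, by rw [hkz]; exact hz⟩

/-- In a table with a free slot no item can be displaced all around the table. -/
lemma offset_add_one_lt (h : Ordered E n c) (hf : ∃ z, c (z % n) = .free) {p : ℕ}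
    (hp : c (p % n) ≠ .free) : E.offset n p (c (p % n)) + 1 < n := by
  obtain ⟨k, hk, hkz⟩ := h.exists_free hf p
  have h0 : k ≠ 0 := by rintro rfl; exact hp hkz
  have h1 := h.offset_lt_of_free (z := p + k) (q := p + n) hkz (by omega) (by simpa using hp)
  have h2 : E.offset n (p + n) (c ((p + n) % n)) = E.offset n p (c (p % n)) := by
    rw [Nat.add_mod_right]
    exact offset_congr (h.home_lt _) (by simp [Nat.ModEq])
  omega

/-- Different slots hold items of different unrounded hashes. -/
lemma eq_of_val_eq (h : Ordered E n c) {p q : ℕ} (hp : p < n) (hq : q < n) (hpf : c p ≠ .free)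
    (hqf : c q ≠ .free) (hv : E.val n (c p) = E.val n (c q)) : p = q := by
  wlog hle : E.offset n p (c p) ≤ E.offset n q (c q) generalizing p q
  · exact (this hq hp hqf hpf hv.symm (by omega)).symm
  have hh : E.home n (c p) = E.home n (c q) := by simp [Env.home, hv]
  obtain ⟨k, hk⟩ := Nat.exists_eq_add_of_le hle
  have h1 := home_add_offset (h.home_lt p) p
  have h2 := home_add_offset (h.home_lt q) q
  rw [← hh, hk, ← add_assoc] at h2
  have h3 : p + k ≡ q [MOD n] := (h1.symm.add_right k).trans h2
  have hpn : p % n = p := Nat.mod_eq_of_lt hp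
  have h4 : (p + k) % n = q := by rw [h3]; exact Nat.mod_eq_of_lt hq
  rcases Nat.eq_zero_or_pos k with rfl | hk0
  · rw [← hpn]; simpa using h4
  exfalso
  have h5 : E.offset n (p + k) (c q) = E.offset n q (c q) := offset_congr (h.home_lt q) h3
  have h6 := (h.chain (p := p) (q := p + k) (by omega) (by rw [h4]; exact hqf) (by
    rw [h4, h5]; omega)).2
  rw [h4, hpn] at h6
  rcases h6 with h6 | ⟨-, h6⟩
  · omega
  · exact h6.ne hv

end Ordered

lemma val_nonneg (hH : ∀ u, E.H u ∈ Set.Ico (0 : ℝ) 1) (n : ℕ) (s : Slot U) : 0 ≤ E.val n s := by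
  cases s with
  | free => simp [Env.val]
  | key u => exact mul_nonneg (hH u).1 (Nat.cast_nonneg _)
  | tomb u => exact mul_nonneg (hH u).1 (Nat.cast_nonneg _)
  | grave a => simp [Env.val]

lemma home_key_lt (hH : ∀ u, E.H u ∈ Set.Ico (0 : ℝ) 1) (hn : 0 < n) (u : U) :
    E.home n (.key u) < n := by
  have hn' : (0 : ℝ) < n := by exact_mod_cast hn
  have := (hH u).2
  refine (Nat.floor_lt (val_nonneg hH n (.key u))).2 ?_
  simp only [Env.val]
  nlinarith

/-- A key in the table lies behind smaller items only. -/
lemma Ordered.smaller_of_key {c : ℕ → Slot U} (h : Ordered E n c) {u : U} {p : ℕ} (hp : p < n)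
    (hk : c p = .key u) {i : ℕ} (hi : i < E.offset n p (.key u)) :
    c ((E.home n (.key u) + i) % n) ≠ .free ∧
      E.Smaller n u i (c ((E.home n (.key u) + i) % n)) := by
  have hu : E.home n (.key u) < n := by rw [← hk]; exact h.home_lt p
  set o := E.offset n p (.key u) with ho
  have hon : o < n := offset_lt (by omega) _ _
  have h1 : (E.home n (.key u) + o) % n = p := by
    rw [home_add_offset hu p]; exact Nat.mod_eq_of_lt hp
  have h2 := offset_of_home_add hu rfl hon
  have h3 := h.chain (p := E.home n (.key u) + i) (q := E.home n (.key u) + o) (by omega)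
    (by rw [h1, hk]; simp) (by rw [h1, hk, h2]; omega)
  refine ⟨h3.1, ?_⟩
  have h4 := h3.2
  rw [h1, hk] at h4
  rcases h4 with h4 | ⟨h4, hv⟩
  · left; rw [h2] at h4; omega
  · right; rw [h2] at h4; exact ⟨by omega, hv⟩

lemma not_greater_of_smaller {u : U} {i : ℕ} {s : Slot U} (h : E.Smaller n u i s) :
    ¬ E.Greater n u i s := by
  rintro (h' | ⟨h', hv'⟩) <;> rcases h with h | ⟨h, hv⟩
  · omega
  · omega
  · omega
  · exact lt_asymm hv hv'

lemma ne_key_of_smaller {u : U} {i : ℕ} {s : Slot U} (hu : E.home n (.key u) < n) (hi : i < n)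
    (h : E.Smaller n u i s) : s ≠ .key u := by
  rintro rfl
  rw [Env.Smaller, offset_of_home_add hu rfl hi] at h
  rcases h with h | ⟨-, h⟩
  · omega
  · exact lt_irrefl _ h

section

variable {a : Bool}

/-! ### Memory accesses -/

@[simp] lemma touch_cell (p : ℕ) (m : Mem U) : (touch E a p m).cell = m.cell := by
  unfold touch; split_ifs <;> rfl

@[simp] lemma write_loads (p : ℕ) (s : Slot U) (m : Mem U) :
    (write E a p s m).loads = (touch E a p m).loads := rfl

@[simp] lemma write_cache (p : ℕ) (s : Slot U) (m : Mem U) :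
    (write E a p s m).cache = (touch E a p m).cache := rfl

@[simp] lemma write_cell (p : ℕ) (s : Slot U) (m : Mem U) :
    (write E a p s m).cell = Function.update m.cell a (Function.update (m.cell a) p s) := rfl

lemma le_touch_loads (p : ℕ) (m : Mem U) : m.loads ≤ (touch E a p m).loads := by
  unfold touch; split_ifs <;> simp

lemma touch_loads_le (p : ℕ) (m : Mem U) : (touch E a p m).loads ≤ m.loads + 1 := by
  unfold touch; split_ifs <;> simp

lemma touch_loads_of_head {p : ℕ} {m : Mem U} (h : m.cache.head? = some (a, p / E.B)) :
    (touch E a p m).loads = m.loads := by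
  unfold touch
  rw [if_pos (List.mem_of_head? h)]

lemma touch_head (hf : 0 < E.frames) (p : ℕ) (m : Mem U) :
    (touch E a p m).cache.head? = some (a, p / E.B) := by
  unfold touch
  split_ifs
  · rfl
  · obtain ⟨k, hk⟩ := Nat.exists_eq_succ_of_ne_zero hf.ne'
    simp [hk]

/-- `1` if going from slot `p` to the next one leads to another block, `0` otherwise. -/
def edge (E : Env U) (n p : ℕ) : ℕ := if (p % n) / E.B = ((p + 1) % n) / E.B then 0 else 1

lemma touch_next_loads {p : ℕ} {m : Mem U} (h : m.cache.head? = some (a, p % n / E.B)) :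
    (touch E a ((p + 1) % n) m).loads ≤ m.loads + edge E n p := by
  unfold edge
  split_ifs with h1
  · rw [touch_loads_of_head (by rw [← h1]; exact h)]; omega
  · exact touch_loads_le _ _

/-! ### Searching -/

lemma find_cell (u : U) (fuel i : ℕ) (m : Mem U) : (find E a n u fuel i m).1.cell = m.cell := by
  induction fuel generalizing i m with
  | zero => rfl
  | succ fuel ih =>
    unfold find
    dsimp only
    split
    · simp
    · split_ifs
      · simp
      · simp
      · rw [ih]; simp

lemma find_some {u : U} {fuel i p : ℕ} {m : Mem U} (h : (find E a n u fuel i m).2 = some p) :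
    m.cell a p = .key u := by
  induction fuel generalizing i m with
  | zero => simp [find] at h
  | succ fuel ih =>
    unfold find at h
    dsimp only at h
    split at h
    · simp at h
    · split_ifs at h with h1 h2
      · simp only [Option.some.injEq] at h
        rw [← h]; exact h1
      · simpa using ih h

/-- The search stops at the block of the key that it has found, so a deletion marks the key at no
further cost. -/
lemma find_head (hf : 0 < E.frames) {u : U} {fuel i p : ℕ} {m : Mem U}
    (h : (find E a n u fuel i m).2 = some p) :
    (find E a n u fuel i m).1.cache.head? = some (a, p / E.B) := by
  induction fuel generalizing i m with
  | zero => simp [find] at h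
  | succ fuel ih =>
    unfold find at h ⊢
    dsimp only at h ⊢
    split at h
    · simp at h
    · split_ifs at h ⊢ with h1 h2
      · simp only [Option.some.injEq] at h
        rw [← h]; exact touch_head hf _ _
      · exact ih h

/-- A search finds its key at distance `o` if it passes the slots before. -/
lemma find_of_key {u : U} {c : ℕ → Slot U} {o : ℕ}
    (ho : c ((E.home n (.key u) + o) % n) = .key u)
    (hlt : ∀ i < o, c ((E.home n (.key u) + i) % n) ≠ .free ∧
      c ((E.home n (.key u) + i) % n) ≠ .key u ∧
      ¬ E.Greater n u i (c ((E.home n (.key u) + i) % n)))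
    {fuel i : ℕ} {m : Mem U} (hm : m.cell a = c) (hi : i ≤ o) (hfuel : o < i + fuel) :
    (find E a n u fuel i m).2 = some ((E.home n (.key u) + o) % n) := by
  induction fuel generalizing i m with
  | zero => omega
  | succ fuel ih =>
    unfold find
    dsimp only
    rcases hi.eq_or_lt with rfl | hi
    · rw [hm, ho]; simp
    · obtain ⟨h1, h2, h3⟩ := hlt i hi
      rw [hm]
      split
      · contradiction
      · rw [if_neg h2, if_neg h3]
        exact ih (by simp [hm]) hi (by omega)

/-- The slots passed by a search (at distances `i ≤ j < D`), and its cost after the first access. -/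
lemma find_cost (hf : 0 < E.frames) (u : U) (fuel i : ℕ) (m : Mem U) :
    ∃ D, i ≤ D ∧ (∀ j, i ≤ j → j < D → m.cell a ((E.home n (.key u) + j) % n) ≠ .free ∧
        ¬ E.Greater n u j (m.cell a ((E.home n (.key u) + j) % n))) ∧
      (find E a n u fuel i m).1.loads ≤ (touch E a ((E.home n (.key u) + i) % n) m).loads +
        ∑ d ∈ Finset.Ico i D, edge E n (E.home n (.key u) + d) := by
  induction fuel generalizing i m with
  | zero =>
    exact ⟨i, le_rfl, fun j h1 h2 => by omega, by simpa [find] using le_touch_loads _ _⟩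
  | succ fuel ih =>
    unfold find
    dsimp only
    have halt : ∃ D, i ≤ D ∧ (∀ j, i ≤ j → j < D →
        m.cell a ((E.home n (.key u) + j) % n) ≠ .free ∧
        ¬ E.Greater n u j (m.cell a ((E.home n (.key u) + j) % n))) ∧
      (touch E a ((E.home n (.key u) + i) % n) m).loads ≤
        (touch E a ((E.home n (.key u) + i) % n) m).loads +
        ∑ d ∈ Finset.Ico i D, edge E n (E.home n (.key u) + d) :=
      ⟨i, le_rfl, fun j h1 h2 => by omega, by simp⟩
    split
    · exact halt
    · rename_i hfree
      split_ifs with h1 h2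
      · exact halt
      · exact halt
      · obtain ⟨D, hD, hpass, hcost⟩ :=
          ih (i + 1) (touch E a ((E.home n (.key u) + i) % n) m)
        refine ⟨D, by omega, fun j hj hjD => ?_, ?_⟩
        · rcases hj.eq_or_lt with rfl | hj
          · exact ⟨hfree, h2⟩
          · simpa using hpass j hj hjD
        · refine hcost.trans ?_
          have := touch_next_loads (E := E) (n := n) (a := a) (p := E.home n (.key u) + i)
            (touch_head hf ((E.home n (.key u) + i) % n) m)
          rw [Finset.sum_eq_sum_Ico_succ_bot (by omega : i < D)]
          rw [← add_assoc (E.home n (.key u)) i 1]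
          omega

/-! ### Insertion -/

/-- The slot holds a key; these are the slots whose contents an insertion shifts on. -/
def Slot.IsKey : Slot U → Prop
  | .key _ => True
  | _ => False

/-- Contents of the memory after shifting `l` keys, and the cost after the first access. -/
lemma shift_spec (hf : 0 < E.frames) {l : ℕ} (hl : l < n) {p : ℕ} {s : Slot U} {m : Mem U}
    {fuel : ℕ} (hfuel : l < fuel) (hk : ∀ j < l, (m.cell a ((p + j) % n)).IsKey)
    (hlk : ¬ (m.cell a ((p + l) % n)).IsKey) :
    (shift E a n fuel (p % n) s m).cell a (p % n) = s ∧
    (∀ j < l, (shift E a n fuel (p % n) s m).cell a ((p + j + 1) % n) =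
      m.cell a ((p + j) % n)) ∧
    (∀ q, (∀ j ≤ l, q ≠ (p + j) % n) →
      (shift E a n fuel (p % n) s m).cell a q = m.cell a q) ∧
    (∀ b, b ≠ a → (shift E a n fuel (p % n) s m).cell b = m.cell b) ∧
    (shift E a n fuel (p % n) s m).loads ≤ (touch E a (p % n) m).loads +
      ∑ j ∈ Finset.range l, edge E n (p + j) := by
  induction l generalizing p s m fuel with
  | zero =>
    obtain ⟨fuel, rfl⟩ := Nat.exists_eq_succ_of_ne_zero (by omega : fuel ≠ 0)
    have : shift E a n (fuel + 1) (p % n) s m = write E a (p % n) s m := by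
      unfold shift
      split
      · rename_i v hv
        simp [hv, Slot.IsKey] at hlk
      · rfl
    rw [Nat.succ_eq_add_one, this]
    refine ⟨by simp, by simp, fun q hq => ?_, fun b hb => ?_, by simp⟩
    · have := hq 0 le_rfl
      simp at this
      simp [this]
    · simp [hb]
  | succ l ih =>
    obtain ⟨fuel, rfl⟩ := Nat.exists_eq_succ_of_ne_zero (by omega : fuel ≠ 0)
    obtain ⟨v, hv⟩ : ∃ v, m.cell a (p % n) = .key v := by
      have := hk 0 (by omega)
      simp only [add_zero] at this
      cases h : m.cell a (p % n) <;> simp [h, Slot.IsKey] at this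
      exact ⟨_, rfl⟩
    have hsh : shift E a n (fuel + 1) (p % n) s m =
        shift E a n fuel ((p + 1) % n) (.key v) (write E a (p % n) s m) := by
      conv_lhs => unfold shift
      rw [hv]
      simp
    have hne : ∀ j, j < l + 1 → (p + 1 + j) % n ≠ p % n := by
      intro j hj h
      have := add_mod_inj (n := n) (b := p) (i := 1 + j) (j := 0) (by omega) (by omega)
        (by rw [← add_assoc]; simpa using h)
      omega
    have hw : ∀ j, j < l + 1 →
        (write E a (p % n) s m).cell a ((p + 1 + j) % n) = m.cell a ((p + (j + 1)) % n) := by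
      intro j hj
      simp only [write_cell, Function.update_self]
      rw [Function.update_of_ne (hne j hj)]
      congr 2; ring
    obtain ⟨h1, h2, h3, h4, h5⟩ := ih (p := p + 1) (s := .key v) (m := write E a (p % n) s m)
      (fuel := fuel) (by omega) (by omega)
      (fun j hj => by rw [hw j (by omega)]; exact hk (j + 1) (by omega))
      (by rw [hw l (by omega)]; exact hlk)
    rw [Nat.succ_eq_add_one, hsh]
    refine ⟨?_, ?_, ?_, ?_, ?_⟩
    · rw [h3]
      · simp
      · intro j hj
        exact (hne j (by omega)).symm
    · intro j hj
      cases j with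
      | zero => simp only [add_zero]; rw [h1, hv]
      | succ j =>
        have := h2 j (by omega)
        rw [hw j (by omega)] at this
        rw [← this]
        congr 2; ring
    · intro q hq
      have hq0 : q ≠ p % n := by simpa using hq 0 (by omega)
      rw [h3 q]
      · simp [hq0]
      · intro j hj
        have := hq (j + 1) (by omega)
        rwa [show p + 1 + j = p + (j + 1) by ring]
    · intro b hb
      rw [h4 b hb]; simp [hb]
    · refine h5.trans ?_
      have := touch_next_loads (E := E) (n := n) (a := a) (p := p)
        (m := write E a (p % n) s m) (by simpa using touch_head hf (p % n) m)
      rw [Finset.sum_range_succ']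
      have h6 : ∑ j ∈ Finset.range l, edge E n (p + 1 + j) =
          ∑ j ∈ Finset.range l, edge E n (p + (j + 1)) :=
        Finset.sum_congr rfl fun j _ => by congr 1; ring
      rw [h6]
      simp at this ⊢
      omega

open Classical in
/-- An insertion passes the smaller items; at the next slot it finds its key or starts shifting. -/
lemma insertFrom_spec (hf : 0 < E.frames) {u : U} {k : ℕ} {fuel i : ℕ} {m : Mem U}
    (hpass : ∀ j, i ≤ j → j < k → m.cell a ((E.home n (.key u) + j) % n) ≠ .free ∧
      m.cell a ((E.home n (.key u) + j) % n) ≠ .key u ∧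
      E.Smaller n u j (m.cell a ((E.home n (.key u) + j) % n)))
    (hend : m.cell a ((E.home n (.key u) + k) % n) = .free ∨
      ¬ E.Smaller n u k (m.cell a ((E.home n (.key u) + k) % n)))
    (hi : i ≤ k) (hfuel : k < i + fuel) :
    ∃ m' : Mem U, m'.cell = m.cell ∧
      m'.cache.head? = some (a, (E.home n (.key u) + k) % n / E.B) ∧
      m'.loads ≤ (touch E a ((E.home n (.key u) + i) % n) m).loads +
        ∑ d ∈ Finset.Ico i k, edge E n (E.home n (.key u) + d) ∧
      insertFrom E a n u fuel i m =
        if m.cell a ((E.home n (.key u) + k) % n) = .key u then (m', true)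
        else (shift E a n n ((E.home n (.key u) + k) % n) (.key u) m', false) := by
  induction fuel generalizing i m with
  | zero => omega
  | succ fuel ih =>
    unfold insertFrom
    dsimp only
    rcases hi.eq_or_lt with rfl | hi
    · refine ⟨touch E a ((E.home n (.key u) + i) % n) m, by simp, touch_head hf _ _, by simp, ?_⟩
      split
      · rename_i h
        rw [h]; simp
      · rename_i h
        split_ifs with h1 h2
        · rfl
        · exact hend.elim (fun h' => (h h').elim) fun h' => absurd h2 h'
        · rfl
    · obtain ⟨h1, h2, h3⟩ := hpass i le_rfl hi
      obtain ⟨m', hm1, hm2, hm3, hm4⟩ := ih (i := i + 1)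
        (m := touch E a ((E.home n (.key u) + i) % n) m)
        (fun j hj hjk => by simpa using hpass j (by omega) hjk) (by simpa using hend) hi (by omega)
      refine ⟨m', by simpa using hm1, hm2, ?_, ?_⟩
      · refine hm3.trans ?_
        have := touch_next_loads (E := E) (n := n) (a := a) (p := E.home n (.key u) + i)
          (touch_head hf ((E.home n (.key u) + i) % n) m)
        rw [Finset.sum_eq_sum_Ico_succ_bot (by omega : i < k)]
        rw [← add_assoc (E.home n (.key u)) i 1]
        omega
      · split
        · contradiction
        · rw [if_neg h2, if_pos h3, hm4]
          simp

/-! ### Quantities that no access increases -/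

/-- If no access to the table increases `Φ`, no search does; `Φ` may be a potential, or a quantity
that turns positive when `loads` decreases. -/
lemma find_mono {Φ : Mem U → ℕ} (hn : 0 < n)
    (ht : ∀ m p, p < n → Φ (touch E a p m) ≤ Φ m) (u : U) (fuel i : ℕ)
    (m : Mem U) : Φ (find E a n u fuel i m).1 ≤ Φ m := by
  induction fuel generalizing i m with
  | zero => exact le_rfl
  | succ fuel ih =>
    have h := ht m _ (Nat.mod_lt (E.home n (.key u) + i) hn)
    unfold find
    dsimp only
    split
    · exact h
    · split_ifs
      · exact h
      · exact h
      · exact (ih _ _).trans h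

lemma shift_mono {Φ : Mem U → ℕ} (hn : 0 < n)
    (hw : ∀ m p s, p < n → Φ (write E a p s m) ≤ Φ m) (fuel p : ℕ) (hp : p < n)
    (s : Slot U) (m : Mem U) : Φ (shift E a n fuel p s m) ≤ Φ m := by
  induction fuel generalizing p s m with
  | zero => exact le_rfl
  | succ fuel ih =>
    unfold shift
    split
    · exact (ih _ (Nat.mod_lt _ hn) _ _).trans (hw m p s hp)
    · exact hw m p s hp

lemma insertFrom_mono {Φ : Mem U → ℕ} (hn : 0 < n)
    (ht : ∀ m p, p < n → Φ (touch E a p m) ≤ Φ m)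
    (hw : ∀ m p s, p < n → Φ (write E a p s m) ≤ Φ m) (u : U) (fuel i : ℕ) (m : Mem U) :
    Φ (insertFrom E a n u fuel i m).1 ≤ Φ m := by
  induction fuel generalizing i m with
  | zero => exact le_rfl
  | succ fuel ih =>
    have h := ht m _ (Nat.mod_lt (E.home n (.key u) + i) hn)
    unfold insertFrom
    dsimp only
    split
    · exact (shift_mono hn hw _ _ (Nat.mod_lt _ hn) _ _).trans h
    · split_ifs
      · exact h
      · exact (ih _ _).trans h
      · exact (shift_mono hn hw _ _ (Nat.mod_lt _ hn) _ _).trans h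

end

/-! ### Ordered tables under insertions and deletions -/

lemma home_eq_of_val_eq {s s' : Slot U} (h : E.val n s = E.val n s') :
    E.home n s = E.home n s' := by simp [Env.home, h]

/-- The ordering depends on the unrounded hashes only. Hence replacing a key by its tombstone
preserves it. -/
lemma Ordered.congr_val {c c' : ℕ → Slot U} (h : Ordered E n c)
    (hfree : ∀ p, c' p = .free ↔ c p = .free) (hv : ∀ p, E.val n (c' p) = E.val n (c p)) :
    Ordered E n c' := by
  have ho : ∀ p q, E.offset n q (c' p) = E.offset n q (c p) := fun p q =>
    offset_eq_of_home_eq (home_eq_of_val_eq (hv p)) q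
  refine ⟨fun p => by rw [home_eq_of_val_eq (hv p)]; exact h.home_lt p, fun p h1 h2 => ?_⟩
  rw [ho] at h2
  rw [ne_eq, hfree] at h1 ⊢
  obtain ⟨h3, h4⟩ := h.step p h1 h2
  refine ⟨h3, ?_⟩
  unfold Env.Precedes at h4 ⊢
  rwa [ho, ho, hv, hv]

/-- It suffices to check the ordering condition once around the table. -/
lemma Ordered.of_base {c : ℕ → Slot U} (hn : 0 < n) (hlt : ∀ p, E.home n (c p) < n) (b : ℕ)
    (h : ∀ j < n, c ((b + j + 1) % n) ≠ .free →
      E.offset n (b + j + 1) (c ((b + j + 1) % n)) ≠ 0 →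
      c ((b + j) % n) ≠ .free ∧
        E.Precedes n (b + j) (c ((b + j) % n)) (b + j + 1) (c ((b + j + 1) % n))) :
    Ordered E n c := by
  refine ⟨hlt, fun p h1 h2 => ?_⟩
  obtain ⟨j, hj, hjp⟩ := exists_add_modEq hn b p
  have hjp' : b + j + 1 ≡ p + 1 [MOD n] := hjp.add_right 1
  have e1 : (b + j) % n = p % n := hjp
  have e2 : (b + j + 1) % n = (p + 1) % n := hjp'
  have o1 := offset_congr (hlt (p % n)) hjp
  have o2 := offset_congr (hlt ((p + 1) % n)) hjp'
  have := h j hj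
  rw [e1, e2] at this
  unfold Env.Precedes at this ⊢
  rw [o1, o2] at this
  obtain ⟨h3, h4⟩ := this h1 h2
  exact ⟨h3, h4.imp (fun h => by omega) fun h => ⟨by omega, h.2⟩⟩

lemma Ordered.adjacent {c : ℕ → Slot U} (h : Ordered E n c) {p : ℕ}
    (hq : c ((p + 1) % n) ≠ .free) :
    E.Precedes n p (c (p % n)) (p + 1) (c ((p + 1) % n)) := by
  by_cases h0 : E.offset n (p + 1) (c ((p + 1) % n)) = 0
  · left; omega
  · exact (h.step p hq h0).2

/-- The contents `c'` of the table arise from `c` by inserting the key `u`, absent before, at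
distance `i` from its hash, shifting `l` keys on and using up the tombstone or free slot behind
them. -/
structure Insertion (E : Env U) (n : ℕ) (u : U) (i l : ℕ) (c c' : ℕ → Slot U) : Prop where
  lt : i + l < n
  smaller : ∀ j < i, c ((E.home n (.key u) + j) % n) ≠ .free ∧
    E.Smaller n u j (c ((E.home n (.key u) + j) % n))
  halt : c ((E.home n (.key u) + i) % n) = .free ∨
    ¬ E.Smaller n u i (c ((E.home n (.key u) + i) % n))
  keys : ∀ j < l, (c ((E.home n (.key u) + i + j) % n)).IsKey
  last : ¬ (c ((E.home n (.key u) + i + l) % n)).IsKey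
  new : c' ((E.home n (.key u) + i) % n) = .key u
  shifted : ∀ j < l, c' ((E.home n (.key u) + i + j + 1) % n) =
    c ((E.home n (.key u) + i + j) % n)
  rest : ∀ q, (∀ j ≤ l, q ≠ (E.home n (.key u) + i + j) % n) → c' q = c q
  home_lt : E.home n (.key u) < n
  val_ne : ∀ p, (c p).IsKey → E.val n (c p) ≠ E.val n (.key u)

lemma Slot.IsKey.ne_free {s : Slot U} (h : s.IsKey) : s ≠ .free := by rintro rfl; exact h

namespace Insertion

variable {u : U} {i l : ℕ} {c c' : ℕ → Slot U}

lemma rest' (I : Insertion E n u i l c c') {j : ℕ} (hj : l < j) (hjn : j < n) :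
    c' ((E.home n (.key u) + i + j) % n) = c ((E.home n (.key u) + i + j) % n) := by
  refine I.rest _ fun j' hj' h => ?_
  have := add_mod_inj hjn (by omega) h
  omega

/-- The new key lies at distance `i` from its hash. -/
lemma offset_new (I : Insertion E n u i l c c') :
    E.offset n (E.home n (.key u) + i) (.key u) = i :=
  offset_of_home_add I.home_lt rfl (by have := I.lt; omega)

/-- The item found in the place of the new key is not smaller. -/
lemma le_first (I : Insertion E n u i l c c') (h : c ((E.home n (.key u) + i) % n) ≠ .free) :
    E.offset n (E.home n (.key u) + i) (c ((E.home n (.key u) + i) % n)) < i ∨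
    (E.offset n (E.home n (.key u) + i) (c ((E.home n (.key u) + i) % n)) = i ∧
      E.val n (.key u) ≤ E.val n (c ((E.home n (.key u) + i) % n))) := by
  have h1 := I.halt.resolve_left h
  rw [Env.Smaller, not_or, not_and, not_lt, not_lt] at h1
  rcases h1.1.eq_or_lt with h2 | h2
  · exact Or.inr ⟨h2, h1.2 h2⟩
  · exact Or.inl h2

/-- Insertions keep tables ordered: every shifted key moves one slot away from its hash and keeps
its predecessor or gets the new key in front of it, and the item behind the slot used up stays
larger than everything before it. -/
lemma ordered (I : Insertion E n u i l c c') (h : Ordered E n c)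
    (hf : ∃ z, c (z % n) = .free) : Ordered E n c' := by
  have hlt := I.lt
  have hn := h.pos
  set b := E.home n (.key u) + i with hb
  have move : ∀ j < l, E.offset n (b + j + 1) (c ((b + j) % n)) =
      E.offset n (b + j) (c ((b + j) % n)) + 1 := fun j hj =>
    offset_add (h.home_lt _) (h.offset_add_one_lt hf (I.keys j hj).ne_free)
  have hnew := I.offset_new
  rw [← hb] at hnew
  have first : 0 < l → E.Precedes n b (.key u) b (c (b % n)) := by
    intro hl
    have hk : (c (b % n)).IsKey := by simpa using I.keys 0 hl
    have h1 := I.le_first hk.ne_free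
    rw [← hb] at h1
    unfold Env.Precedes
    rw [hnew]
    exact h1.imp (fun h => by omega) fun h =>
      ⟨by omega, lt_of_le_of_ne h.2 (I.val_ne _ hk).symm⟩
  refine Ordered.of_base hn (fun p => ?_) b fun j hj h1 h2 => ?_
  · obtain ⟨j, hj, hjp⟩ := exists_add_modEq hn b (p % n)
    by_cases hp : p < n
    · have hjp' : (b + j) % n = p := by rw [hjp]; simp [Nat.mod_eq_of_lt hp]
      rw [← hjp']
      rcases Nat.eq_zero_or_pos j with rfl | hj0
      · rw [add_zero, I.new]; exact I.home_lt
      · by_cases hjl : j ≤ l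
        · obtain ⟨j, rfl⟩ := Nat.exists_eq_succ_of_ne_zero hj0.ne'
          rw [Nat.succ_eq_add_one, ← add_assoc, I.shifted j (by omega)]
          exact h.home_lt _
        · rw [I.rest' (by omega) hj]; exact h.home_lt _
    · rw [I.rest p fun j' _ h' => hp (h' ▸ Nat.mod_lt _ hn)]
      exact h.home_lt _
  · rcases lt_trichotomy j l with hjl | hjl | hjl
    · rw [I.shifted j hjl] at h1 h2 ⊢
      rcases Nat.eq_zero_or_pos j with rfl | hj0
      · have hf1 := first hjl
        have hm := move 0 hjl
        simp only [add_zero] at h1 h2 hm ⊢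
        rw [I.new]
        refine ⟨by simp, ?_⟩
        unfold Env.Precedes at hf1 ⊢
        rw [hm]
        exact hf1.imp (fun h => by omega) fun h => ⟨by omega, h.2⟩
      · obtain ⟨j, rfl⟩ := Nat.exists_eq_succ_of_ne_zero hj0.ne'
        rw [Nat.succ_eq_add_one] at *
        have hm := move _ hjl
        have hm' := move j (by omega)
        have hadj := h.adjacent (p := b + j) (by rw [add_assoc]; exact h1)
        simp only [← add_assoc] at *
        rw [I.shifted j (by omega)]
        refine ⟨(I.keys j (by omega)).ne_free, ?_⟩
        unfold Env.Precedes at hadj ⊢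
        rw [hm, hm']
        exact hadj.imp (fun h => by omega) fun h => ⟨by omega, h.2⟩
    · subst hjl
      by_cases hjn : j + 1 < n
      · have hr := I.rest' (j := j + 1) (by omega) hjn
        rw [← hb, ← add_assoc] at hr
        rw [hr] at h1 h2 ⊢
        obtain ⟨h3, h4⟩ := h.step (b + j) h1 h2
        rcases Nat.eq_zero_or_pos j with rfl | hj0
        · simp only [add_zero] at *
          rw [I.new]
          refine ⟨by simp, ?_⟩
          have h5 := I.le_first h3
          rw [← hb] at h5
          unfold Env.Precedes at h4 ⊢
          rw [hnew]
          rcases h5 with h5 | ⟨h5, h6⟩ <;> rcases h4 with h4 | ⟨h4, h7⟩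
          · left; omega
          · left; omega
          · left; omega
          · right; exact ⟨by omega, h6.trans_lt h7⟩
        · obtain ⟨j, rfl⟩ := Nat.exists_eq_succ_of_ne_zero hj0.ne'
          rw [Nat.succ_eq_add_one] at *
          have hm' := move j (by omega)
          have hadj := h.adjacent (p := b + j) (by rw [add_assoc]; exact h3)
          simp only [← add_assoc] at *
          rw [I.shifted j (by omega)]
          refine ⟨(I.keys j (by omega)).ne_free, ?_⟩
          have h6 := hadj.trans h4
          unfold Env.Precedes at h6 ⊢
          rw [hm']
          exact h6.imp (fun h => by omega) fun h => ⟨by omega, h.2⟩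
      · -- all slots but one are shifted: the new key lies in the slot of its hash
        exfalso
        apply h2
        have hi0 : i = 0 := by omega
        have e1 : b + j + 1 = b + n := by omega
        rw [e1, Nat.add_mod_right, I.new]
        rw [offset_congr I.home_lt (by simp [Nat.ModEq] : b + n ≡ b [MOD n]), hnew, hi0]
    · by_cases hjn : j + 1 < n
      · have hr := I.rest' (j := j + 1) (by omega) hjn
        rw [← hb, ← add_assoc] at hr
        rw [hr] at h1 h2 ⊢
        rw [I.rest' hjl hj]
        exact h.step (b + j) h1 h2
      · have e1 : b + j + 1 = b + n := by omega
        have e2 : E.offset n (b + n) (.key u) = i := by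
          rw [offset_congr I.home_lt (by simp [Nat.ModEq] : b + n ≡ b [MOD n]), hnew]
        rw [e1, Nat.add_mod_right, I.new] at h2 ⊢
        rw [e2] at h2
        rw [I.rest' hjl hj, ← hb]
        have e3 : b + j = E.home n (.key u) + (i - 1) + n := by omega
        obtain ⟨h5, h6⟩ := I.smaller (i - 1) (by omega)
        rw [e3, Nat.add_mod_right]
        refine ⟨h5, ?_⟩
        have e4 : E.offset n (E.home n (.key u) + (i - 1) + n)
            (c ((E.home n (.key u) + (i - 1)) % n)) = E.offset n (E.home n (.key u) + (i - 1))
            (c ((E.home n (.key u) + (i - 1)) % n)) :=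
          offset_congr (h.home_lt _) (by simp [Nat.ModEq])
        unfold Env.Precedes
        rw [e4, e2]
        exact h6.imp (fun h => by omega) fun h => ⟨by omega, h.2⟩

end Insertion

/-! ### The set of items -/

open Classical in
/-- The keys and tombstones in the table. -/
noncomputable def items (n : ℕ) (c : ℕ → Slot U) : Finset (Slot U) :=
  ((Finset.range n).image c).filter (· ≠ .free)

lemma mem_items {c : ℕ → Slot U} {s : Slot U} :
    s ∈ items n c ↔ s ≠ .free ∧ ∃ p < n, c p = s := by
  classical
  simp [items, and_comm]

open Classical in
/-- An insertion replaces the item that it uses up, if there is one, by the new key. -/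
lemma Insertion.items_eq {u : U} {i l : ℕ} {c c' : ℕ → Slot U}
    (I : Insertion E n u i l c c') (h : Ordered E n c) :
    items n c' = insert (.key u)
      ((items n c).erase (c ((E.home n (.key u) + i + l) % n))) := by
  have hn := h.pos
  have hlt := I.lt
  set b := E.home n (.key u) + i with hb
  have hinj : ∀ j j', j < n → j' < n → c ((b + j) % n) ≠ .free →
      c ((b + j) % n) = c ((b + j') % n) → j = j' := by
    intro j j' hj hj' hfr he
    exact add_mod_inj hj hj' (h.eq_of_val_eq (Nat.mod_lt _ hn) (Nat.mod_lt _ hn) hfr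
      (he ▸ hfr) (by rw [he]))
  ext s
  rw [Finset.mem_insert, Finset.mem_erase, mem_items, mem_items]
  constructor
  · rintro ⟨hs, p, hp, rfl⟩
    obtain ⟨j, hj, hjp⟩ := exists_add_modEq hn b p
    have hjp' : (b + j) % n = p := by rw [hjp]; exact Nat.mod_eq_of_lt hp
    rw [← hjp'] at hs ⊢
    rcases Nat.eq_zero_or_pos j with rfl | hj0
    · left; rw [add_zero, I.new]
    · right
      by_cases hjl : j ≤ l
      · obtain ⟨j, rfl⟩ := Nat.exists_eq_succ_of_ne_zero hj0.ne'
        rw [Nat.succ_eq_add_one, ← add_assoc, I.shifted j (by omega)] at hs ⊢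
        refine ⟨fun he => ?_, hs, _, Nat.mod_lt _ hn, rfl⟩
        have := I.keys j (by omega)
        rw [← hb, he] at this
        exact I.last this
      · rw [I.rest' (by omega) hj, ← hb] at hs ⊢
        refine ⟨fun he => ?_, hs, _, Nat.mod_lt _ hn, rfl⟩
        have := hinj j l hj (by omega) hs he
        omega
  · rintro (rfl | ⟨h1, hs, p, hp, rfl⟩)
    · exact ⟨by simp, _, Nat.mod_lt _ hn, I.new⟩
    · refine ⟨hs, ?_⟩
      obtain ⟨j, hj, hjp⟩ := exists_add_modEq hn b p
      have hjp' : (b + j) % n = p := by rw [hjp]; exact Nat.mod_eq_of_lt hp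
      rw [← hjp'] at h1 ⊢
      rcases lt_trichotomy j l with hjl | rfl | hjl
      · exact ⟨_, Nat.mod_lt _ hn, I.shifted j hjl⟩
      · exact absurd rfl h1
      · exact ⟨_, Nat.mod_lt _ hn, I.rest' hjl hj⟩

open Classical in
lemma items_delete {u : U} {c : ℕ → Slot U} {p : ℕ} (h : Ordered E n c) (hp : p < n)
    (hk : c p = .key u) : items n (Function.update c p (.tomb u)) =
      insert (.tomb u) ((items n c).erase (.key u)) := by
  ext s
  rw [Finset.mem_insert, Finset.mem_erase, mem_items, mem_items]
  constructor
  · rintro ⟨hs, q, hq, rfl⟩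
    by_cases hqp : q = p
    · left; rw [hqp, Function.update_self]
    · right
      rw [Function.update_of_ne hqp] at hs ⊢
      refine ⟨fun he => hqp ?_, hs, q, hq, rfl⟩
      exact h.eq_of_val_eq hq hp hs (by rw [hk]; simp) (by rw [he, hk])
  · rintro (rfl | ⟨h1, hs, q, hq, rfl⟩)
    · exact ⟨by simp, p, hp, by simp⟩
    · refine ⟨hs, q, hq, ?_⟩
      rw [Function.update_of_ne]
      rintro rfl
      exact h1 hk

/-- Replacing an item `r` by a new one does not decrease the number of items with some property, if
the new item inherits the property from `r`. -/
lemma card_filter_replace_le {α : Type*} [DecidableEq α] {s : Finset α} {r x : α} (hx : x ∉ s)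
    (φ : α → Prop) [DecidablePred φ]
    (h : r ∈ s → φ r → φ x) :
    (s.filter φ).card ≤ ((insert x (s.erase r)).filter φ).card := by
  by_cases hr : r ∈ s ∧ φ r
  · have h1 := h hr.1 hr.2
    rw [Finset.filter_insert, if_pos h1, Finset.card_insert_of_notMem (by simp [hx]),
      Finset.filter_erase, Finset.card_erase_of_mem (by simp [hr])]
    omega
  · refine Finset.card_le_card fun y hy => ?_
    rw [Finset.mem_filter] at hy ⊢
    refine ⟨Finset.mem_insert_of_mem (Finset.mem_erase.2 ⟨?_, hy.1⟩), hy.2⟩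
    rintro rfl
    exact hr hy

/-- No insertion passes an artificial tombstone: if the item that is used up hashes to the interval
that ends at the slot `m` and begins at the hash of an artificial tombstone still present, so does
the new key. -/
lemma Insertion.offset_le_of_grave {u : U} {i l : ℕ} {c c' : ℕ → Slot U}
    (I : Insertion E n u i l c c') (h : Ordered E n c) (hf : ∃ z, c (z % n) = .free)
    (hnn : ∀ s : Slot U, 0 ≤ E.val n s) {m g p : ℕ}
    (hp : p < n) (hg : c p = .grave g)
    (hr : c ((E.home n (.key u) + i + l) % n) ≠ .free)
    (hrg : c ((E.home n (.key u) + i + l) % n) ≠ .grave g)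
    (hle : E.offset n m (c ((E.home n (.key u) + i + l) % n)) ≤ E.offset n m (.grave g)) :
    E.offset n m (.key u) ≤ E.offset n m (.grave g) := by
  by_contra hcon
  push Not at hcon
  have hn := h.pos
  have hlt := I.lt
  have hhu := I.home_lt
  have hhg : E.home n (.grave g) < n := hg ▸ h.home_lt p
  obtain ⟨ζ, hζn, hζ⟩ := h.exists_free hf (E.home n (.key u))
  set b := E.home n (.key u) with hb
  set r := c ((b + i + l) % n) with hrdef
  have hhr : E.home n r < n := h.home_lt _
  have hun := offset_lt (E := E) hn m (.key u)
  -- distances from the hash of `u` to the hashes of the tombstone and of `r`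
  obtain ⟨α, hα⟩ := Nat.exists_eq_add_of_lt hcon
  obtain ⟨β, hβ⟩ := Nat.exists_eq_add_of_le (hle.trans hcon.le)
  have hug := (home_add_offset hhu m).trans (home_add_offset hhg m).symm
  have hur := (home_add_offset hhu m).trans (home_add_offset hhr m).symm
  rw [hα, ← hb] at hug
  rw [hβ, ← hb] at hur
  have hhg' : b + (α + 1) ≡ E.home n (.grave g) [MOD n] := by
    refine Nat.ModEq.add_right_cancel' (E.offset n m (.grave g)) ?_
    convert hug using 1; ring
  have hhr' : b + β ≡ E.home n r [MOD n] := by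
    refine Nat.ModEq.add_right_cancel' (E.offset n m r) ?_
    convert hur using 1; ring
  -- the slots up to that of `r` are taken
  have hfull : ∀ j ≤ i + l, c ((b + j) % n) ≠ .free := by
    intro j hj
    by_cases hji : j < i
    · exact (I.smaller j hji).1
    · obtain ⟨j, rfl⟩ := Nat.exists_eq_add_of_le (not_lt.1 hji)
      rw [← add_assoc]
      rcases (by omega : j < l ∨ j = l) with hjl | rfl
      · exact (I.keys j hjl).ne_free
      · exact hr
  have hζl : i + l < ζ := by
    by_contra hc
    exact hfull ζ (by omega) hζ
  have hor : E.offset n (b + i + l) r ≤ i + l := by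
    have h1 := h.offset_growth (p := b + i) (q := b + i + l) (by omega) hr
    have h2 := I.le_first (by simpa using hfull i (by omega))
    rw [← hb] at h2
    rw [← hrdef] at h1
    omega
  have hor' : β + E.offset n (b + i + l) r = i + l := by
    have h1 := home_add_offset hhr (b + i + l)
    have h2 := (hhr'.add_right (E.offset n (b + i + l) r)).trans h1
    have h3 : β + E.offset n (b + i + l) r ≡ i + l [MOD n] :=
      Nat.ModEq.add_left_cancel' b (by rwa [← add_assoc, ← add_assoc])
    rcases lt_or_ge (β + E.offset n (b + i + l) r) n with h5 | h5
    · exact Nat.ModEq.eq_of_lt_of_lt h3 h5 hlt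
    · have h6 : β + E.offset n (b + i + l) r - n ≡ i + l [MOD n] := by
        have : β + E.offset n (b + i + l) r - n + n ≡ i + l [MOD n] := by
          rw [Nat.sub_add_cancel h5]; exact h3
        simpa [Nat.ModEq] using this
      have h7 := Nat.ModEq.eq_of_lt_of_lt h6 (by omega) hlt
      omega
  -- the tombstone lies at distance `α + 1 + o` from the hash of `u`: it would be passed by the
  -- search (excluded by its hash), shifted (only keys are), used up (it is still present), or lie
  -- behind `r` (excluded as the hash of `r` is not below its own)
  set o := E.offset n p (.grave g) with ho
  have hpos : b + (α + 1) + o ≡ p [MOD n] := (hhg'.add_right o).trans (home_add_offset hhg p)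
  have hcell : c ((b + (α + 1) + o) % n) = .grave g := by
    rw [hpos, Nat.mod_eq_of_lt hp, hg]
  have hoff : E.offset n (b + (α + 1) + o) (.grave g) = o := offset_congr hhg hpos
  have hne : c ((b + (α + 1) + o) % n) ≠ .free := by rw [hcell]; simp
  have hk : α + 1 + o < ζ := by
    by_contra hc
    rcases (by omega : α + 1 + o = ζ ∨ ζ < α + 1 + o) with h1 | h1
    · rw [← h1, ← add_assoc] at hζ; exact hne hζ
    · have := h.offset_lt_of_free hζ (q := b + (α + 1) + o) (by omega) hne
      rw [hcell, hoff] at this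
      omega
  rcases lt_trichotomy (α + 1 + o) (i + l) with h1 | h1 | h1
  · by_cases hji : α + 1 + o < i
    · have h2 := (I.smaller _ hji).2
      rw [← hb, ← add_assoc, hcell] at h2
      unfold Env.Smaller at h2
      rw [← hb, ← add_assoc, hoff] at h2
      omega
    · obtain ⟨j, hj⟩ := Nat.exists_eq_add_of_le (not_lt.1 hji)
      have h2 := I.keys j (by omega)
      rw [← hb, add_assoc, ← hj, ← add_assoc, hcell] at h2
      exact h2
  · apply hrg
    rw [hrdef, add_assoc, ← h1, ← add_assoc, hcell]
  · have h2 := (h.chain (p := b + i + l) (q := b + (α + 1) + o) (by omega) hne (by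
      rw [hcell, hoff]; omega)).2
    rw [hcell, ← hrdef] at h2
    unfold Env.Precedes at h2
    rw [hoff] at h2
    rcases h2 with h2 | ⟨h2, h3⟩
    · omega
    · have h4 : β = α + 1 := by omega
      rw [h4] at hhr'
      have h5 : E.home n r = E.home n (.grave g) :=
        Nat.ModEq.eq_of_lt_of_lt (hhr'.symm.trans hhg') hhr hhg
      have h6 := Nat.floor_le (hnn r)
      have h7 : E.home n (.grave g : Slot U) = g := Nat.floor_natCast g
      rw [h7] at h5
      unfold Env.home at h5
      rw [h5] at h6
      exact absurd h3 (not_lt.2 h6)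

/-! ### The invariant between two rebuilds -/

/-- The hash values of the keys in `K` are in general position: they are distinct, and irrational,
so that no unrounded hash of a key is a slot number, such as the hash of an artificial tombstone. -/
structure Generic (E : Env U) (K : Set U) : Prop where
  mem_Ico : ∀ u, E.H u ∈ Set.Ico (0 : ℝ) 1
  irrational : ∀ u ∈ K, Irrational (E.H u)
  injOn : Set.InjOn E.H K

/-- The hashes of the artificial tombstones of a table of `n` slots. -/
def graves (t n : ℕ) : Finset ℕ :=
  (Finset.range (n / (2 * t))).image fun i => 2 * t * (i + 1) - 1

/-- What may lie in a slot: a key or tombstone from `Y`, or an artificial tombstone. -/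
def IsItem (t n : ℕ) (Y : Finset U) : Slot U → Prop
  | .free => True
  | .key u => u ∈ Y
  | .tomb u => u ∈ Y
  | .grave a => a ∈ graves t n

open Classical in
/-- The invariant: the table `T` holds the keys `X`, it held the keys `X₀` after the last rebuild,
and all keys that it has held since then are in `Y`. -/
structure Inv (E : Env U) (T : Table U) (X X₀ Y : Finset U) : Prop where
  outside : ∀ a p, T.mem.cell a p ≠ .free → a = T.area ∧ p < T.n
  ordered : Ordered E T.n (T.mem.cell T.area)
  item : ∀ p, IsItem E.t T.n Y (T.mem.cell T.area p)
  key : ∀ u, u ∈ X ↔ ∃ p, T.mem.cell T.area p = .key u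
  count : T.count = X.card
  size : T.n = E.size X₀.card
  base_sub : X₀ ⊆ Y
  /-- At most one key has been added for each insertion or deletion since the last rebuild. -/
  seen : Y.card + T.left ≤ X₀.card + E.window T.n
  /-- At most one key has been removed for each insertion or deletion since the last rebuild. -/
  kept : X₀.card + T.left ≤ X.card + E.window T.n
  /-- The number of items hashing to an interval that ends at slot `m` and begins at an artificial
  tombstone `g` still present has not fallen since the last rebuild. -/
  arcs : ∀ m g, Slot.grave g ∈ items T.n (T.mem.cell T.area) →
    (X₀.filter fun v => E.offset T.n m (.key v) ≤ E.offset T.n m (.grave g)).card +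
      ((graves E.t T.n).filter fun g' =>
        E.offset T.n m (.grave g') < E.offset T.n m (.grave g)).card ≤
    ((items T.n (T.mem.cell T.area)).filter fun s =>
      E.offset T.n m s ≤ E.offset T.n m (.grave g) ∧ s ≠ .grave g).card
  /-- The number of items has not fallen since the last rebuild. -/
  total : X₀.card + (graves E.t T.n).card ≤ (items T.n (T.mem.cell T.area)).card

lemma card_graves {t : ℕ} (ht : 0 < t) (n : ℕ) : (graves t n).card = n / (2 * t) := by
  rw [graves, Finset.card_image_of_injective, Finset.card_range]
  intro i j hij
  simp only at hij
  have h1 : 0 < 2 * t * (i + 1) := by positivity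
  have h2 : 0 < 2 * t * (j + 1) := by positivity
  have h3 : 2 * t * (i + 1) = 2 * t * (j + 1) := by omega
  have := Nat.eq_of_mul_eq_mul_left (by omega) h3
  omega

lemma lt_of_mem_graves {t a : ℕ} (ht : 0 < t) (ha : a ∈ graves t n) : a < n := by
  simp only [graves, Finset.mem_image, Finset.mem_range] at ha
  obtain ⟨i, hi, rfl⟩ := ha
  have h1 : 2 * t * (i + 1) ≤ n := (Nat.mul_le_mul_left _ hi).trans (Nat.mul_div_le _ _)
  have h2 : 0 < 2 * t * (i + 1) := by positivity
  omega

lemma val_ne_of_generic {K : Set U} (hG : Generic E K) (hn : 0 < n) {u v : U} (hu : u ∈ K)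
    (hv : v ∈ K) (h : u ≠ v) : E.val n (.key u) ≠ E.val n (.key v) := by
  intro he
  have hn' : (n : ℝ) ≠ 0 := by exact_mod_cast hn.ne'
  exact h (hG.injOn hu hv (mul_right_cancel₀ hn' he))

/-- Between two rebuilds the keys seen, at most a window more than the `N` keys at the rebuild, and
the artificial tombstones do not fill the table. -/
lemma seen_add_graves_lt (ht : 2 ≤ E.t) {N y : ℕ} (hn : n = E.size N)
    (hy : y ≤ N + E.window n) : y + n / (2 * E.t) < n := by
  set t := E.t with htdef
  have h1 : N < (N / (t - 1) + 1) * (t - 1) := by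
    have := Nat.lt_mul_div_succ N (show 0 < t - 1 by omega)
    rw [mul_comm]; exact this
  set q := N / (t - 1) with hq
  have hn' : n = N + q + 3 := hn
  have ha := Nat.mul_div_le n (2 * t)
  have hb := Nat.mul_div_le n (4 * t)
  unfold Env.window at hy
  rw [← htdef] at hy
  set A := n / (2 * t)
  set B := n / (4 * t)
  obtain ⟨s, hs⟩ := Nat.exists_eq_add_of_le ht
  rw [hs] at h1 ha hb
  have h1' : N < (q + 1) * (s + 1) := by
    have : 2 + s - 1 = s + 1 := by omega
    rwa [this] at h1
  by_contra hcon
  push Not at hcon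
  rcases le_total 1 B with hB | hB
  · rw [max_eq_right hB] at hy
    have : q + 3 ≤ A + B := by omega
    nlinarith
  · rw [max_eq_left hB] at hy
    have : q + 2 ≤ A := by omega
    nlinarith

namespace Inv

variable {T : Table U} {X X₀ Y : Finset U}

lemma pos (h : Inv E T X X₀ Y) : 0 < T.n := h.ordered.pos

lemma mem_seen (h : Inv E T X X₀ Y) {p : ℕ} {u : U} (hp : T.mem.cell T.area p = .key u) :
    u ∈ Y := by
  have := h.item p
  rw [hp] at this
  exact this

lemma sub_seen (h : Inv E T X X₀ Y) : X ⊆ Y := by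
  intro u hu
  obtain ⟨p, hp⟩ := (h.key u).1 hu
  exact h.mem_seen hp

lemma lt_of_cell (h : Inv E T X X₀ Y) {p : ℕ} (hp : T.mem.cell T.area p ≠ .free) : p < T.n :=
  (h.outside _ p hp).2

/-- Each key of `Y` accounts for at most one item: it is not in the table both as a key and as a
tombstone. -/
lemma card_items_le (h : Inv E T X X₀ Y) (φ : Slot U → Prop)
    [DecidablePred φ] (hφ : ∀ u, φ (.tomb u) → φ (.key u)) :
    ((items T.n (T.mem.cell T.area)).filter φ).card ≤
      (Y.filter fun v => φ (.key v)).card +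
        ((graves E.t T.n).filter fun g => φ (.grave g)).card := by
  rw [← Finset.card_disjSum]
  let f : Slot U → U ⊕ ℕ := fun s => match s with
    | .free => .inr 0
    | .key u => .inl u
    | .tomb u => .inl u
    | .grave a => .inr a
  refine Finset.card_le_card_of_injOn f ?_ ?_
  · intro s hs
    rw [Finset.mem_coe, Finset.mem_filter, mem_items] at hs
    obtain ⟨⟨hs, p, hp, rfl⟩, hφs⟩ := hs
    have hi := h.item p
    rw [Finset.mem_coe, Finset.mem_disjSum]
    cases hc : T.mem.cell T.area p with
    | free => exact absurd hc hs
    | key u => rw [hc] at hi hφs; left; exact ⟨u, by simp [hφs]; exact hi, rfl⟩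
    | tomb u => rw [hc] at hi hφs; left; exact ⟨u, by simp [hφ u hφs]; exact hi, rfl⟩
    | grave a => rw [hc] at hi hφs; right; exact ⟨a, by simp [hφs]; exact hi, rfl⟩
  · intro s hs s' hs' hf
    rw [Finset.mem_coe, Finset.mem_filter, mem_items] at hs hs'
    obtain ⟨⟨hs, p, hp, rfl⟩, -⟩ := hs
    obtain ⟨⟨hs', p', hp', rfl⟩, -⟩ := hs'
    have hv : E.val T.n (T.mem.cell T.area p) = E.val T.n (T.mem.cell T.area p') := by
      cases hc : T.mem.cell T.area p <;> cases hc' : T.mem.cell T.area p' <;>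
        simp_all [f, Env.val]
    rw [h.ordered.eq_of_val_eq hp hp' hs hs' hv]

lemma card_items_le_seen (h : Inv E T X X₀ Y) :
    (items T.n (T.mem.cell T.area)).card ≤ Y.card + (graves E.t T.n).card := by
  classical
  simpa using h.card_items_le (fun _ => True) (by simp)

lemma exists_free (h : Inv E T X X₀ Y) (ht : 2 ≤ E.t) :
    ∃ z, T.mem.cell T.area (z % T.n) = .free := by
  classical
  by_contra hcon
  push Not at hcon
  have h1 : (items T.n (T.mem.cell T.area)).card = T.n := by
    have : items T.n (T.mem.cell T.area) = (Finset.range T.n).image (T.mem.cell T.area) := by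
      rw [items, Finset.filter_true_of_mem]
      intro s hs
      obtain ⟨p, hp, rfl⟩ := Finset.mem_image.1 hs
      have := hcon p
      rwa [Nat.mod_eq_of_lt (Finset.mem_range.1 hp)] at this
    rw [this, Finset.card_image_of_injOn, Finset.card_range]
    intro p hp q hq hpq
    have hp' := Finset.mem_range.1 hp
    have hq' := Finset.mem_range.1 hq
    have e1 := hcon p
    have e2 := hcon q
    rw [Nat.mod_eq_of_lt hp'] at e1
    rw [Nat.mod_eq_of_lt hq'] at e2
    exact h.ordered.eq_of_val_eq hp' hq' e1 e2 (by rw [hpq])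
  have h2 := h.card_items_le_seen
  rw [card_graves (by omega), h1] at h2
  have h3 := seen_add_graves_lt (E := E) ht h.size (y := Y.card) (by have := h.seen; omega)
  omega

/-- A key of the table is found behind smaller items. -/
lemma find_eq_some (h : Inv E T X X₀ Y) {u : U} (hu : u ∈ X) :
    ∃ p, T.mem.cell T.area p = .key u ∧ (find E T.area T.n u T.n 0 T.mem).2 = some p := by
  obtain ⟨p, hp⟩ := (h.key u).1 hu
  have hpn := h.lt_of_cell (p := p) (by rw [hp]; simp)
  have hhu : E.home T.n (.key u) < T.n := hp ▸ h.ordered.home_lt p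
  set o := E.offset T.n p (.key u) with ho
  have hon : o < T.n := offset_lt h.pos _ _
  have h1 : (E.home T.n (.key u) + o) % T.n = p := by
    rw [home_add_offset hhu p]; exact Nat.mod_eq_of_lt hpn
  refine ⟨p, hp, ?_⟩
  rw [find_of_key (c := T.mem.cell T.area) (o := o) (by rw [h1, hp]) ?_ rfl (by omega) (by omega),
    h1]
  intro i hi
  obtain ⟨h2, h3⟩ := h.ordered.smaller_of_key hpn hp hi
  exact ⟨h2, ne_key_of_smaller hhu (by omega) h3, not_greater_of_smaller h3⟩

lemma find_eq_none (h : Inv E T X X₀ Y) {u : U} (hu : u ∉ X) :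
    (find E T.area T.n u T.n 0 T.mem).2 = none := by
  cases hf : (find E T.area T.n u T.n 0 T.mem).2 with
  | none => rfl
  | some p => exact absurd ((h.key u).2 ⟨p, find_some hf⟩) hu

end Inv

/-- An operation on the key `u` may pass the first `D` slots from the hash of `u` on: while it
searches it passes items that are not greater than `u`, and while it shifts it passes keys. -/
def Passes (E : Env U) (n : ℕ) (u : U) (c : ℕ → Slot U) (D : ℕ) : Prop :=
  ∀ j < D, c ((E.home n (.key u) + j) % n) ≠ .free ∧
    (¬ E.Greater n u j (c ((E.home n (.key u) + j) % n)) ∨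
      (c ((E.home n (.key u) + j) % n)).IsKey)

/-- The cost of an operation is at most one more than the number of block boundaries among the slots
passed. -/
def CostBound (E : Env U) (n : ℕ) (u : U) (c : ℕ → Slot U) (loads loads' : ℕ) : Prop :=
  ∃ D, Passes E n u c D ∧
    loads' ≤ loads + 1 + ∑ d ∈ Finset.range D, edge E n (E.home n (.key u) + d)

lemma costBound_find (hf : 0 < E.frames) (a : Bool) (u : U) (m : Mem U) :
    CostBound E n u (m.cell a) m.loads (find E a n u n 0 m).1.loads := by
  obtain ⟨D, -, h1, h2⟩ := find_cost (n := n) (a := a) hf u n 0 m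
  refine ⟨D, fun j hj => ⟨(h1 j (Nat.zero_le _) hj).1, Or.inl (h1 j (Nat.zero_le _) hj).2⟩, ?_⟩
  rw [Finset.range_eq_Ico]
  have := touch_loads_le (E := E) (a := a) ((E.home n (.key u) + 0) % n) m
  omega

/-- The effect of an insertion on the memory: none if the key is present, otherwise an
`Insertion`. -/
lemma insertFrom_result {K : Set U} (hG : Generic E K) (hf : 0 < E.frames) {a : Bool} {m : Mem U}
    (h : Ordered E n (m.cell a)) (hfree : ∃ z, m.cell a (z % n) = .free) {u : U} (hu : u ∈ K)
    (hK : ∀ p v, m.cell a p = .key v → v ∈ K) (hlt : ∀ p, m.cell a p ≠ .free → p < n) :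
    CostBound E n u (m.cell a) m.loads (insertFrom E a n u n 0 m).1.loads ∧
    (((∃ p, m.cell a p = .key u) ∧ (insertFrom E a n u n 0 m).2 = true ∧
        (insertFrom E a n u n 0 m).1.cell = m.cell) ∨
      ((¬ ∃ p, m.cell a p = .key u) ∧ (insertFrom E a n u n 0 m).2 = false ∧
        (∀ b, b ≠ a → (insertFrom E a n u n 0 m).1.cell b = m.cell b) ∧
        ∃ i l, Insertion E n u i l (m.cell a) ((insertFrom E a n u n 0 m).1.cell a))) := by
  classical
  have hn := h.pos
  have hhu := home_key_lt (E := E) hG.mem_Ico hn u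
  obtain ⟨ζ, hζn, hζ⟩ := h.exists_free hfree (E.home n (.key u))
  set b := E.home n (.key u) with hb
  have hex : ∃ i, m.cell a ((b + i) % n) = .free ∨
      ¬ E.Smaller n u i (m.cell a ((b + i) % n)) := ⟨ζ, Or.inl hζ⟩
  obtain ⟨i, hend, hmin⟩ : ∃ i, (m.cell a ((b + i) % n) = .free ∨
      ¬ E.Smaller n u i (m.cell a ((b + i) % n))) ∧ ∀ j < i, m.cell a ((b + j) % n) ≠ .free ∧
        E.Smaller n u j (m.cell a ((b + j) % n)) := by
    refine ⟨Nat.find hex, Nat.find_spec hex, fun j hj => ?_⟩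
    have := Nat.find_min hex hj
    push Not at this
    exact this
  have hiζ : i ≤ ζ := by
    by_contra hc
    exact (hmin ζ (by omega)).1 hζ
  have hpass : ∀ j < i, m.cell a ((b + j) % n) ≠ .free ∧ m.cell a ((b + j) % n) ≠ .key u ∧
      E.Smaller n u j (m.cell a ((b + j) % n)) := fun j hj =>
    ⟨(hmin j hj).1, ne_key_of_smaller hhu (by omega) (hmin j hj).2, (hmin j hj).2⟩
  obtain ⟨m', hm1, hm2, hm3, hm4⟩ := insertFrom_spec (a := a) hf (i := 0) (fuel := n)
    (fun j _ hj => hpass j hj) hend (Nat.zero_le _) (by omega)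
  rw [← hb] at hm2 hm3 hm4
  have hcost1 : m'.loads ≤ m.loads + 1 + ∑ d ∈ Finset.range i, edge E n (b + d) := by
    rw [Finset.range_eq_Ico]
    have := touch_loads_le (E := E) (a := a) ((b + 0) % n) m
    omega
  by_cases hk : m.cell a ((b + i) % n) = .key u
  · rw [if_pos hk] at hm4
    rw [hm4]
    refine ⟨⟨i, fun j hj => ⟨(hpass j hj).1, Or.inl (not_greater_of_smaller (hpass j hj).2.2)⟩,
      hcost1⟩, Or.inl ⟨⟨_, hk⟩, rfl, hm1⟩⟩
  · rw [if_neg hk] at hm4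
    rw [hm4]
    have hex2 : ∃ l, ¬ (m.cell a ((b + i + l) % n)).IsKey := by
      refine ⟨ζ - i, ?_⟩
      rw [show b + i + (ζ - i) = b + ζ by omega, hζ]
      exact fun h => h
    obtain ⟨l, hlast, hkeys⟩ : ∃ l, ¬ (m.cell a ((b + i + l) % n)).IsKey ∧
        ∀ j < l, (m.cell a ((b + i + j) % n)).IsKey :=
      ⟨Nat.find hex2, Nat.find_spec hex2, fun j hj => by
        simpa using Nat.find_min hex2 hj⟩
    have hlζ : i + l ≤ ζ := by
      by_contra hc
      have := hkeys (ζ - i) (by omega)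
      rw [show b + i + (ζ - i) = b + ζ by omega, hζ] at this
      exact this
    obtain ⟨s1, s2, s3, s4, s5⟩ := shift_spec (E := E) (a := a) (n := n) hf (l := l) (by omega)
      (p := b + i) (s := .key u) (m := m') (fuel := n) (by omega)
      (fun j hj => by rw [hm1]; exact hkeys j hj) (by rw [hm1]; exact hlast)
    have hnot : ¬ ∃ p, m.cell a p = .key u := by
      rintro ⟨p, hp⟩
      have hpn := hlt p (by rw [hp]; simp)
      set o := E.offset n p (.key u) with ho
      have hon : o < n := offset_lt hn _ _
      have h1 : (b + o) % n = p := by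
        rw [home_add_offset hhu p]; exact Nat.mod_eq_of_lt hpn
      rcases lt_trichotomy o i with h2 | h2 | h2
      · exact (hpass o h2).2.1 (by rw [h1, hp])
      · exact hk (by rw [← h2, h1, hp])
      · obtain ⟨h3, h4⟩ := h.smaller_of_key hpn hp h2
        exact hend.elim h3 fun h5 => h5 h4
    refine ⟨⟨i + l, fun j hj => ?_, ?_⟩, Or.inr ⟨hnot, rfl, fun b' hb' => by rw [s4 b' hb', hm1],
      i, l, ?_⟩⟩
    · rcases lt_or_ge j i with hji | hji
      · exact ⟨(hpass j hji).1, Or.inl (not_greater_of_smaller (hpass j hji).2.2)⟩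
      · obtain ⟨j, rfl⟩ := Nat.exists_eq_add_of_le hji
        have := hkeys j (by omega)
        rw [add_assoc] at this
        exact ⟨this.ne_free, Or.inr this⟩
    · refine s5.trans ?_
      rw [touch_loads_of_head hm2, Finset.sum_range_add]
      simp only [← add_assoc, ← hb]
      omega
    · exact {
        lt := by omega
        smaller := hmin
        halt := hend
        keys := hkeys
        last := hlast
        new := s1
        shifted := fun j hj => by rw [s2 j hj, hm1]
        rest := fun q hq => by rw [s3 q hq, hm1]
        home_lt := hhu
        val_ne := fun p hp => by
          cases hc : m.cell a p <;> rw [hc] at hp <;> try exact hp.elim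
          rename_i v
          refine val_ne_of_generic hG hn (hK p v hc) hu ?_
          rintro rfl
          exact hnot ⟨p, hc⟩ }

/-! ### Operations preserve the invariant -/

/-- The effect of an operation on the set of keys present. -/
def Op.apply [DecidableEq U] : Op U → Finset U → Finset U
  | .query _, X => X
  | .insert u, X => Insert.insert u X
  | .delete u, X => X.erase u

/-- The effect of an operation on the set of keys that the table has held since a rebuild. -/
def Op.see [DecidableEq U] : Op U → Finset U → Finset U
  | .insert u, Y => Insert.insert u Y
  | _, Y => Y

/-- The effect of an operation on the number of insertions and deletions until the next rebuild. -/
def Op.tick : Op U → ℕ → ℕ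
  | .query _, k => k
  | _, k => k - 1

lemma contents_succ [DecidableEq U] (S : ℕ → Op U) (k : ℕ) :
    contents S (k + 1) = (S k).apply (contents S k) := by
  rw [contents]; cases S k <;> rfl

lemma IsItem.mono {t : ℕ} {Y Y' : Finset U} (hY : Y ⊆ Y') {s : Slot U} (h : IsItem t n Y s) :
    IsItem t n Y' s := by
  cases s with
  | free => trivial
  | key u => exact hY h
  | tomb u => exact hY h
  | grave a => exact h

namespace Inv

variable {T : Table U} {X X₀ Y : Finset U}

/-- Accesses that change no contents preserve the invariant. -/
lemma congr (h : Inv E T X X₀ Y) {T' : Table U} {Y' : Finset U}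
    (hcell : T'.mem.cell = T.mem.cell) (harea : T'.area = T.area) (hn : T'.n = T.n)
    (hcount : T'.count = T.count) (hsub : Y ⊆ Y')
    (hseen : Y'.card + T'.left ≤ X₀.card + E.window T.n) (hleft : T'.left ≤ T.left) :
    Inv E T' X X₀ Y' := by
  obtain ⟨⟨cell, cache, loads⟩, area, n, count, left⟩ := T
  obtain ⟨⟨cell', cache', loads'⟩, area', n', count', left'⟩ := T'
  simp only at hcell harea hn hcount hseen hleft
  subst hcell harea hn hcount
  exact ⟨h.outside, h.ordered, fun p => (h.item p).mono hsub, h.key, h.count, h.size,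
    h.base_sub.trans hsub, hseen, by have := h.kept; simp at this ⊢; omega, h.arcs, h.total⟩

lemma key_iff_items (h : Inv E T X X₀ Y) (u : U) :
    u ∈ X ↔ Slot.key u ∈ items T.n (T.mem.cell T.area) := by
  rw [h.key, mem_items]
  constructor
  · rintro ⟨p, hp⟩
    exact ⟨by simp, p, h.lt_of_cell (by rw [hp]; simp), hp⟩
  · rintro ⟨-, p, -, hp⟩
    exact ⟨p, hp⟩

/-- Inserting a new key preserves the invariant. The field `arcs` survives since the item used up,
if it counts for an interval, is replaced by one that counts too
(`Insertion.offset_le_of_grave`). -/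
lemma insert_absent [DecidableEq U] {K : Set U} (hG : Generic E K) (h : Inv E T X X₀ Y)
    (ht : 2 ≤ E.t) (hleft : 0 < T.left) {u : U} (hu : u ∉ X) {T' : Table U}
    (harea : T'.area = T.area) (hn : T'.n = T.n) (hcount : T'.count = T.count + 1)
    (hleft' : T'.left = T.left - 1)
    (hother : ∀ b, b ≠ T.area → T'.mem.cell b = T.mem.cell b) {i l : ℕ}
    (I : Insertion E T.n u i l (T.mem.cell T.area) (T'.mem.cell T.area)) :
    Inv E T' (insert u X) X₀ (insert u Y) := by
  classical
  obtain ⟨⟨cell', cache', loads'⟩, area', n', count', left'⟩ := T'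
  simp only at harea hn hcount hleft' hother I
  subst harea hn hcount hleft'
  have hfree := h.exists_free ht
  have hitems := I.items_eq h.ordered
  have hge : ∀ p, T.n ≤ p → cell' T.area p = T.mem.cell T.area p := fun p hp =>
    I.rest p fun j _ he => by
      have := Nat.mod_lt (E.home T.n (.key u) + i + j) h.pos
      omega
  have hlt : ∀ p, cell' T.area p ≠ .free → p < T.n := by
    intro p hp
    by_contra hc
    rw [hge p (by omega)] at hp
    exact hc (h.lt_of_cell hp)
  have hui : Slot.key u ∉ items T.n (T.mem.cell T.area) := by rwa [← h.key_iff_items]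
  refine ⟨fun b p hp => ?_, I.ordered h.ordered hfree, fun p => ?_, fun v => ?_, ?_, h.size,
    h.base_sub.trans (Finset.subset_insert _ _), ?_, ?_, fun m g hg => ?_, ?_⟩
  · by_cases hb : b = T.area
    · subst hb; exact ⟨rfl, hlt p hp⟩
    · simp only at hp
      rw [hother b hb] at hp
      exact h.outside b p hp
  · by_cases hp : cell' T.area p = .free
    · simp only [hp]; trivial
    · have h1 : cell' T.area p ∈ items T.n (cell' T.area) := mem_items.2 ⟨hp, p, hlt p hp, rfl⟩
      rw [hitems, Finset.mem_insert, Finset.mem_erase] at h1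
      rcases h1 with h1 | ⟨-, h1⟩
      · simp only [h1]; exact Finset.mem_insert_self _ _
      · obtain ⟨-, q, -, hq⟩ := mem_items.1 h1
        have := (h.item q).mono (Finset.subset_insert u Y)
        rwa [hq] at this
  · have h1 : (∃ p, cell' T.area p = .key v) ↔ Slot.key v ∈ items T.n (cell' T.area) := by
      rw [mem_items]
      exact ⟨fun ⟨p, hp⟩ => ⟨by simp, p, hlt p (by rw [hp]; simp), hp⟩,
        fun ⟨_, p, _, hp⟩ => ⟨p, hp⟩⟩
    simp only
    rw [h1, hitems, Finset.mem_insert, Finset.mem_insert, Finset.mem_erase, h.key_iff_items]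
    have h2 : Slot.key v ≠ T.mem.cell T.area ((E.home T.n (.key u) + i + l) % T.n) := by
      intro he
      have := I.last
      rw [← he] at this
      exact this trivial
    simp [h2]
  · simp only
    rw [Finset.card_insert_of_notMem hu, h.count]
  · have := h.seen
    have := Finset.card_insert_le u Y
    simp only
    omega
  · have := h.kept
    simp only
    rw [Finset.card_insert_of_notMem hu]
    omega
  · simp only at hg ⊢
    rw [hitems] at hg ⊢
    have hg' := hg
    rw [Finset.mem_insert, Finset.mem_erase] at hg'
    rcases hg' with hg' | ⟨hg1, hg2⟩
    · cases hg'
    refine (h.arcs m g hg2).trans ?_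
    obtain ⟨-, p, hp, hpg⟩ := mem_items.1 hg2
    refine card_filter_replace_le hui _ ?_
    rintro hr ⟨h1, h2⟩
    exact ⟨I.offset_le_of_grave h.ordered hfree (val_nonneg hG.mem_Ico T.n) hp hpg
      (mem_items.1 hr).1 h2 h1, by simp⟩
  · refine h.total.trans ?_
    simp only
    rw [hitems]
    simpa using card_filter_replace_le hui (fun _ => True) (fun _ _ => trivial)

/-- Deleting a key preserves the invariant: its tombstone has the same hash. -/
lemma delete_present [DecidableEq U] (h : Inv E T X X₀ Y)
    (hleft : 0 < T.left) {u : U} (hu : u ∈ X) {T' : Table U}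
    (harea : T'.area = T.area) (hn : T'.n = T.n) (hcount : T'.count = T.count - 1)
    (hleft' : T'.left = T.left - 1) {p : ℕ} (hp : T.mem.cell T.area p = .key u)
    (hcell : T'.mem.cell = Function.update T.mem.cell T.area
      (Function.update (T.mem.cell T.area) p (.tomb u))) :
    Inv E T' (X.erase u) X₀ Y := by
  classical
  obtain ⟨⟨cell', cache', loads'⟩, area', n', count', left'⟩ := T'
  simp only at harea hn hcount hleft' hcell
  subst harea hn hcount hleft' hcell
  have hpn := h.lt_of_cell (p := p) (by rw [hp]; simp)
  have hitems := items_delete h.ordered hpn hp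
  have hcc : Function.update T.mem.cell T.area (Function.update (T.mem.cell T.area) p (.tomb u))
      T.area = Function.update (T.mem.cell T.area) p (.tomb u) := Function.update_self _ _ _
  have hval : ∀ q, E.val T.n (Function.update (T.mem.cell T.area) p (.tomb u) q) =
      E.val T.n (T.mem.cell T.area q) := by
    intro q
    by_cases hq : q = p
    · subst hq; rw [Function.update_self, hp]; rfl
    · rw [Function.update_of_ne hq]
  have hti : Slot.tomb u ∉ items T.n (T.mem.cell T.area) := by
    intro hmem
    obtain ⟨-, q, hq, hqt⟩ := mem_items.1 hmem
    have := h.ordered.eq_of_val_eq hq hpn (by rw [hqt]; simp) (by rw [hp]; simp)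
      (by rw [hqt, hp]; rfl)
    subst this
    rw [hp] at hqt
    cases hqt
  have huniq : ∀ q, T.mem.cell T.area q = .key u → q = p := fun q hq =>
    h.ordered.eq_of_val_eq (h.lt_of_cell (by rw [hq]; simp)) hpn (by rw [hq]; simp)
      (by rw [hp]; simp) (by rw [hq, hp])
  have hX := Finset.card_erase_of_mem hu
  have hX0 := Finset.card_pos.2 ⟨u, hu⟩
  refine ⟨fun b q hq => ?_, ?_, fun q => ?_, fun v => ?_, ?_, h.size, h.base_sub, ?_, ?_,
    fun m g hg => ?_, ?_⟩
  · simp only at hq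
    by_cases hb : b = T.area
    · subst hb
      rw [hcc] at hq
      refine ⟨rfl, ?_⟩
      by_cases hqp : q = p
      · subst hqp; exact hpn
      · rw [Function.update_of_ne hqp] at hq; exact h.lt_of_cell hq
    · rw [Function.update_of_ne hb] at hq
      exact h.outside b q hq
  · simp only
    rw [hcc]
    refine h.ordered.congr_val (fun q => ?_) hval
    by_cases hqp : q = p
    · subst hqp; simp [hp]
    · rw [Function.update_of_ne hqp]
  · simp only
    rw [hcc]
    by_cases hqp : q = p
    · subst hqp; rw [Function.update_self]; exact h.mem_seen hp
    · rw [Function.update_of_ne hqp]; exact h.item q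
  · simp only
    rw [hcc, Finset.mem_erase, h.key]
    constructor
    · rintro ⟨hv, q, hq⟩
      refine ⟨q, ?_⟩
      rw [Function.update_of_ne, hq]
      rintro rfl
      rw [hp] at hq
      cases hq
      exact hv rfl
    · rintro ⟨q, hq⟩
      by_cases hqp : q = p
      · subst hqp; simp at hq
      · rw [Function.update_of_ne hqp] at hq
        refine ⟨?_, q, hq⟩
        rintro rfl
        exact hqp (huniq q hq)
  · simp only; rw [hX, h.count]
  · have := h.seen; simp only; omega
  · have := h.kept; simp only; omega
  · simp only at hg ⊢
    rw [hcc, hitems] at hg ⊢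
    have hg' := hg
    rw [Finset.mem_insert, Finset.mem_erase] at hg'
    rcases hg' with hg' | ⟨hg1, hg2⟩
    · cases hg'
    refine (h.arcs m g hg2).trans ?_
    refine card_filter_replace_le hti _ ?_
    rintro hr ⟨h1, h2⟩
    exact ⟨h1, by simp⟩
  · refine h.total.trans ?_
    simp only
    rw [hcc, hitems]
    simpa using card_filter_replace_le hti (fun _ => True) (fun _ _ => trivial)

end Inv

/-- What an operation does: its answer is correct, its cost is bounded by the slots it passes, and
the invariant is preserved. -/
lemma perform_spec [DecidableEq U] {K : Set U} (hG : Generic E K) (hf : 0 < E.frames)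
    (ht : 2 ≤ E.t) {T : Table U} {X X₀ Y : Finset U} (h : Inv E T X X₀ Y) (hY : ↑Y ⊆ K)
    {op : Op U} (hop : op.key ∈ K) (hleft : 0 < T.left) :
    Inv E (perform E T op).1 (op.apply X) X₀ (op.see Y) ∧
    ((perform E T op).2 = true ↔ op.key ∈ X) ∧
    CostBound E T.n op.key (T.mem.cell T.area) T.mem.loads (perform E T op).1.mem.loads ∧
    (perform E T op).1.n = T.n ∧ (perform E T op).1.area = T.area ∧
    (perform E T op).1.left = op.tick T.left := by
  cases op with
  | query u =>
    refine ⟨?_, ?_, costBound_find hf _ _ _, rfl, rfl, rfl⟩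
    · exact h.congr (by simp [perform, find_cell]) rfl rfl rfl (subset_refl _) h.seen le_rfl
    · by_cases hu : u ∈ X
      · obtain ⟨p, -, hp⟩ := h.find_eq_some hu
        simp [perform, hp, Op.key, hu]
      · simp [perform, h.find_eq_none hu, Op.key, hu]
  | insert u =>
    have hu : u ∈ K := hop
    obtain ⟨h1, h2⟩ := insertFrom_result (a := T.area) (m := T.mem) hG hf h.ordered
      (h.exists_free ht) hu (fun p v hv => hY (h.mem_seen hv)) (fun p hp => h.lt_of_cell hp)
    rcases h2 with ⟨h2, h3, h4⟩ | ⟨h2, h3, h4, i, l, I⟩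
    · rw [← h.key] at h2
      refine ⟨?_, by simp [perform, h3, Op.key, h2], h1, rfl, rfl, rfl⟩
      have hX : Op.apply (.insert u) X = X := Finset.insert_eq_of_mem h2
      have hY' : Op.see (.insert u) Y = Y := Finset.insert_eq_of_mem (h.sub_seen h2)
      rw [hX, hY']
      refine h.congr (by simp [perform, h4]) rfl rfl (by simp [perform, h3]) (subset_refl _) ?_ ?_
      · have := h.seen
        simp only [perform]
        omega
      · simp [perform]
    · rw [← h.key] at h2
      refine ⟨?_, by simp [perform, h3, Op.key, h2], h1, rfl, rfl, rfl⟩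
      exact h.insert_absent (T' := (perform E T (.insert u)).1) hG ht hleft h2 rfl rfl
        (by simp [perform, h3]) rfl h4 I
  | delete u =>
    by_cases hu : u ∈ X
    · obtain ⟨p, hp1, hp2⟩ := h.find_eq_some hu
      have hperf : perform E T (.delete u) =
          ({ T with
              mem := write E T.area p (.tomb u) (find E T.area T.n u T.n 0 T.mem).1
              count := T.count - 1
              left := T.left - 1 }, true) := by
        simp only [perform]; rw [hp2]
      rw [hperf]
      refine ⟨?_, by simp [Op.key, hu], ?_, rfl, rfl, rfl⟩
      · exact h.delete_present hleft hu rfl rfl rfl rfl hp1 (by simp [find_cell])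
      · have := costBound_find (n := T.n) hf T.area u T.mem
        simp only [write_loads]
        rwa [touch_loads_of_head (find_head hf hp2)]
    · have hn := h.find_eq_none hu
      have hperf : perform E T (.delete u) =
          ({ T with mem := (find E T.area T.n u T.n 0 T.mem).1, left := T.left - 1 }, false) := by
        simp only [perform]; rw [hn]
      rw [hperf]
      refine ⟨?_, by simp [Op.key, hu], costBound_find hf _ _ _, rfl, rfl, rfl⟩
      have hX : Op.apply (.delete u) X = X := Finset.erase_eq_of_notMem hu
      rw [hX]
      refine h.congr (by simp [find_cell]) rfl rfl rfl (subset_refl _) ?_ ?_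
      · have := h.seen
        simp only [Op.see]
        omega
      · simp

/-! ### Distances between artificial tombstones -/

lemma home_grave (a : ℕ) : E.home n (.grave a) = a := Nat.floor_natCast a

/-- The hashes of artificial tombstones are at distance at least `2 * t`, also across the end of the
table. -/
lemma graves_gap {t : ℕ} (ht : 0 < t) {g g' : ℕ} (hg : g ∈ graves t n) (hg' : g' ∈ graves t n)
    (m : ℕ) (h : E.offset n m (.grave g) < E.offset n m (.grave g')) :
    E.offset n m (.grave g) + 2 * t ≤ E.offset n m (.grave g') := by
  have hgn := lt_of_mem_graves ht hg
  have hgn' := lt_of_mem_graves ht hg'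
  have h1 := home_add_offset (E := E) (n := n) (s := .grave g) (by rwa [home_grave]) m
  have h2 := home_add_offset (E := E) (n := n) (s := .grave g') (by rwa [home_grave]) m
  have hon' := offset_lt (E := E) (n := n) (by omega) m (.grave g')
  rw [home_grave] at h1 h2
  obtain ⟨δ, hδ⟩ := Nat.exists_eq_add_of_lt h
  rw [hδ] at h2 hon' ⊢
  have h3 : g' + (δ + 1) ≡ g [MOD n] := by
    refine Nat.ModEq.add_right_cancel' (E.offset n m (.grave g)) ?_
    convert h2.trans h1.symm using 1; ring
  simp only [graves, Finset.mem_image, Finset.mem_range] at hg hg'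
  obtain ⟨i, hi, hgi⟩ := hg
  obtain ⟨i', hi', hgi'⟩ := hg'
  have e1 : 2 * t * 1 ≤ 2 * t * (i + 1) := Nat.mul_le_mul_left _ (by omega)
  have e2 : 2 * t * 1 ≤ 2 * t * (i' + 1) := Nat.mul_le_mul_left _ (by omega)
  rcases lt_or_ge (g' + (δ + 1)) n with h4 | h4
  · have h5 := Nat.ModEq.eq_of_lt_of_lt h3 h4 hgn
    have h6 : i' < i := by
      by_contra hc
      have := Nat.mul_le_mul_left (2 * t) (show i + 1 ≤ i' + 1 by omega)
      omega
    have h7 := Nat.mul_le_mul_left (2 * t) (show i' + 1 + 1 ≤ i + 1 by omega)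
    rw [mul_add (2 * t) (i' + 1) 1] at h7
    omega
  · have h5 : g' + (δ + 1) - n ≡ g [MOD n] := by
      have : g' + (δ + 1) - n + n ≡ g [MOD n] := by rwa [Nat.sub_add_cancel h4]
      simpa [Nat.ModEq] using this
    have h6 := Nat.ModEq.eq_of_lt_of_lt h5 (by omega) hgn
    omega

/-- Artificial tombstones in an interval, given by the distances of its ends to `m`. -/
lemma card_graves_arc_le {t : ℕ} (ht : 0 < t) (m a b : ℕ) :
    ((graves t n).filter fun g => a ≤ E.offset n m (.grave g) ∧
      E.offset n m (.grave g) ≤ b).card ≤ (b - a) / (2 * t) + 1 := by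
  rw [← Finset.card_range ((b - a) / (2 * t) + 1)]
  refine Finset.card_le_card_of_injOn (fun g => (E.offset n m (.grave g) - a) / (2 * t)) ?_ ?_
  · intro g hg
    simp only [Finset.coe_filter, Set.mem_ofPred_eq] at hg
    simp only [Finset.coe_range, Set.mem_Iio]
    exact Nat.lt_succ_of_le (Nat.div_le_div_right (by omega))
  · intro g hg g' hg' hgg
    simp only [Finset.coe_filter, Set.mem_ofPred_eq] at hg hg'
    simp only at hgg
    by_contra hne
    wlog hlt : E.offset n m (.grave g : Slot U) < E.offset n m (.grave g') generalizing g g'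
    · rcases lt_or_eq_of_le (not_lt.1 hlt) with h | h
      · exact this hgg.symm hg' hg (Ne.symm hne) h
      · have h1 := lt_of_mem_graves ht hg.1
        have h2 := lt_of_mem_graves ht hg'.1
        have := home_eq_of_offset_eq (E := E) (s := .grave g) (s' := .grave g')
          (by rwa [home_grave]) (by rwa [home_grave]) h.symm
        rw [home_grave, home_grave] at this
        exact hne this
    have h1 := graves_gap ht hg.1 hg'.1 m hlt
    have h2 : (E.offset n m (.grave g) - a + 2 * t) / (2 * t) ≤
        (E.offset n m (.grave g') - a) / (2 * t) := Nat.div_le_div_right (by omega)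
    rw [Nat.add_div_right _ (by omega)] at h2
    omega

/-- An interval of length `j` contains about `j / (2 * t)` artificial tombstones; two of them may be
missing, at its ends or at the end of the table. -/
lemma le_card_graves_arc {t : ℕ} (ht : 0 < t) (hn : 0 < n) (m : ℕ) {j : ℕ} (hj : j < n) :
    j ≤ 2 * t * (((graves t n).filter fun g => E.offset n m (.grave g) < j).card + 2) := by
  have h1 := card_graves_arc_le (E := E) (n := n) ht m j (n - 1)
  have h2 := Finset.card_filter_add_card_filter_not (s := graves t n)
    (fun g => E.offset n m (.grave g) < j)
  have h3 : ((graves t n).filter fun g => ¬ E.offset n m (.grave g) < j) =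
      (graves t n).filter fun g => j ≤ E.offset n m (.grave g) ∧
        E.offset n m (.grave g) ≤ n - 1 := by
    refine Finset.filter_congr fun g _ => ?_
    have := offset_lt (E := E) hn m (.grave g)
    omega
  rw [h3, card_graves ht] at h2
  set x := ((graves t n).filter fun g => E.offset n m (.grave g) < j).card
  set y := ((graves t n).filter fun g => j ≤ E.offset n m (.grave g) ∧
    E.offset n m (.grave g) ≤ n - 1).card
  have h4 := Nat.mul_div_le (n - 1 - j) (2 * t)
  have h5 := Nat.lt_mul_div_succ n (show 0 < 2 * t by omega)
  have h6 : 2 * t * (n / (2 * t)) ≤ 2 * t * (x + ((n - 1 - j) / (2 * t) + 1)) :=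
    Nat.mul_le_mul_left _ (by omega)
  rw [mul_add] at h5 h6 ⊢
  rw [mul_add (2 * t) ((n - 1 - j) / (2 * t)) 1] at h6
  omega

/-! ### Which configurations of hashes make an operation long -/

/-- If an operation on `u` passes `D` slots, one of the following holds for the slot `m` halfway:
many items hash to an interval ending at `m`, so that they reach far beyond it; or all artificial
tombstones of an interval that ends at `m` have been used up, so that as many new keys as there were
artificial tombstones hash to it; or the table is too small to have artificial tombstones.

In the first case the last item passed hashes to a slot up to `m`, and then so does the whole run
in front of it. Otherwise an artificial tombstone hashing to a slot between the hash of `u` and `m`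
would lie among the slots passed, where there is none. The interval then begins at the last
artificial tombstone before `m` that is still present, so that the field `arcs` of the invariant
applies. -/
lemma Inv.long_operation [DecidableEq U] {T : Table U} {X X₀ Y : Finset U} (h : Inv E T X X₀ Y)
    (ht : 2 ≤ E.t) (hleft : 0 < T.left) {u : U} (hhu : E.home T.n (.key u) < T.n) {D : ℕ}
    (hD : 1 ≤ D) (hp : Passes E T.n u (T.mem.cell T.area) D) :
    D < T.n ∧
    ((∃ j < T.n, j + (D - D / 2) ≤
      (Y.filter fun v => E.offset T.n (E.home T.n (.key u) + D / 2) (.key v) ≤ j).card +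
        (j / (2 * E.t) + 1)) ∨
    (∃ j < T.n, D / 2 ≤ j ∧ j ≤ 2 * E.t * (((Y \ X₀).filter fun v =>
      E.offset T.n (E.home T.n (.key u) + D / 2) (.key v) ≤ j).card + 2)) ∨
    T.n < 2 * E.t) := by
  classical
  have hcardle := @Inv.card_items_le _ _ _ _ _ _ h
  have harcs := h.arcs
  have htotal := h.total
  have hseen := h.seen
  set n := T.n with hndef
  set c := T.mem.cell T.area with hc
  set b := E.home n (.key u) with hb
  have hO : Ordered E n c := h.ordered
  have hn : 0 < n := hO.pos
  obtain ⟨ζ, hζn, hζ⟩ := hO.exists_free (h.exists_free ht) b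
  have hDζ : D ≤ ζ := by
    by_contra hcon
    exact (hp ζ (by omega)).1 hζ
  refine ⟨by omega, ?_⟩
  set m := b + D / 2 with hm
  set e := b + (D - 1) with he
  obtain ⟨w, hw⟩ : ∃ w, D - 1 = D / 2 + w := Nat.exists_eq_add_of_le (by omega)
  have hew : e = m + w := by omega
  have hefree : c (e % n) ≠ .free := (hp (D - 1) (by omega)).1
  by_cases hcase : w ≤ E.offset n e (c (e % n))
  · left
    -- `k` items lie behind the last free slot before `e`, up to `e`; all of them hash to the
    -- interval of length `k - w` that ends at `m`
    have hex : ∃ k, k ≤ n ∧ c ((e + n - k) % n) = .free := by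
      obtain ⟨κ, hκn, hκ⟩ := hO.exists_free (h.exists_free ht) e
      refine ⟨n - κ, by omega, ?_⟩
      rw [show e + n - (n - κ) = e + κ by omega]
      exact hκ
    obtain ⟨k, ⟨hkn, hkfree⟩, hkmin⟩ : ∃ k, (k ≤ n ∧ c ((e + n - k) % n) = .free) ∧
        ∀ i < k, c ((e + n - i) % n) ≠ .free := by
      refine ⟨Nat.find hex, Nat.find_spec hex, fun i hi hfr => Nat.find_min hex hi ⟨?_, hfr⟩⟩
      have := (Nat.find_spec hex).1
      omega
    have hk0 : k ≠ 0 := by rintro rfl; simp at hkfree; exact hefree hkfree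
    have hkn' : k < n := by
      rcases hkn.eq_or_lt with rfl | h1
      · exfalso; simp only [Nat.add_sub_cancel] at hkfree; exact hefree hkfree
      · exact h1
    have heo : E.offset n (e + n) (c ((e + n) % n)) = E.offset n e (c (e % n)) := by
      rw [Nat.add_mod_right]
      exact offset_congr (hO.home_lt _) (by simp [Nat.ModEq])
    have hfacts : ∀ i < k, w ≤ E.offset n (e + n - i) (c ((e + n - i) % n)) + i ∧
        E.offset n (e + n - i) (c ((e + n - i) % n)) + i < k ∧
        E.offset n m (c ((e + n - i) % n)) =
          E.offset n (e + n - i) (c ((e + n - i) % n)) + i - w := by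
      intro i hi
      have h1 := hO.offset_growth (p := e + n - i) (q := e + n) (by omega)
        (by rw [Nat.add_mod_right]; exact hefree)
      have h2 := hO.offset_lt_of_free (z := e + n - k) (q := e + n - i) hkfree (by omega)
        (hkmin i hi)
      rw [heo] at h1
      refine ⟨by omega, by omega, offset_eq (hO.home_lt _) (by omega) ?_⟩
      have h3 := (home_add_offset (hO.home_lt ((e + n - i) % n)) (e + n - i)).add_right i
      rw [show e + n - i + i = m + w + n by omega] at h3
      refine Nat.ModEq.add_right_cancel' w ?_
      rw [add_assoc, Nat.sub_add_cancel (by omega), ← add_assoc]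
      exact h3.trans (by simp [Nat.ModEq])
    refine ⟨k - 1 - w, by omega, ?_⟩
    have hw0 := hfacts 0 (by omega)
    have hcard : k ≤ ((items n c).filter fun s => E.offset n m s ≤ k - 1 - w).card := by
      conv_lhs => rw [← Finset.card_range k]
      refine Finset.card_le_card_of_injOn (fun i => c ((e + n - i) % n)) ?_ ?_
      · intro i hi
        have hi' := Finset.mem_range.1 hi
        obtain ⟨f1, f2, f3⟩ := hfacts i hi'
        rw [Finset.mem_coe, Finset.mem_filter, mem_items]
        exact ⟨⟨hkmin i hi', _, Nat.mod_lt _ hn, rfl⟩, by simp only; rw [f3]; omega⟩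
      · intro i hi i' hi' hii
        have hi1 := Finset.mem_range.1 (Finset.mem_coe.1 hi)
        have hi2 := Finset.mem_range.1 (Finset.mem_coe.1 hi')
        simp only at hii
        have h1 := hO.eq_of_val_eq (Nat.mod_lt _ hn) (Nat.mod_lt _ hn) (hkmin i hi1)
          (hkmin i' hi2) (by rw [hii])
        have e1 : e + n - i = e + 1 + (n - 1 - i) := by omega
        have e2 : e + n - i' = e + 1 + (n - 1 - i') := by omega
        rw [e1, e2] at h1
        have := add_mod_inj (by omega) (by omega) h1
        omega
    have h1 := hcardle (fun s => E.offset n m s ≤ k - 1 - w) fun v hv => hv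
    have h2 := card_graves_arc_le (E := E) (n := n) (t := E.t) (by omega) m 0 (k - 1 - w)
    simp only [Nat.zero_le, true_and, Nat.sub_zero] at h2
    have h3 := hcard.trans h1
    omega
  · -- an item hashing to a slot up to `m` lies before `e`, and the slots passed hold no artificial
    -- tombstone of a hash greater than that of `u`
    push Not at hcase
    have habsent : ∀ g, Slot.grave g ∈ items n c → D / 2 ≤ E.offset n m (.grave g) := by
      intro g hg
      by_contra hcon
      push Not at hcon
      obtain ⟨-, p, hpn, hpg⟩ := mem_items.1 hg
      have hhg : E.home n (.grave g) < n := hpg ▸ hO.home_lt p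
      obtain ⟨γ, hγ⟩ := Nat.exists_eq_add_of_lt hcon
      have hhg' : b + (γ + 1) ≡ E.home n (.grave g) [MOD n] := by
        refine Nat.ModEq.add_right_cancel' (E.offset n m (.grave g)) ?_
        have h1 := (home_add_offset hhg m).symm
        have h2 : m = b + (γ + 1) + E.offset n m (.grave g) := by omega
        exact (congrArg (· % n) h2).symm.trans h1
      set o := E.offset n p (.grave g) with ho
      have hpos : b + (γ + 1) + o ≡ p [MOD n] :=
        (hhg'.add_right o).trans (home_add_offset hhg p)
      have hcell : c ((b + (γ + 1) + o) % n) = .grave g := by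
        rw [hpos, Nat.mod_eq_of_lt hpn, hpg]
      have hoff : E.offset n (b + (γ + 1) + o) (.grave g) = o := offset_congr hhg hpos
      have hne : c ((b + (γ + 1) + o) % n) ≠ .free := by rw [hcell]; simp
      rcases lt_or_ge (γ + 1 + o) D with h1 | h1
      · rcases (hp (γ + 1 + o) h1).2 with h2 | h2
        · apply h2
          left
          rw [← hb, ← add_assoc, hcell, hoff]
          omega
        · rw [← hb, ← add_assoc, hcell] at h2
          exact h2
      · have h2 := (hO.chain (p := e) (q := b + (γ + 1) + o) (by omega) hne (by
          rw [hcell, hoff]; omega)).2.le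
        rw [hcell, hoff] at h2
        omega
    right
    by_cases hpres : ∃ g, Slot.grave g ∈ items n c
    · left
      -- the present artificial tombstone nearest to `m` from the left
      obtain ⟨g, hg, hgmin⟩ : ∃ g, Slot.grave g ∈ items n c ∧ ∀ g', Slot.grave g' ∈ items n c →
          E.offset n m (.grave g) ≤ E.offset n m (.grave g') := by
        have hne : ∃ o g, Slot.grave g ∈ items n c ∧ E.offset n m (.grave g) = o := by
          obtain ⟨g, hg⟩ := hpres
          exact ⟨_, g, hg, rfl⟩
        obtain ⟨g, hg, hgo⟩ := Nat.find_spec hne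
        exact ⟨g, hg, fun g' hg' => by rw [hgo]; exact Nat.find_min' hne ⟨g', hg', rfl⟩⟩
      have hglt := offset_lt (E := E) hn m (.grave g)
      refine ⟨E.offset n m (.grave g), hglt, habsent g hg, ?_⟩
      have h1 := harcs m g hg
      have h2 : ((items n c).filter fun s => E.offset n m s ≤ E.offset n m (.grave g) ∧
          s ≠ .grave g).card ≤
          (Y.filter fun v => E.offset n m (.key v) ≤ E.offset n m (.grave g)).card := by
        have h3 := hcardle (fun s => (E.offset n m s ≤ E.offset n m (.grave g) ∧
          s ≠ .grave g) ∧ s ∈ {s | ∀ g', s = .grave g' → s ∈ items n c}) (by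
            intro v hv; exact ⟨⟨hv.1.1, by simp⟩, by intro g' hg'; cases hg'⟩)
        have h4 : ((graves E.t n).filter fun g' =>
            (E.offset n m (.grave g') ≤ E.offset n m (.grave g) ∧
              (Slot.grave g' : Slot U) ≠ .grave g) ∧
              (Slot.grave g' : Slot U) ∈ {s | ∀ g', s = .grave g' → s ∈ items n c}) = ∅ := by
          refine Finset.filter_eq_empty_iff.2 fun g' hg' ⟨⟨h5, h6⟩, h7⟩ => h6 ?_
          have h8 := hgmin g' (h7 g' rfl)
          obtain ⟨-, p', hp', hpg'⟩ := mem_items.1 (h7 g' rfl)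
          obtain ⟨-, p, hp, hpg⟩ := mem_items.1 hg
          have h9 := home_eq_of_offset_eq (E := E) (s := .grave g') (s' := .grave g)
            (hpg' ▸ hO.home_lt p') (hpg ▸ hO.home_lt p) (le_antisymm h5 h8)
          rw [home_grave, home_grave] at h9
          rw [h9]
        rw [h4, Finset.card_empty, add_zero] at h3
        refine le_trans (le_of_eq ?_) (h3.trans (Finset.card_le_card fun v hv => ?_))
        · congr 1
          refine Finset.filter_congr fun s hs => ?_
          simp only [Set.mem_ofPred_eq]
          exact ⟨fun h => ⟨h, fun _ _ => hs⟩, fun h => h.1⟩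
        · rw [Finset.mem_filter] at hv ⊢
          exact ⟨hv.1, hv.2.1.1⟩
      have h3 : (Y.filter fun v => E.offset n m (.key v) ≤ E.offset n m (.grave g)).card =
          (X₀.filter fun v => E.offset n m (.key v) ≤ E.offset n m (.grave g)).card +
          ((Y \ X₀).filter fun v => E.offset n m (.key v) ≤ E.offset n m (.grave g)).card := by
        rw [← Finset.card_union_of_disjoint, ← Finset.filter_union,
          Finset.union_sdiff_of_subset h.base_sub]
        exact Finset.disjoint_filter_filter Finset.disjoint_sdiff
      have h4 := le_card_graves_arc (E := E) (n := n) (t := E.t) (by omega) hn m hglt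
      refine h4.trans (Nat.mul_le_mul_left _ ?_)
      omega
    · -- without any artificial tombstone left, as many keys have been added as there were
      -- artificial tombstones, which is more than a window allows
      right
      by_contra hcon
      push Not at hpres hcon
      have h1 := htotal
      have h2 := hcardle (fun s => s ∈ {s | s ∈ items n c ∨ ∃ v, s = .key v}) (by
        intro v _; exact Or.inr ⟨v, rfl⟩)
      have h3 : ((graves E.t n).filter fun g =>
          (Slot.grave g : Slot U) ∈ {s | s ∈ items n c ∨ ∃ v, s = .key v}) = ∅ := by
        refine Finset.filter_eq_empty_iff.2 fun g _ hg => ?_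
        rcases hg with hg | ⟨v, hv⟩
        · exact hpres g hg
        · cases hv
      have hall : ∀ s ∈ items n c, s ∈ {s | s ∈ items n c ∨ ∃ v, s = Slot.key v} :=
        fun s hs => Or.inl hs
      rw [h3, Finset.card_empty, add_zero, Finset.filter_true_of_mem hall] at h2
      have h4 := h2.trans (Finset.card_filter_le _ _)
      have h5 := hseen
      rw [card_graves (by omega)] at h1
      unfold Env.window at h5
      have h6 : 1 ≤ n / (2 * E.t) := (Nat.one_le_div_iff (by omega)).2 hcon
      have h7 : 2 * (n / (4 * E.t)) ≤ n / (2 * E.t) := by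
        rw [show 4 * E.t = 2 * E.t * 2 by ring, ← Nat.div_div_eq_div_mul]
        exact Nat.mul_div_le _ _
      omega

/-! ### Laying out a sorted list of items -/

/-- The first available position after laying out `i` items with hashes `h 0, h 1, …` from position
`q` on. -/
def nextPos (q : ℕ) (h : ℕ → ℕ) : ℕ → ℕ
  | 0 => q
  | i + 1 => max (nextPos q h i) (h i) + 1

lemma nextPos_eq_max (q : ℕ) (h : ℕ → ℕ) (i : ℕ) :
    nextPos q h i = max (nextPos 0 h i) (q + i) := by
  induction i with
  | zero => simp [nextPos]
  | succ i ih => simp only [nextPos, ih]; omega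

lemma nextPos_lt_succ (q : ℕ) (h : ℕ → ℕ) (i : ℕ) : nextPos q h i < nextPos q h (i + 1) := by
  simp only [nextPos]; omega

lemma nextPos_mono (q : ℕ) (h : ℕ → ℕ) : Monotone (nextPos q h) :=
  monotone_nat_of_le_succ fun i => (nextPos_lt_succ q h i).le

section Sequence

variable {h : ℕ → ℕ} {m N : ℕ}

lemma nextPos_le_add (hmono : ∀ i, i + 1 < m → h i ≤ h (i + 1)) {i : ℕ} (hi : i < m) :
    nextPos 0 h i ≤ h i + i := by
  induction i with
  | zero => simp [nextPos]
  | succ i ih =>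
    have := ih (by omega)
    have := hmono i hi
    simp only [nextPos]
    omega

lemma nextPos_add_le (hlt : ∀ i < m, h i < N) (q : ℕ) {i k : ℕ} (hik : i + k ≤ m) :
    nextPos q h (i + k) ≤ max (nextPos q h i) (N - 1) + k := by
  induction k with
  | zero => simp
  | succ k ih =>
    have := ih (by omega)
    have := hlt (i + k) (by omega)
    rw [← add_assoc]
    simp only [nextPos]
    omega

/-- If the sweep starts behind the room for the items that will wrap around, it ends at most one
round after its start, and exactly there if there is such room. Thus the wrapped items just fill
the room. -/
lemma nextPos_wrap_le (hlt : ∀ i < m, h i < N) (hm : m < N) :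
    nextPos (nextPos 0 h m - N) h m ≤ nextPos 0 h m - N + N ∧
    nextPos (nextPos 0 h m - N) h m ≤ 2 * N ∧
    (0 < nextPos 0 h m - N → nextPos (nextPos 0 h m - N) h m = nextPos 0 h m - N + N) := by
  have h1 := nextPos_eq_max (nextPos 0 h m - N) h m
  have h2 := nextPos_add_le hlt 0 (i := 0) (k := m) (by omega)
  simp only [zero_add, nextPos] at h2
  omega

/-- With the room left for wrapped items, no item is displaced all around the table. -/
lemma nextPos_wrap_lt (hmono : ∀ i, i + 1 < m → h i ≤ h (i + 1)) (hlt : ∀ i < m, h i < N)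
    (hm : m < N) {i : ℕ} (hi : i < m) :
    nextPos (nextPos 0 h m - N) h i < h i + N := by
  have h1 := nextPos_eq_max (nextPos 0 h m - N) h i
  have h2 := nextPos_le_add hmono hi
  have h3 := nextPos_add_le hlt 0 (i := i) (k := m - i) (by omega)
  rw [show i + (m - i) = m by omega] at h3
  omega

end Sequence

/-- Contents of the new table, and first available position, after laying out the items of a list
from position `q` on in a table with contents `c`. -/
noncomputable def lay (E : Env U) (n : ℕ) (c : ℕ → Slot U) (q : ℕ) (P : List (Slot U)) :
    (ℕ → Slot U) × ℕ :=
  P.foldl (fun cq s => (Function.update cq.1 (max cq.2 (E.home n s) % n) s,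
    max cq.2 (E.home n s) + 1)) (c, q)

lemma lay_append_singleton (c : ℕ → Slot U) (q : ℕ) (P : List (Slot U)) (s : Slot U) :
    lay E n c q (P ++ [s]) =
      (Function.update (lay E n c q P).1 (max (lay E n c q P).2 (E.home n s) % n) s,
        max (lay E n c q P).2 (E.home n s) + 1) := by
  simp [lay]

lemma lay_take (c : ℕ → Slot U) (q : ℕ) (P : List (Slot U)) {k : ℕ} (hk : k ≤ P.length) :
    (lay E n c q (P.take k)).2 = nextPos q (fun i => E.home n (P.getD i .free)) k := by
  induction k with
  | zero => simp [lay, nextPos]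
  | succ k ih =>
    have hlt : k < P.length := by omega
    rw [List.take_succ_eq_append_getElem hlt, lay_append_singleton]
    simp only [nextPos]
    rw [ih (by omega), List.getD_eq_getElem _ _ hlt]

lemma lay_next (c : ℕ → Slot U) (q : ℕ) (P : List (Slot U)) :
    (lay E n c q P).2 = nextPos q (fun i => E.home n (P.getD i .free)) P.length := by
  rw [← lay_take c q P le_rfl, List.take_length]

/-- A sweep that takes at most one round puts no two items into the same slot. -/
lemma lay_cell {q : ℕ} {P : List (Slot U)} (c : ℕ → Slot U)
    (hq : nextPos q (fun i => E.home n (P.getD i .free)) P.length ≤ q + n) {k : ℕ}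
    (hk : k ≤ P.length) :
    (∀ i < k, (lay E n c q (P.take k)).1
      ((nextPos q (fun i => E.home n (P.getD i .free)) (i + 1) - 1) % n) = P.getD i .free) ∧
    (∀ p, (∀ i < k, p ≠ (nextPos q (fun i => E.home n (P.getD i .free)) (i + 1) - 1) % n) →
      (lay E n c q (P.take k)).1 p = c p) := by
  set h : ℕ → ℕ := fun i => E.home n (P.getD i .free) with hh
  induction k with
  | zero => simp [lay]
  | succ k ih =>
    have hlt : k < P.length := by omega
    obtain ⟨ih1, ih2⟩ := ih (by omega)
    have hpos : max (lay E n c q (P.take k)).2 (E.home n P[k]) = nextPos q h (k + 1) - 1 := by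
      rw [lay_take c q P (by omega)]
      simp only [nextPos, hh]
      rw [List.getD_eq_getElem _ _ hlt]
      omega
    rw [List.take_succ_eq_append_getElem hlt, lay_append_singleton]
    simp only [hpos]
    refine ⟨fun i hi => ?_, fun p hp => ?_⟩
    · rcases Nat.lt_succ_iff_lt_or_eq.1 hi with hi' | rfl
      · rw [Function.update_of_ne, ih1 i hi']
        intro he
        have h1 := nextPos_mono q h (Nat.zero_le i)
        have h2 := nextPos_mono q h (show i + 1 ≤ k by omega)
        have h3 := nextPos_mono q h (show k + 1 ≤ P.length by omega)
        have h4 := nextPos_lt_succ q h i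
        have h5 := nextPos_lt_succ q h k
        have h6 : nextPos q h 0 = q := rfl
        obtain ⟨x, hx⟩ := Nat.exists_eq_add_of_le (show q ≤ nextPos q h (i + 1) - 1 by omega)
        obtain ⟨y, hy⟩ := Nat.exists_eq_add_of_le (show q ≤ nextPos q h (k + 1) - 1 by omega)
        rw [hx, hy] at he
        have := add_mod_inj (by omega) (by omega) he
        omega
      · rw [Function.update_self, List.getD_eq_getElem _ _ hlt]
    · rw [Function.update_of_ne (hp k (by omega))]
      exact ih2 p fun i hi => hp i (by omega)

/-- A sorted list of fewer than `n` items is laid out as an ordered table of `n` slots, if the sweep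
starts behind the room needed for the items that will wrap around. This room is read off a first
sweep, whose target `c₀` does not matter. -/
lemma ordered_lay {P : List (Slot U)}
    (hsort : P.Pairwise fun s s' => E.val n s < E.val n s')
    (hlt : ∀ s ∈ P, E.home n s < n) (hfree : ∀ s ∈ P, s ≠ .free) (hlen : P.length < n)
    (c₀ : ℕ → Slot U) :
    let L := lay E n (fun _ => .free) ((lay E n c₀ 0 P).2 - n) P
    Ordered E n L.1 ∧ (∀ s, s ≠ .free → (s ∈ P ↔ ∃ p, L.1 p = s)) ∧
      (∀ p, L.1 p ≠ .free → p < n) ∧ L.2 ≤ 2 * n := by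
  intro L
  set h : ℕ → ℕ := fun i => E.home n (P.getD i .free) with hh
  set m := P.length with hm
  have hn : 0 < n := by omega
  have hget : ∀ i, (hi : i < m) → P.getD i .free = P[i] := fun i hi => List.getD_eq_getElem _ _ hi
  have hlt' : ∀ i < m, h i < n := fun i hi => by
    simp only [hh, hget i hi]; exact hlt _ (List.getElem_mem _)
  have hval : ∀ i j, i < j → j < m →
      E.val n (P.getD i .free) < E.val n (P.getD j .free) := fun i j hij hj => by
    rw [hget i (by omega), hget j hj]
    exact List.pairwise_iff_getElem.1 hsort i j _ _ hij
  have hmono : ∀ i, i + 1 < m → h i ≤ h (i + 1) := fun i hi =>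
    Nat.floor_le_floor (hval i (i + 1) (by omega) hi).le
  have hdry : (lay E n c₀ 0 P).2 = nextPos 0 h m := lay_next _ _ _
  obtain ⟨w1, w2, w3⟩ := nextPos_wrap_le hlt' hlen
  have w4 := fun i hi => nextPos_wrap_lt hmono hlt' hlen (i := i) hi
  have hL : L = lay E n (fun _ => .free) (nextPos 0 h m - n) P := by
    simp only [L, hdry]
  set q := nextPos 0 h m - n with hqdef
  have hcell := lay_cell (E := E) (n := n) (q := q) (P := P) (fun _ => .free) w1 (k := m) le_rfl
  rw [hm, List.take_length, ← hL, ← hm] at hcell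
  obtain ⟨hc1, hc2⟩ := hcell
  -- position of the item number `i`
  set r : ℕ → ℕ := fun i => nextPos q h (i + 1) - 1 with hr
  have hrmax : ∀ i, r i = max (nextPos q h i) (h i) := fun i => by
    simp only [hr, nextPos]; omega
  have hcr : ∀ i < m, L.1 (r i % n) = P.getD i .free := hc1
  have hinv : ∀ p, L.1 p ≠ .free → ∃ i < m, p = r i % n := by
    intro p hp
    by_contra hcon
    push Not at hcon
    exact hp (hc2 p hcon)
  have hoff : ∀ i < m, ∀ p, p ≡ r i [MOD n] → E.offset n p (P.getD i .free) = r i - h i := by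
    intro i hi p hp
    refine offset_eq (hlt' i hi) ?_ ?_
    · have := w4 i hi
      have := hrmax i
      omega
    · have := hrmax i
      have h1 : E.home n (P.getD i .free) + (r i - h i) = r i := by
        change h i + (r i - h i) = r i
        omega
      rw [h1]; exact hp.symm
  refine ⟨⟨fun p => ?_, fun p hp ho => ?_⟩, fun s hs => ⟨fun hsP => ?_, ?_⟩, fun p hp => ?_, ?_⟩
  · by_cases hp : L.1 p = .free
    · rw [hp]; simpa [Env.home, Env.val] using hn
    · obtain ⟨i, hi, rfl⟩ := hinv p hp
      rw [hcr i hi]; exact hlt' i hi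
  · obtain ⟨i, hi, hpi⟩ := hinv _ hp
    rw [hpi, hcr i hi, hoff i hi (p + 1) hpi] at ho
    have hri := hrmax i
    have hq0 : nextPos q h 0 = q := rfl
    -- the item before it, around the end of the table if it is the first one
    obtain ⟨k, hk, hpk, hord⟩ : ∃ k < m, p ≡ r k [MOD n] ∧
        (r i - h i + p < r k - h k + (p + 1) ∨ (r i - h i + p = r k - h k + (p + 1) ∧
          E.val n (P.getD k .free) < E.val n (P.getD i .free))) := by
      rcases Nat.eq_zero_or_pos i with rfl | hi0
      · have h1 : 0 < q := by omega
        have h2 := w3 h1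
        have h3 : r (m - 1) = q + n - 1 := by
          simp only [hr]
          rw [show m - 1 + 1 = m by omega, h2]
        have h4 := hlt' (m - 1) (by omega)
        refine ⟨m - 1, by omega, ?_, Or.inl (by omega)⟩
        refine Nat.ModEq.add_right_cancel' 1 (Nat.ModEq.trans hpi ?_)
        rw [h3, show q + n - 1 + 1 = q + n by omega, show r 0 = q by omega]
        simp [Nat.ModEq]
      · obtain ⟨i, rfl⟩ := Nat.exists_eq_succ_of_ne_zero hi0.ne'
        rw [Nat.succ_eq_add_one] at *
        have h1 : r (i + 1) = r i + 1 := by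
          have h2 : r i = nextPos q h (i + 1) - 1 := rfl
          have h3 := nextPos_lt_succ q h i
          omega
        refine ⟨i, by omega, Nat.ModEq.add_right_cancel' 1 (by rw [← h1]; exact hpi), ?_⟩
        have h2 := hmono i hi
        have h3 := hval i (i + 1) (by omega) hi
        have h4 := hrmax i
        rcases h2.eq_or_lt with h2 | h2
        · right; exact ⟨by omega, h3⟩
        · left; omega
    have hcp : L.1 (p % n) = P.getD k .free := by rw [hpk]; exact hcr k hk
    rw [hcp, hpi, hcr i hi]
    refine ⟨?_, ?_⟩
    · rw [hget k hk]; exact hfree _ (List.getElem_mem _)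
    · unfold Env.Precedes
      rw [hoff k hk p hpk, hoff i hi (p + 1) hpi]
      exact hord
  · obtain ⟨i, hi, rfl⟩ := List.getElem_of_mem hsP
    exact ⟨_, by rw [hcr i hi, hget i hi]⟩
  · rintro ⟨p, rfl⟩
    obtain ⟨i, hi, rfl⟩ := hinv p hs
    rw [hcr i hi, hget i hi]
    exact List.getElem_mem _
  · obtain ⟨i, -, rfl⟩ := hinv p hp
    exact Nat.mod_lt _ hn
  · rw [hL, lay_next]
    exact w2

/-! ### The list of items laid out by a sweep -/

/-- The artificial tombstones number `g + 1, …, g'`. -/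
def graveList (t g g' : ℕ) : List (Slot U) :=
  (List.range' (g + 1) (g' - g)).map fun i => .grave (2 * t * i - 1)

/-- Add a key to the list, after all artificial tombstones that precede it. The number paired with
the list counts the artificial tombstones in it. -/
noncomputable def addKey (E : Env U) (n : ℕ) (lg : List (Slot U) × ℕ) (v : U) :
    List (Slot U) × ℕ :=
  (lg.1 ++ graveList E.t lg.2 (max lg.2 ((E.home n (.key v) + 1) / (2 * E.t))) ++ [.key v],
    max lg.2 ((E.home n (.key v) + 1) / (2 * E.t)))

/-- The keys of the table in the order of the slots, either the keys that lie past the wrap-around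
or the others. -/
noncomputable def keysOf (E : Env U) (n : ℕ) (c : ℕ → Slot U) (wrapped : Bool) (ps : List ℕ) :
    List U :=
  ps.filterMap fun p => match c p with
    | .key u => if decide (p < E.home n (.key u)) = wrapped then some u else none
    | _ => none

/-- The items of the new table with `n'` slots in the order in which a sweep lays them out. -/
noncomputable def plan (E : Env U) (n n' : ℕ) (c : ℕ → Slot U) : List (Slot U) :=
  let lg := (keysOf E n c false (List.range n) ++ keysOf E n c true (List.range n)).foldl
    (addKey E n') ([], 0)
  lg.1 ++ graveList E.t lg.2 (max lg.2 (n' / (2 * E.t)))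

/-- State of a sweep over the table in area `a`, whose contents are `c`, after laying out the list
`l`, which contains `g` artificial tombstones, from position `q` on in the other area, whose
contents were `c₀`. -/
structure Lays (E : Env U) (wet : Bool) (a : Bool) (n' : ℕ) (c c₀ : ℕ → Slot U) (q : ℕ)
    (L : Layout U) (l : List (Slot U)) (g : ℕ) : Prop where
  graves : L.graves = g
  next : L.next = (lay E n' c₀ q l).2
  old : L.mem.cell a = c
  new : L.mem.cell (!a) = if wet then (lay E n' c₀ q l).1 else c₀

namespace Lays

variable {wet a : Bool} {n' q g : ℕ} {c c₀ : ℕ → Slot U} {L : Layout U} {l : List (Slot U)}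

lemma put (h : Lays E wet a n' c c₀ q L l g) (s : Slot U) :
    Lays E wet a n' c c₀ q (put E wet (!a) n' (E.home n' s) s L) (l ++ [s]) g := by
  have hne : a ≠ !a := by cases a <;> simp
  refine ⟨h.graves, ?_, ?_, ?_⟩
  · rw [lay_append_singleton]; simp [Graveyard.put, h.next]
  · cases wet
    · simpa [Graveyard.put] using h.old
    · simp only [Graveyard.put, if_true, write_cell]
      rw [Function.update_of_ne hne, h.old]
  · rw [lay_append_singleton]
    have := h.new
    cases wet
    · simpa [Graveyard.put] using this
    · simp only [Graveyard.put, if_true, write_cell] at this ⊢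
      rw [Function.update_self, this, h.next]

lemma putGraves (h : Lays E wet a n' c c₀ q L l g) (ht : 0 < E.t) {lim fuel : ℕ}
    (hfuel : lim / (2 * E.t) ≤ g + fuel) :
    Lays E wet a n' c c₀ q (putGraves E wet (!a) n' lim fuel L)
      (l ++ graveList E.t g (max g (lim / (2 * E.t)))) (max g (lim / (2 * E.t))) := by
  have hend : lim / (2 * E.t) ≤ g → max g (lim / (2 * E.t)) = g ∧
      (graveList E.t g (max g (lim / (2 * E.t))) : List (Slot U)) = [] := by
    intro hle
    rw [max_eq_left hle]
    exact ⟨rfl, by simp [graveList]⟩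
  induction fuel generalizing L l g with
  | zero =>
    obtain ⟨h1, h2⟩ := hend hfuel
    rw [h2, h1, List.append_nil]
    exact h
  | succ fuel ih =>
    have hiff : 2 * E.t * (g + 1) - 1 < lim ↔ g + 1 ≤ lim / (2 * E.t) := by
      rw [Nat.le_div_iff_mul_le (by omega), mul_comm]
      have : 0 < (g + 1) * (2 * E.t) := by positivity
      omega
    unfold Graveyard.putGraves
    simp only [h.graves]
    split_ifs with hlt
    · rw [hiff] at hlt
      have h1 := h.put (.grave (2 * E.t * (g + 1) - 1))
      rw [home_grave] at h1
      have h2 : Lays E wet a n' c c₀ q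
          { Graveyard.put E wet (!a) n' (2 * E.t * (g + 1) - 1)
              (.grave (2 * E.t * (g + 1) - 1)) L with graves := g + 1 }
          (l ++ [.grave (2 * E.t * (g + 1) - 1)]) (g + 1) := ⟨rfl, h1.next, h1.old, h1.new⟩
      have h3 := ih h2 (by omega) (fun hle => by
        rw [max_eq_left hle]
        exact ⟨rfl, by simp [graveList]⟩)
      rw [max_eq_right (by omega)] at h3 ⊢
      have h4 : (graveList E.t g (lim / (2 * E.t)) : List (Slot U)) =
          .grave (2 * E.t * (g + 1) - 1) :: graveList E.t (g + 1) (lim / (2 * E.t)) := by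
        unfold graveList
        rw [show lim / (2 * E.t) - g = lim / (2 * E.t) - (g + 1) + 1 by omega, List.range'_succ]
        simp
      rw [h4]
      simpa using h3
    · rw [hiff] at hlt
      obtain ⟨h1, h2⟩ := hend (by omega)
      rw [h2, h1, List.append_nil]
      exact h

lemma visit (hlt : ∀ v, E.home n' (.key v) < n') (h : Lays E wet a n' c c₀ q L l g)
    (ht : 0 < E.t) (wrapped : Bool) (p : ℕ) :
    Lays E wet a n' c c₀ q (visit E wet a n n' wrapped L p)
      ((keysOf E n c wrapped [p]).foldl (addKey E n') (l, g)).1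
      ((keysOf E n c wrapped [p]).foldl (addKey E n') (l, g)).2 := by
  have h' : Lays E wet a n' c c₀ q { L with mem := touch E a p L.mem } l g :=
    ⟨h.graves, h.next, by simpa using h.old, by simpa using h.new⟩
  unfold Graveyard.visit keysOf
  rw [h.old]
  cases hc : c p with
  | key u =>
    by_cases hw : decide (p < E.home n (.key u)) = wrapped
    · simp only [hc, List.filterMap_cons, List.filterMap_nil, if_pos hw, List.foldl_cons,
        List.foldl_nil]
      refine (h'.putGraves ht ?_).put _
      have := Nat.div_le_self (E.home n' (.key u) + 1) (2 * E.t)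
      have := hlt u
      omega
    · simpa [hc, List.filterMap_cons, if_neg hw] using h'
  | free => simpa [hc] using h'
  | tomb u => simpa [hc] using h'
  | grave b => simpa [hc] using h'

lemma foldl_visit (hlt : ∀ v, E.home n' (.key v) < n') (h : Lays E wet a n' c c₀ q L l g)
    (ht : 0 < E.t) (wrapped : Bool) (ps : List ℕ) :
    Lays E wet a n' c c₀ q (ps.foldl (Graveyard.visit E wet a n n' wrapped) L)
      ((keysOf E n c wrapped ps).foldl (addKey E n') (l, g)).1
      ((keysOf E n c wrapped ps).foldl (addKey E n') (l, g)).2 := by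
  induction ps generalizing L l g with
  | nil => exact h
  | cons p ps ih =>
    have h1 := ih (h.visit hlt ht wrapped p (n := n))
    have h2 : keysOf E n c wrapped (p :: ps) =
        keysOf E n c wrapped [p] ++ keysOf E n c wrapped ps := by
      unfold keysOf
      rw [← List.filterMap_append]
      rfl
    rw [h2, List.foldl_append]
    exact h1

lemma sweep (hlt : ∀ v, E.home n' (.key v) < n') (h : Lays E wet a n' c c₀ q L [] 0)
    (ht : 0 < E.t) :
    ∃ g, Lays E wet a n' c c₀ q (sweep E wet a n n' L) (plan E n n' c) g := by
  unfold Graveyard.sweep plan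
  rw [List.foldl_append]
  exact ⟨_, ((h.foldl_visit hlt ht false (List.range n)).foldl_visit hlt ht true
    (List.range n)).putGraves ht ((Nat.div_le_self _ _).trans (Nat.le_add_left _ _))⟩

end Lays

/-! ### The list is sorted -/

lemma mem_graveList {t g g' : ℕ} {s : Slot U} :
    s ∈ graveList t g g' ↔ ∃ i, g < i ∧ i ≤ g' ∧ s = .grave (2 * t * i - 1) := by
  simp only [graveList, List.mem_map, List.mem_range'_1]
  constructor
  · rintro ⟨i, hi, rfl⟩
    exact ⟨i, by omega, by omega, rfl⟩
  · rintro ⟨i, h1, h2, rfl⟩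
    exact ⟨i, by omega, rfl⟩

lemma pairwise_graveList {t : ℕ} (ht : 0 < t) (g g' : ℕ) :
    (graveList t g g').Pairwise fun s s' : Slot U => E.val n s < E.val n s' := by
  rw [graveList, List.pairwise_map]
  refine List.Pairwise.imp_of_mem ?_ List.pairwise_lt_range'
  intro i j hi hj hij
  rw [List.mem_range'_1] at hi hj
  simp only [Env.val, Nat.cast_lt]
  have h1 : 2 * t * (i + 1) ≤ 2 * t * j := Nat.mul_le_mul_left _ hij
  have h2 : 0 < 2 * t * i := Nat.mul_pos (by omega) (by omega)
  rw [mul_add] at h1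
  omega

lemma floor_bounds {K : Set U} (hG : Generic E K) (u : U) :
    (E.home n (.key u) : ℝ) ≤ E.val n (.key u) ∧ E.val n (.key u) < E.home n (.key u) + 1 :=
  ⟨Nat.floor_le (val_nonneg hG.mem_Ico n _), Nat.lt_floor_add_one _⟩

lemma val_key_ne_nat {K : Set U} (hG : Generic E K) (hn : 0 < n) {u : U} (hu : u ∈ K) (m : ℕ) :
    E.val n (.key u) ≠ m :=
  ((hG.irrational u hu).mul_natCast hn.ne').ne_nat m

/-- The list of items under construction is sorted, and contains exactly the keys added and the
first `g` artificial tombstones, where `g` is given by the hash of the last key. -/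
lemma foldl_addKey {K : Set U} (hG : Generic E K) (ht : 0 < E.t) (hn : 0 < n) {us : List U}
    (hus : us.Pairwise fun u v => E.H u < E.H v) (hK : ∀ u ∈ us, u ∈ K) :
    let lg := us.foldl (addKey E n) ([], 0)
    lg.1.Pairwise (fun s s' => E.val n s < E.val n s') ∧
    (∀ s, s ∈ lg.1 ↔ (∃ u ∈ us, s = .key u) ∨ ∃ i, 0 < i ∧ i ≤ lg.2 ∧
      s = .grave (2 * E.t * i - 1)) ∧
    (∀ u ∈ us, (E.home n (.key u) + 1) / (2 * E.t) ≤ lg.2) ∧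
    (lg.2 = 0 ∨ ∃ u ∈ us, lg.2 = (E.home n (.key u) + 1) / (2 * E.t)) := by
  induction us using List.reverseRecOn with
  | nil => simp
  | append_singleton us v ih =>
    rw [List.pairwise_append] at hus
    obtain ⟨hus, -, huv⟩ := hus
    have huv' : ∀ u ∈ us, E.val n (.key u) < E.val n (.key v) := fun u hu => by
      have hn' : (0 : ℝ) < n := by exact_mod_cast hn
      exact mul_lt_mul_of_pos_right (huv u hu v (by simp)) hn'
    obtain ⟨i1, i2, i3, i4⟩ := ih hus fun u hu => hK u (by simp [hu])
    rw [List.foldl_append]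
    simp only [List.foldl_cons, List.foldl_nil]
    set lg := us.foldl (addKey E n) ([], 0) with hlg
    set x := (E.home n (.key v) + 1) / (2 * E.t) with hx
    -- artificial tombstones not beyond the hash of `v` come before `v`
    have hgv : ∀ i, 0 < i → i ≤ x →
        E.val n (.grave (2 * E.t * i - 1) : Slot U) < E.val n (.key v) := by
      intro i hi0 hi
      have h1 : 2 * E.t * i ≤ E.home n (.key v) + 1 :=
        (Nat.mul_le_mul_left _ hi).trans (Nat.mul_div_le _ _)
      have h2 : 2 * E.t * i - 1 ≤ E.home n (.key v) := by omega
      refine lt_of_le_of_ne ?_ (val_key_ne_nat hG hn (hK v (by simp)) _).symm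
      exact (Nat.cast_le.2 h2).trans (floor_bounds hG v).1
    have hold : ∀ i, 0 < i → i ≤ lg.2 →
        E.val n (.grave (2 * E.t * i - 1) : Slot U) < E.val n (.key v) := by
      intro i hi0 hi
      rcases i4 with h0 | ⟨u, hu, hgu⟩
      · omega
      · refine hgv i hi0 (hi.trans ?_)
        rw [hgu, hx]
        exact Nat.div_le_div_right (Nat.add_le_add_right (Nat.floor_le_floor (huv' u hu).le) 1)
    refine ⟨?_, ?_, ?_, ?_⟩
    · simp only [addKey]
      rw [List.pairwise_append, List.pairwise_append]
      refine ⟨⟨i1, pairwise_graveList ht _ _, ?_⟩, by simp, ?_⟩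
      · intro s hs s' hs'
        obtain ⟨i, hi1, hi2, rfl⟩ := mem_graveList.1 hs'
        rcases (i2 s).1 hs with ⟨u, hu, rfl⟩ | ⟨j, hj1, hj2, rfl⟩
        · have h1 := i3 u hu
          have h2 : (E.home n (.key u) + 1) / (2 * E.t) < i := by omega
          rw [Nat.div_lt_iff_lt_mul (by omega), mul_comm] at h2
          have h3 : E.home n (.key u) + 1 ≤ 2 * E.t * i - 1 := by omega
          refine (floor_bounds hG u).2.trans_le ?_
          simp only [Env.val]
          exact_mod_cast h3
        · simp only [Env.val, Nat.cast_lt]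
          have h1 : 2 * E.t * (j + 1) ≤ 2 * E.t * i := Nat.mul_le_mul_left _ (by omega)
          have h2 : 0 < 2 * E.t * j := Nat.mul_pos (by omega) hj1
          rw [mul_add] at h1
          omega
      · intro s hs s' hs'
        rw [List.mem_singleton] at hs'
        subst hs'
        rw [List.mem_append, i2, mem_graveList] at hs
        rcases hs with (⟨u, hu, rfl⟩ | ⟨j, hj1, hj2, rfl⟩) | ⟨j, hj1, hj2, rfl⟩
        · exact huv' u hu
        · exact hold j hj1 hj2
        · exact hgv j (by omega) (by omega)
    · intro s
      simp only [addKey, List.mem_append, i2, mem_graveList, List.mem_singleton]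
      constructor
      · rintro (((⟨u, hu, rfl⟩ | ⟨j, hj1, hj2, rfl⟩) | ⟨j, hj1, hj2, rfl⟩) | rfl)
        · exact Or.inl ⟨u, Or.inl hu, rfl⟩
        · exact Or.inr ⟨j, hj1, by omega, rfl⟩
        · exact Or.inr ⟨j, by omega, hj2, rfl⟩
        · exact Or.inl ⟨v, Or.inr rfl, rfl⟩
      · rintro (⟨u, hu | rfl, rfl⟩ | ⟨j, hj1, hj2, rfl⟩)
        · exact Or.inl (Or.inl (Or.inl ⟨u, hu, rfl⟩))
        · exact Or.inr rfl
        · by_cases hj : j ≤ lg.2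
          · exact Or.inl (Or.inl (Or.inr ⟨j, hj1, hj, rfl⟩))
          · exact Or.inl (Or.inr ⟨j, by omega, hj2, rfl⟩)
    · intro u hu
      simp only [addKey]
      rw [List.mem_append, List.mem_singleton] at hu
      rcases hu with hu | rfl
      · exact (i3 u hu).trans (le_max_left _ _)
      · exact le_max_right _ _
    · simp only [addKey]
      rcases le_total lg.2 x with hle | hle
      · right; exact ⟨v, by simp, by rw [max_eq_right hle]⟩
      · rw [max_eq_left hle]
        refine i4.imp id ?_
        rintro ⟨u, hu, h⟩
        exact ⟨u, by simp [hu], h⟩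

/-- A sweep over an ordered table visits the keys in the order of their hashes: the keys past the
wrap-around, which come last, are the only ones out of place. -/
lemma keys_sorted {c : ℕ → Slot U} (h : Ordered E n c) :
    (keysOf E n c false (List.range n) ++ keysOf E n c true (List.range n)).Pairwise
      fun u v => E.H u < E.H v := by
  have hn := h.pos
  have hn' : (0 : ℝ) < n := by exact_mod_cast hn
  have hmem : ∀ p u w, (match c p with
      | .key u => if decide (p < E.home n (.key u)) = w then some u else none
      | _ => none) = some u → c p = .key u ∧ (p < E.home n (.key u) ↔ w = true) := by
    intro p u w hp
    split at hp
    · rename_i v hv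
      split_ifs at hp with h1
      cases hp
      exact ⟨hv, by rw [← h1]; simp⟩
    · cases hp
  have hoff0 : ∀ p u, p < n → c p = .key u → E.home n (.key u) ≤ p →
      E.offset n p (.key u) = p - E.home n (.key u) := fun p u hp hu hle =>
    offset_eq (hu ▸ h.home_lt p) (by omega) (by rw [Nat.add_sub_cancel' hle])
  have hoff1 : ∀ p u, p < n → c p = .key u → p < E.home n (.key u) →
      E.offset n p (.key u) = p + n - E.home n (.key u) := fun p u hp hu hlt => by
    have hlt' : E.home n (.key u) < n := hu ▸ h.home_lt p
    refine offset_eq hlt' (by omega) ?_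
    rw [Nat.add_sub_cancel' (by omega)]; simp [Nat.ModEq]
  have hof : ∀ {u v}, E.val n (.key u) < E.val n (.key v) → E.H u < E.H v := fun {u v} huv =>
    lt_of_mul_lt_mul_right huv hn'.le
  have hofh : ∀ {u v}, E.home n (.key u) < E.home n (.key v) → E.H u < E.H v := fun {u v} huv => by
    refine hof ?_
    by_contra hc
    exact absurd huv (not_lt.2 (Nat.floor_le_floor (not_lt.1 hc)))
  have key : ∀ {p q u v}, p < n → c p = .key u → c (q % n) = .key v → p < q →
      E.home n (.key v) ≤ E.home n (.key u) → q ≤ p + E.offset n q (.key v) →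
      E.offset n p (.key u) + q ≤ E.offset n q (.key v) + p → E.H u < E.H v := by
    intro p q u v hp hu hv hpq hle ho hcmp
    have h1 := (h.chain hpq (by rw [hv]; simp) (by rw [hv]; exact ho)).2
    rw [hv, Nat.mod_eq_of_lt hp, hu] at h1
    rcases h1 with h1 | ⟨-, h1⟩
    · omega
    · exact hof h1
  have same : ∀ w, (keysOf E n c w (List.range n)).Pairwise fun u v => E.H u < E.H v := by
    intro w
    unfold keysOf
    rw [List.pairwise_filterMap]
    refine List.Pairwise.imp_of_mem ?_ List.pairwise_lt_range
    intro p q hp hq hpq u hu' v hv'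
    rw [List.mem_range] at hp hq
    obtain ⟨hu, hwu⟩ := hmem p u w hu'
    clear hu'
    obtain ⟨hv, hwv⟩ := hmem q v w hv'
    clear hv'
    rcases lt_or_ge (E.home n (.key u)) (E.home n (.key v)) with h1 | h1
    · exact hofh h1
    cases w
    · have h2 := hoff0 p u hp hu (by simpa using hwu)
      have h3 := hoff0 q v hq hv (by simpa using hwv)
      simp only [Bool.false_eq_true, iff_false, not_lt] at hwu hwv
      exact key hp hu (by rw [Nat.mod_eq_of_lt hq, hv]) hpq h1 (by omega) (by omega)
    · simp only [iff_true] at hwu hwv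
      have h2 := hoff1 p u hp hu hwu
      have h3 := hoff1 q v hq hv hwv
      have h4 : E.home n (.key u) < n := hu ▸ h.home_lt p
      exact key hp hu (by rw [Nat.mod_eq_of_lt hq, hv]) hpq h1 (by omega) (by omega)
  rw [List.pairwise_append]
  refine ⟨same false, same true, ?_⟩
  intro u hu v hv
  unfold keysOf at hu hv
  rw [List.mem_filterMap] at hu hv
  obtain ⟨p, hp, hu⟩ := hu
  obtain ⟨q, hq, hv⟩ := hv
  rw [List.mem_range] at hp hq
  obtain ⟨hu, hwu⟩ := hmem p u _ hu
  obtain ⟨hv, hwv⟩ := hmem q v _ hv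
  simp only [Bool.false_eq_true, iff_false, not_lt, iff_true] at hwu hwv
  rcases lt_or_ge (E.home n (.key u)) (E.home n (.key v)) with h1 | h1
  · exact hofh h1
  have h2 := hoff0 p u hp hu hwu
  have h3 := hoff1 q v hq hv hwv
  have h4 : E.offset n (q + n) (.key v) = E.offset n q (.key v) :=
    offset_congr (hv ▸ h.home_lt q) (by simp [Nat.ModEq])
  have h5 : E.home n (.key v) < n := hv ▸ h.home_lt q
  exact key hp hu (by rw [Nat.add_mod_right, Nat.mod_eq_of_lt hq, hv]) (by omega) h1 (by omega)
    (by omega)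

/-! ### Rebuilding the table -/

lemma mem_keysOf {c : ℕ → Slot U} {u : U} :
    u ∈ keysOf E n c false (List.range n) ++ keysOf E n c true (List.range n) ↔
      ∃ p < n, c p = .key u := by
  simp only [List.mem_append, keysOf, List.mem_filterMap, List.mem_range]
  constructor
  · rintro (⟨p, hp, h⟩ | ⟨p, hp, h⟩)
    all_goals
      split at h
      · rename_i v hv
        split_ifs at h
        cases h
        exact ⟨p, hp, hv⟩
      · cases h
  · rintro ⟨p, hp, h⟩
    by_cases hw : p < E.home n (.key u)
    · exact Or.inr ⟨p, hp, by simp [h, hw]⟩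
    · exact Or.inl ⟨p, hp, by simp [h]; omega⟩

lemma mem_graves {t a : ℕ} :
    a ∈ graves t n ↔ ∃ i, 0 < i ∧ i ≤ n / (2 * t) ∧ a = 2 * t * i - 1 := by
  simp only [graves, Finset.mem_image, Finset.mem_range]
  constructor
  · rintro ⟨i, hi, rfl⟩
    exact ⟨i + 1, by omega, by omega, rfl⟩
  · rintro ⟨i, h1, h2, rfl⟩
    exact ⟨i - 1, by omega, by rw [Nat.sub_add_cancel (by omega)]⟩

/-- The list of items laid out by a rebuild is sorted and consists of the keys of the table and the
artificial tombstones of the new table. -/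
lemma plan_spec {K : Set U} (hG : Generic E K) (ht : 0 < E.t) {c : ℕ → Slot U} {n' : ℕ}
    (hn' : 0 < n') (h : Ordered E n c) (hK : ∀ p u, c p = .key u → u ∈ K) :
    (plan E n n' c).Pairwise (fun s s' => E.val n' s < E.val n' s') ∧
    ∀ s, s ∈ plan E n n' c ↔ (∃ u, (∃ p < n, c p = .key u) ∧ s = .key u) ∨
      ∃ a ∈ graves E.t n', s = .grave a := by
  obtain ⟨h1, h2, h3, h4⟩ := foldl_addKey (n := n') hG ht hn' (keys_sorted h) fun u hu => by
    obtain ⟨p, -, hp⟩ := mem_keysOf.1 hu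
    exact hK p u hp
  unfold plan
  set lg := (keysOf E n c false (List.range n) ++ keysOf E n c true (List.range n)).foldl
    (addKey E n') ([], 0) with hlg
  have hle : lg.2 ≤ n' / (2 * E.t) := by
    rcases h4 with h4 | ⟨u, -, h4⟩
    · rw [h4]; exact Nat.zero_le _
    · rw [h4]
      exact Nat.div_le_div_right (home_key_lt hG.mem_Ico hn' u)
  simp only [max_eq_right hle]
  constructor
  · rw [List.pairwise_append]
    refine ⟨h1, pairwise_graveList ht _ _, fun s hs s' hs' => ?_⟩
    obtain ⟨i, hi1, hi2, rfl⟩ := mem_graveList.1 hs'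
    rcases (h2 s).1 hs with ⟨u, hu, rfl⟩ | ⟨j, hj1, hj2, rfl⟩
    · have h5 : (E.home n' (.key u) + 1) / (2 * E.t) < i := (h3 u hu).trans_lt hi1
      rw [Nat.div_lt_iff_lt_mul (by omega), mul_comm] at h5
      have h6 : E.home n' (.key u) + 1 ≤ 2 * E.t * i - 1 := by omega
      refine (floor_bounds hG u).2.trans_le ?_
      simp only [Env.val]
      exact_mod_cast h6
    · simp only [Env.val, Nat.cast_lt]
      have h5 : 2 * E.t * (j + 1) ≤ 2 * E.t * i := Nat.mul_le_mul_left _ (by omega)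
      have h6 : 0 < 2 * E.t * j := Nat.mul_pos (by omega) hj1
      rw [mul_add] at h5
      omega
  · intro s
    rw [List.mem_append, h2, mem_graveList]
    constructor
    · rintro ((⟨u, hu, rfl⟩ | ⟨j, hj1, hj2, rfl⟩) | ⟨j, hj1, hj2, rfl⟩)
      · exact Or.inl ⟨u, mem_keysOf.1 hu, rfl⟩
      · exact Or.inr ⟨_, mem_graves.2 ⟨j, hj1, by omega, rfl⟩, rfl⟩
      · exact Or.inr ⟨_, mem_graves.2 ⟨j, by omega, by omega, rfl⟩, rfl⟩
    · rintro (⟨u, hu, rfl⟩ | ⟨a, ha, rfl⟩)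
      · exact Or.inl (Or.inl ⟨u, mem_keysOf.2 hu, rfl⟩)
      · obtain ⟨j, hj1, hj2, rfl⟩ := mem_graves.1 ha
        by_cases hj : j ≤ lg.2
        · exact Or.inl (Or.inr ⟨j, hj1, hj, rfl⟩)
        · exact Or.inr ⟨j, by omega, hj2, rfl⟩

lemma erase_cell (a : Bool) (k : ℕ) (m : Mem U) :
    (∀ b, b ≠ a → ((List.range k).foldl (fun m p => write E a p .free m) m).cell b = m.cell b) ∧
    ∀ p, ((List.range k).foldl (fun m p => write E a p .free m) m).cell a p =
      if p < k then .free else m.cell a p := by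
  induction k with
  | zero => simp
  | succ k ih =>
    rw [List.range_succ, List.foldl_append]
    simp only [List.foldl_cons, List.foldl_nil, write_cell]
    refine ⟨fun b hb => by rw [Function.update_of_ne hb]; exact ih.1 b hb, fun p => ?_⟩
    rw [Function.update_self]
    by_cases hp : p = k
    · subst hp; simp
    · rw [Function.update_of_ne hp, ih.2]
      by_cases h1 : p < k
      · rw [if_pos h1, if_pos (by omega)]
      · rw [if_neg h1, if_neg (by omega)]

/-- Layout state before the first sweep of a rebuild, and after it. -/
noncomputable def dryLayout (E : Env U) (T : Table U) : Layout U :=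
  sweep E false T.area T.n (E.size T.count) ⟨T.mem, 0, 0⟩

/-- Layout state after the second sweep of a rebuild. -/
noncomputable def wetLayout (E : Env U) (T : Table U) : Layout U :=
  sweep E true T.area T.n (E.size T.count)
    ⟨(dryLayout E T).mem, (dryLayout E T).next - E.size T.count, 0⟩

lemma size_pos (N : ℕ) : 3 ≤ E.size N := Nat.le_add_left _ _

/-- A rebuild establishes the invariant anew, with the keys present as those of the last rebuild.
Its second sweep writes at most two rounds of slots. -/
lemma rebuild_spec {K : Set U} (hG : Generic E K) (ht : 2 ≤ E.t) {T : Table U}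
    {X X₀ Y : Finset U} (h : Inv E T X X₀ Y) (hY : ↑Y ⊆ K) :
    Inv E (rebuild E T) X X X ∧ (wetLayout E T).next ≤ 2 * E.size T.count := by
  classical
  have hcount := h.count
  set n' := E.size T.count with hn'
  have hn'0 : 0 < n' := by have := size_pos (E := E) T.count; omega
  set c := T.mem.cell T.area with hc
  have hlt : ∀ v, E.home n' (.key v) < n' := home_key_lt hG.mem_Ico hn'0
  have hkey : ∀ u, (∃ p < T.n, c p = .key u) ↔ u ∈ X := fun u => by
    rw [h.key]
    exact ⟨fun ⟨p, _, hp⟩ => ⟨p, hp⟩, fun ⟨p, hp⟩ => ⟨p, h.lt_of_cell (by rw [hp]; simp), hp⟩⟩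
  have hother : T.mem.cell (!T.area) = fun _ => .free := by
    funext p
    by_contra hp
    have := (h.outside _ p hp).1
    cases hb : T.area <;> simp [hb] at this
  obtain ⟨hsort, hmem⟩ := plan_spec (n' := n') hG (by omega) hn'0 h.ordered
    fun p u hp => hY (h.mem_seen hp)
  set P := plan E T.n n' c with hP
  have hmem' : ∀ s, s ∈ P ↔ s ∈ X.image Slot.key ∪ (graves E.t n').image Slot.grave := by
    intro s
    rw [hmem, Finset.mem_union, Finset.mem_image, Finset.mem_image]
    refine or_congr ?_ ?_
    · exact ⟨fun ⟨u, hu, hs⟩ => ⟨u, (hkey u).1 hu, hs.symm⟩,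
        fun ⟨u, hu, hs⟩ => ⟨u, (hkey u).2 hu, hs.symm⟩⟩
    · exact ⟨fun ⟨a, ha, hs⟩ => ⟨a, ha, hs.symm⟩, fun ⟨a, ha, hs⟩ => ⟨a, ha, hs.symm⟩⟩
  have hlen : P.length < n' := by
    have hnd : P.Nodup := hsort.imp fun hlt he => hlt.ne (by rw [he])
    rw [← List.toFinset_card_of_nodup hnd]
    have h1 : P.toFinset ⊆ X.image Slot.key ∪ (graves E.t n').image Slot.grave := fun s hs =>
      (hmem' s).1 (List.mem_toFinset.1 hs)
    have h2 := Finset.card_le_card h1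
    have h3 := Finset.card_union_le (X.image Slot.key) ((graves E.t n').image Slot.grave)
    have h4 := Finset.card_image_le (s := X) (f := Slot.key)
    have h5 := Finset.card_image_le (s := graves E.t n') (f := (Slot.grave : ℕ → Slot U))
    have h6 := seen_add_graves_lt (E := E) ht hn' (y := X.card) (by omega)
    rw [card_graves (by omega)] at h5
    omega
  obtain ⟨hO, hP1, hP2, hP3⟩ := ordered_lay (n := n') hsort
    (fun s hs => by
      rcases (hmem s).1 hs with ⟨u, -, rfl⟩ | ⟨a, ha, rfl⟩
      · exact hlt u
      · rw [home_grave]; exact lt_of_mem_graves (by omega) ha)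
    (fun s hs => by rcases (hmem s).1 hs with ⟨u, -, rfl⟩ | ⟨a, ha, rfl⟩ <;> simp)
    hlen (fun _ => .free)
  -- the two sweeps
  obtain ⟨g, hdry⟩ := Lays.sweep (E := E) (wet := false) (a := T.area) (n := T.n) (n' := n')
    (c := c) (c₀ := fun _ => .free) (q := 0) (L := ⟨T.mem, 0, 0⟩) hlt
    ⟨rfl, rfl, rfl, by simpa using hother⟩ (by omega)
  obtain ⟨g', hwet⟩ := Lays.sweep (E := E) (wet := true) (a := T.area) (n := T.n) (n' := n')
    (c := c) (c₀ := fun _ => .free) (q := (lay E n' (fun _ => .free) 0 P).2 - n')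
    (L := ⟨(dryLayout E T).mem, (dryLayout E T).next - n', 0⟩) hlt
    ⟨rfl, by simp only [dryLayout]; rw [hdry.next]; rfl, hdry.old,
      by simpa [lay, dryLayout] using hdry.new⟩ (by omega)
  change Lays E true T.area n' c _ _ (wetLayout E T) P g' at hwet
  refine ⟨?_, hwet.next ▸ hP3⟩
  have hreb : rebuild E T =
      { mem := (List.range T.n).foldl (fun m p => write E T.area p .free m) (wetLayout E T).mem
        area := !T.area, n := n', count := T.count, left := E.window n' } := rfl
  have hne : (!T.area) ≠ T.area := by cases T.area <;> simp
  obtain ⟨her1, her2⟩ := erase_cell (E := E) T.area T.n (wetLayout E T).mem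
  set m' := (List.range T.n).foldl (fun m p => write E T.area p .free m) (wetLayout E T).mem
    with hm'
  have hnew : m'.cell (!T.area) =
      (lay E n' (fun _ => .free) ((lay E n' (fun _ => .free) 0 P).2 - n') P).1 := by
    rw [her1 _ hne, hwet.new, if_pos rfl]
  have hold : ∀ p, m'.cell T.area p = .free := by
    intro p
    rw [her2, hwet.old]
    split_ifs with hp
    · rfl
    · by_contra hcp; exact hp (h.lt_of_cell hcp)
  set c' := (lay E n' (fun _ => .free) ((lay E n' (fun _ => .free) 0 P).2 - n') P).1 with hc'
  have hitems : items n' c' = X.image Slot.key ∪ (graves E.t n').image Slot.grave := by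
    ext s
    rw [mem_items, ← hmem']
    constructor
    · rintro ⟨hs, p, -, hp⟩
      exact (hP1 s hs).2 ⟨p, hp⟩
    · intro hs
      have hsf : s ≠ .free := by
        rcases (hmem s).1 hs with ⟨u, -, rfl⟩ | ⟨a, ha, rfl⟩ <;> simp
      obtain ⟨p, hp⟩ := (hP1 s hsf).1 hs
      exact ⟨hsf, p, hP2 p (by rw [hp]; exact hsf), hp⟩
  have hcard : ∀ (φ : Slot U → Prop) [DecidablePred φ], (X.filter fun v => φ (.key v)).card +
      ((graves E.t n').filter fun a => φ (.grave a)).card ≤ ((items n' c').filter φ).card := by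
    intro φ _
    rw [hitems, Finset.filter_union, Finset.card_union_of_disjoint]
    · rw [Finset.filter_image, Finset.filter_image,
        Finset.card_image_of_injective _ (fun _ _ h => by simpa using h),
        Finset.card_image_of_injective _ (fun _ _ h => by simpa using h)]
    · rw [Finset.disjoint_left]
      intro s hs hs'
      simp only [Finset.mem_filter, Finset.mem_image] at hs hs'
      obtain ⟨⟨u, -, rfl⟩, -⟩ := hs
      obtain ⟨⟨a, -, ha⟩, -⟩ := hs'
      cases ha
  rw [hreb]
  refine ⟨fun b p hp => ?_, ?_, fun p => ?_, fun u => ?_, hcount, ?_, subset_refl _, ?_, ?_,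
    fun m g hg => ?_, ?_⟩
  · simp only at hp ⊢
    have hb : b = !T.area := by
      by_contra hb
      have : b = T.area := by cases b <;> cases hA : T.area <;> simp_all
      subst this
      exact hp (hold p)
    subst hb
    rw [hnew] at hp
    exact ⟨rfl, hP2 p hp⟩
  · simp only; rw [hnew]; exact hO
  · simp only
    rw [hnew]
    by_cases hp : c' p = .free
    · rw [hp]; trivial
    · rcases (hmem _).1 ((hP1 _ hp).2 ⟨p, rfl⟩) with ⟨u, hu, he⟩ | ⟨a, ha, he⟩
      · rw [he]; exact (hkey u).1 hu
      · rw [he]; exact ha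
  · simp only
    rw [hnew, ← hP1 _ (by simp), hmem]
    simp only [Slot.key.injEq, reduceCtorEq, and_false, exists_false, or_false,
      exists_eq_right']
    exact (hkey u).symm
  · simp only; rw [hn', hcount]
  · simp
  · simp
  · simp only
    rw [hnew]
    refine le_trans (Nat.add_le_add ?_ ?_) (hcard _)
    · exact Finset.card_le_card fun v hv => by
        rw [Finset.mem_filter] at hv ⊢
        exact ⟨hv.1, hv.2, by simp⟩
    · exact Finset.card_le_card fun v hv => by
        rw [Finset.mem_filter] at hv ⊢
        refine ⟨hv.1, hv.2.le, ?_⟩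
        intro he
        rw [he] at hv
        exact lt_irrefl _ hv.2
  · simp only
    rw [hnew]
    simpa using hcard fun _ => True

/-! ### The cost of a rebuild -/

open Classical in
/-- Potential for scans that work on one block of each area at a time, at present on the blocks
`(a, f a)`: the number of these blocks that are not in internal memory, and one more if the block
used last is neither of them (so that the next access to one may evict the other). -/
noncomputable def pot (f : Bool → ℕ) (m : Mem U) : ℕ :=
  (if (false, f false) ∈ m.cache then 0 else 1) + (if (true, f true) ∈ m.cache then 0 else 1) +
    if ∃ a, m.cache.head? = some (a, f a) then 0 else 1

lemma pot_le (f : Bool → ℕ) (m : Mem U) : pot f m ≤ 3 := by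
  unfold pot; split_ifs <;> omega

lemma pot_congr_cache (f : Bool → ℕ) {m m' : Mem U} (h : m.cache = m'.cache) :
    pot f m = pot f m' := by
  unfold pot; rw [h]

/-- Accesses to the blocks that are being scanned do not raise the sum of cost and potential:
loading one of them is paid for by its term in the potential. The other one may be evicted only if
it was not used last, which is paid for by the third term, as there is room for two blocks. -/
lemma touch_pot (hf : 2 ≤ E.frames) (f : Bool → ℕ) (m : Mem U) {a : Bool} {p : ℕ}
    (hp : p / E.B = f a) : (touch E a p m).loads + pot f (touch E a p m) ≤ m.loads + pot f m := by
  have hhead := touch_head (a := a) (E := E) (by omega) p m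
  rw [hp] at hhead
  have h1 : ∃ b, (touch E a p m).cache.head? = some (b, f b) := ⟨a, hhead⟩
  by_cases hin : (a, p / E.B) ∈ m.cache
  · have h2 : ∀ x, x ∈ (touch E a p m).cache ↔ x ∈ m.cache := by
      intro x
      unfold touch
      rw [if_pos hin]
      exact (List.perm_cons_erase hin).symm.mem_iff
    have h3 : (touch E a p m).loads = m.loads := by unfold touch; rw [if_pos hin]
    unfold pot
    simp only [if_pos h1, h2, h3]
    omega
  · have h3 : (touch E a p m).loads = m.loads + 1 := by unfold touch; rw [if_neg hin]
    have ha : (a, f a) ∈ (touch E a p m).cache := List.mem_of_head? hhead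
    -- if the other block was used last, it is not evicted
    have hb : (∃ b, m.cache.head? = some (b, f b)) →
        (!a, f (!a)) ∈ m.cache ∧ (!a, f (!a)) ∈ (touch E a p m).cache := by
      rintro ⟨b, hb⟩
      have hba : b = !a := by
        by_contra hc
        have : b = a := by cases a <;> cases b <;> simp_all
        subst this
        exact hin (hp ▸ List.mem_of_head? hb)
      subst hba
      refine ⟨List.mem_of_head? hb, ?_⟩
      unfold touch
      rw [if_neg hin]
      obtain ⟨k, hk⟩ := Nat.exists_eq_add_of_le hf
      cases hc : m.cache with
      | nil => simp [hc] at hb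
      | cons x l =>
        rw [hc] at hb
        simp only [List.head?_cons, Option.some.injEq] at hb
        simp [hk, Nat.add_comm 2 k, hb]
    rw [hp] at hin
    unfold pot
    rw [if_pos h1, h3]
    cases a
    · rw [if_pos ha, if_neg hin]
      by_cases h4 : ∃ b, m.cache.head? = some (b, f b)
      · obtain ⟨h5, h6⟩ := hb h4
        simp only [Bool.not_false] at h5 h6
        rw [if_pos h5, if_pos h6]; omega
      · rw [if_neg h4]; split_ifs <;> omega
    · rw [if_pos ha, if_neg hin]
      by_cases h4 : ∃ b, m.cache.head? = some (b, f b)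
      · obtain ⟨h5, h6⟩ := hb h4
        simp only [Bool.not_true] at h5 h6
        rw [if_pos h5, if_pos h6]; omega
      · rw [if_neg h4]; split_ifs <;> omega

lemma write_pot (hf : 2 ≤ E.frames) (f : Bool → ℕ) (m : Mem U) {a : Bool} {p : ℕ}
    (hp : p / E.B = f a) (s : Slot U) :
    (write E a p s m).loads + pot f (write E a p s m) ≤ m.loads + pot f m := by
  rw [write_loads, pot_congr_cache f (write_cache p s m)]
  exact touch_pot hf f m hp

/-- Moving one of the two scans to another block raises the potential by at most two. -/
lemma pot_update_le (f : Bool → ℕ) (a : Bool) (i : ℕ) (m : Mem U) :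
    pot (Function.update f a i) m ≤ pot f m + 2 * (i - f a) + 2 * (f a - i) := by
  by_cases hi : i = f a
  · subst hi; simp
  · have h1 : 2 ≤ 2 * (i - f a) + 2 * (f a - i) := by omega
    refine le_trans ?_ (show pot f m + 2 ≤ _ by omega)
    unfold pot
    cases a <;> simp <;> split_ifs <;> omega

/-- The distance, in blocks, covered by a scan that goes round a table of `n` slots, up to position
`q`: in each round it goes through all blocks and back to the first one. -/
def trip (E : Env U) (n q : ℕ) : ℕ := (q / n) * (2 * ((n - 1) / E.B)) + q % n / E.B

lemma trip_le (hn : 0 < n) {q q' : ℕ} (h : q ≤ q') :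
    (q' % n / E.B - q % n / E.B) + (q % n / E.B - q' % n / E.B) + trip E n q ≤ trip E n q' := by
  have h1 : q % n / E.B ≤ (n - 1) / E.B :=
    Nat.div_le_div_right (by have := Nat.mod_lt q hn; omega)
  have h2 : q' % n / E.B ≤ (n - 1) / E.B :=
    Nat.div_le_div_right (by have := Nat.mod_lt q' hn; omega)
  unfold trip
  rcases (Nat.div_le_div_right (c := n) h).eq_or_lt with he | hlt
  · have h3 : q % n ≤ q' % n := by
      have e1 := Nat.div_add_mod q n
      have e2 := Nat.div_add_mod q' n
      rw [← he] at e2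
      omega
    have h4 := Nat.div_le_div_right (c := E.B) h3
    rw [he]
    omega
  · have h3 := Nat.mul_le_mul_right (2 * ((n - 1) / E.B)) hlt
    rw [Nat.succ_mul] at h3
    generalize q % n / E.B = x at *
    generalize q' % n / E.B = y at *
    generalize (n - 1) / E.B = z at *
    omega

/-- The cost of a sweep up to the state `L`, in which the scan of the old table has reached block
`i`, is at most `k`, plus a part that is charged to the scan of the new table (of `n'` slots), which
has reached position `q`. -/
def Charged (E : Env U) (wet a : Bool) (n' i k : ℕ) (L : Layout U) : Prop :=
  ∃ q, (wet = true → q ≤ L.next) ∧ (wet = false → q = 0) ∧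
    L.mem.loads + pot (Function.update (fun _ => q % n' / E.B) a i) L.mem ≤ k + 2 * trip E n' q

namespace Charged

variable {wet a : Bool} {n' i k : ℕ} {L : Layout U}

lemma put (hf : 2 ≤ E.frames) (hn' : 0 < n') (h : Charged E wet a n' i k L) (x : ℕ) (s : Slot U) :
    Charged E wet a n' i k (put E wet (!a) n' x s L) := by
  obtain ⟨q, h1, h2, h3⟩ := h
  cases wet
  · exact ⟨q, by simp, h2, by simpa [Graveyard.put] using h3⟩
  · have hq := h1 rfl
    refine ⟨max L.next x, fun _ => by simp [Graveyard.put], by simp, ?_⟩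
    simp only [Graveyard.put, if_true]
    refine (write_pot hf _ _ (by cases a <;> simp) s).trans ?_
    have h4 : Function.update (fun _ => max L.next x % n' / E.B) a i =
        Function.update (Function.update (fun _ => q % n' / E.B) a i) (!a)
          (max L.next x % n' / E.B) := by
      funext b; cases a <;> cases b <;> simp
    have h5 := pot_update_le (Function.update (fun _ => q % n' / E.B) a i) (!a)
      (max L.next x % n' / E.B) L.mem
    rw [← h4, Function.update_of_ne (by cases a <;> simp)] at h5
    have h6 := trip_le (E := E) hn' (hq.trans (le_max_left L.next x))
    omega

lemma putGraves (hf : 2 ≤ E.frames) (hn' : 0 < n') (h : Charged E wet a n' i k L)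
    (lim fuel : ℕ) :
    Charged E wet a n' i k (putGraves E wet (!a) n' lim fuel L) := by
  induction fuel generalizing L with
  | zero => exact h
  | succ fuel ih =>
    unfold Graveyard.putGraves
    dsimp only
    split_ifs
    · obtain ⟨q, h1, h2, h3⟩ := h.put hf hn' (2 * E.t * (L.graves + 1) - 1)
        (.grave (2 * E.t * (L.graves + 1) - 1))
      exact ih ⟨q, h1, h2, h3⟩
    · exact h

lemma move (h : Charged E wet a n' i k L) (j : ℕ) :
    Charged E wet a n' j (k + 2 * (j - i) + 2 * (i - j)) L := by
  obtain ⟨q, h1, h2, h3⟩ := h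
  refine ⟨q, h1, h2, ?_⟩
  have h4 := pot_update_le (Function.update (fun _ => q % n' / E.B) a i) a j L.mem
  rw [Function.update_self, Function.update_idem] at h4
  omega

lemma visit (hf : 2 ≤ E.frames) (hn' : 0 < n') (h : Charged E wet a n' i k L) (wrapped : Bool)
    (n p : ℕ) :
    Charged E wet a n' (p / E.B) (k + 2 * (p / E.B - i) + 2 * (i - p / E.B))
      (visit E wet a n n' wrapped L p) := by
  have h' : Charged E wet a n' (p / E.B) (k + 2 * (p / E.B - i) + 2 * (i - p / E.B))
      { L with mem := touch E a p L.mem } := by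
    obtain ⟨q, h1, h2, h3⟩ := h.move (p / E.B)
    exact ⟨q, h1, h2, (touch_pot hf _ _ (by simp)).trans h3⟩
  unfold Graveyard.visit
  dsimp only
  split
  · split_ifs
    · exact (h'.putGraves hf hn' _ _).put hf hn' _ _
    · exact h'
  · exact h'

lemma foldl_visit (hf : 2 ≤ E.frames) (hn' : 0 < n') (h : Charged E wet a n' 0 k L)
    (wrapped : Bool) (n N : ℕ) :
    Charged E wet a n' ((N - 1) / E.B) (k + 2 * ((N - 1) / E.B))
      ((List.range N).foldl (Graveyard.visit E wet a n n' wrapped) L) := by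
  induction N with
  | zero => simpa using h
  | succ N ih =>
    rw [List.range_succ, List.foldl_append]
    simp only [List.foldl_cons, List.foldl_nil]
    have h1 := ih.visit hf hn' wrapped n N
    have h2 : (N - 1) / E.B ≤ N / E.B := Nat.div_le_div_right (Nat.sub_le _ _)
    rw [show k + 2 * ((N - 1) / E.B) + 2 * (N / E.B - (N - 1) / E.B) +
      2 * ((N - 1) / E.B - N / E.B) = k + 2 * (N / E.B) by omega] at h1
    exact h1

/-- A sweep scans the old table twice, each time going back to the first block. -/
lemma sweep (hf : 2 ≤ E.frames) (hn' : 0 < n') (h : Charged E wet a n' 0 k L) (n : ℕ) :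
    Charged E wet a n' 0 (k + 8 * ((n - 1) / E.B)) (sweep E wet a n n' L) := by
  have h1 := ((h.foldl_visit hf hn' false n n).move 0).foldl_visit hf hn' true n n
  have h2 := (h1.move 0).putGraves hf hn' n' n'
  refine cast ?_ h2
  congr 1
  generalize (n - 1) / E.B = z
  omega

end Charged

/-- The cost of erasing the first `k` slots. -/
lemma erase_pot (hf : 2 ≤ E.frames) (f : Bool → ℕ) {a : Bool} (ha : f a = 0) (k : ℕ) (m : Mem U) :
    ((List.range k).foldl (fun m p => write E a p .free m) m).loads +
      pot (Function.update f a ((k - 1) / E.B))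
        ((List.range k).foldl (fun m p => write E a p .free m) m) ≤
      m.loads + pot f m + 2 * ((k - 1) / E.B) := by
  induction k with
  | zero => rw [show (0 - 1) / E.B = f a by simp [ha]]; simp
  | succ k ih =>
    rw [List.range_succ, List.foldl_append]
    simp only [List.foldl_cons, List.foldl_nil]
    have h1 := write_pot hf (Function.update f a (k / E.B))
      ((List.range k).foldl (fun m p => write E a p .free m) m) (a := a) (p := k) (by simp) .free
    have h2 := pot_update_le (Function.update f a ((k - 1) / E.B)) a (k / E.B)
      ((List.range k).foldl (fun m p => write E a p .free m) m)
    rw [Function.update_self, Function.update_idem] at h2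
    have h3 : (k - 1) / E.B ≤ k / E.B := Nat.div_le_div_right (Nat.sub_le _ _)
    simp only [Nat.add_sub_cancel]
    omega

/-- The cost of a rebuild, up to the potential of the first blocks of the two areas. In particular a
rebuild within these two blocks is free if they are in internal memory and one of
them was used last.

Moving a scan by one block costs at most `2`. The old table is scanned five times, forth and back,
namely twice by each sweep and once when it is erased, and the new one by at most two rounds and a
partial one, of cost at most `10` per block, before its scan returns to the first block. -/
lemma rebuild_cost (hf : 2 ≤ E.frames) (T : Table U)
    (hnext : (wetLayout E T).next ≤ 2 * E.size T.count) :
    (rebuild E T).mem.loads + pot 0 (rebuild E T).mem ≤ T.mem.loads + pot 0 T.mem +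
      20 * ((T.n - 1) / E.B) + 12 * ((E.size T.count - 1) / E.B) := by
  set n' := E.size T.count with hn'
  have hn'0 : 0 < n' := by have := size_pos (E := E) T.count; omega
  set α := (T.n - 1) / E.B with hα
  set β := (n' - 1) / E.B with hβ
  have h0 : Charged E false T.area n' 0 (T.mem.loads + pot 0 T.mem) ⟨T.mem, 0, 0⟩ := by
    refine ⟨0, by simp, by simp, ?_⟩
    have : Function.update (fun _ => 0 % n' / E.B) T.area 0 = 0 := by
      funext b; simp [Function.update]
    rw [this]
    exact Nat.le_add_right _ _
  have hdry : Charged E false T.area n' 0 _ (dryLayout E T) := h0.sweep hf hn'0 T.n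
  have h1 : Charged E true T.area n' 0 (T.mem.loads + pot 0 T.mem + 8 * α)
      ⟨(dryLayout E T).mem, (dryLayout E T).next - n', 0⟩ := by
    obtain ⟨q, -, h2, h3⟩ := hdry
    have hq := h2 rfl
    subst hq
    exact ⟨0, by simp, by simp, h3⟩
  have hwet : Charged E true T.area n' 0 (T.mem.loads + pot 0 T.mem + 8 * α + 8 * α)
      (wetLayout E T) := h1.sweep hf hn'0 T.n
  obtain ⟨q, h2, -, h3⟩ := hwet
  have hq := (h2 rfl).trans hnext
  have htrip : trip E n' q ≤ 5 * β := by
    have h4 : q / n' ≤ 2 := by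
      have := Nat.div_le_div_right (c := n') hq
      rwa [Nat.mul_div_cancel _ hn'0] at this
    have h5 : q % n' / E.B ≤ β := Nat.div_le_div_right (by have := Nat.mod_lt q hn'0; omega)
    have h6 := Nat.mul_le_mul_right (2 * β) h4
    change q / n' * (2 * β) + q % n' / E.B ≤ 5 * β
    generalize q % n' / E.B = x at *
    omega
  have hβ' : q % n' / E.B ≤ β := Nat.div_le_div_right (by have := Nat.mod_lt q hn'0; omega)
  -- the scan of the new table returns to the first block
  have h7 := pot_update_le (Function.update (fun _ => q % n' / E.B) T.area 0) (!T.area) 0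
    (wetLayout E T).mem
  have h8 : Function.update (Function.update (fun _ => q % n' / E.B) T.area 0) (!T.area) 0 =
      (0 : Bool → ℕ) := by
    funext b; cases hA : T.area <;> cases b <;> simp
  rw [h8, Function.update_of_ne (by simp)] at h7
  have h9 := erase_pot hf 0 (a := T.area) rfl T.n (wetLayout E T).mem
  have h10 := pot_update_le (Function.update 0 T.area ((T.n - 1) / E.B)) T.area 0
    ((List.range T.n).foldl (fun m p => write E T.area p .free m) (wetLayout E T).mem)
  have h11 : Function.update (Function.update (0 : Bool → ℕ) T.area ((T.n - 1) / E.B)) T.area 0 =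
      0 := by
    rw [Function.update_idem]; exact Function.update_eq_self T.area (0 : Bool → ℕ)
  rw [h11, Function.update_self] at h10
  change ((List.range T.n).foldl (fun m p => write E T.area p .free m) (wetLayout E T).mem).loads +
    pot 0 ((List.range T.n).foldl (fun m p => write E T.area p .free m) (wetLayout E T).mem) ≤
    T.mem.loads + pot 0 T.mem + 20 * α + 12 * β
  change _ ≤ _ + 2 * α at h9
  change _ ≤ _ + 2 * (0 - α) + 2 * (α - 0) at h10
  generalize q % n' / E.B = x at *
  clear_value α β
  omega

lemma loads_le_put (wet a : Bool) (n h : ℕ) (s : Slot U) (L : Layout U) :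
    L.mem.loads ≤ (put E wet a n h s L).mem.loads := by
  cases wet
  · exact le_rfl
  · exact le_touch_loads _ _

lemma loads_le_putGraves (wet a : Bool) (n lim fuel : ℕ) (L : Layout U) :
    L.mem.loads ≤ (putGraves E wet a n lim fuel L).mem.loads := by
  induction fuel generalizing L with
  | zero => exact le_rfl
  | succ fuel ih =>
    unfold putGraves
    dsimp only
    split_ifs
    · refine le_trans ?_ (ih _)
      exact loads_le_put wet a n _ _ L
    · exact le_rfl

lemma loads_le_foldl {α β : Type*} (loads : β → ℕ) (f : β → α → β)
    (h : ∀ b x, loads b ≤ loads (f b x)) (l : List α) (b : β) : loads b ≤ loads (l.foldl f b) := by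
  induction l generalizing b with
  | nil => exact le_rfl
  | cons x l ih => exact (h b x).trans (ih _)

lemma loads_le_sweep (wet a : Bool) (n n' : ℕ) (L : Layout U) :
    L.mem.loads ≤ (sweep E wet a n n' L).mem.loads := by
  have h1 : ∀ wrapped (L : Layout U) p, L.mem.loads ≤
      (visit E wet a n n' wrapped L p).mem.loads := by
    intro wrapped L p
    have h2 := le_touch_loads (E := E) (a := a) p L.mem
    unfold visit
    dsimp only
    split
    · split_ifs
      · exact h2.trans
          ((loads_le_putGraves wet (!a) n' _ n' { L with mem := touch E a p L.mem }).trans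
            (loads_le_put _ _ _ _ _ _))
      · exact h2
    · exact h2
  exact (loads_le_foldl (fun L : Layout U => L.mem.loads) _ (h1 false) _ L).trans
    ((loads_le_foldl (fun L : Layout U => L.mem.loads) _ (h1 true) _ _).trans
      (loads_le_putGraves _ _ _ _ _ _))

lemma loads_le_rebuild (T : Table U) : T.mem.loads ≤ (rebuild E T).mem.loads := by
  have h1 : T.mem.loads ≤ (dryLayout E T).mem.loads :=
    loads_le_sweep false T.area T.n (E.size T.count) ⟨T.mem, 0, 0⟩
  have h2 : (dryLayout E T).mem.loads ≤ (wetLayout E T).mem.loads :=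
    loads_le_sweep true T.area T.n (E.size T.count)
      ⟨(dryLayout E T).mem, (dryLayout E T).next - E.size T.count, 0⟩
  exact (h1.trans h2).trans (loads_le_foldl Mem.loads (fun m p => write E T.area p .free m)
    (fun m p => le_touch_loads p m) (List.range T.n) (wetLayout E T).mem)

/-- The potential kept between operations: that of the first blocks of the two areas, as long as the
table lies within its first block. -/
noncomputable def Table.pot (E : Env U) (T : Table U) : ℕ :=
  if T.n ≤ E.B then Graveyard.pot 0 T.mem else 0

/-- Operations within the first block do not raise the potential. -/
lemma perform_pot (hf : 2 ≤ E.frames) {T : Table U} (hn : 0 < T.n)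
    (hlt : ∀ p, T.mem.cell T.area p ≠ .free → p < T.n) (op : Op U) :
    (perform E T op).1.pot E ≤ T.pot E ∧ T.mem.loads ≤ (perform E T op).1.mem.loads := by
  have gen : ∀ Φ : Mem U → ℕ, (∀ m p, p < T.n → Φ (touch E T.area p m) ≤ Φ m) →
      (∀ m p s, p < T.n → Φ (write E T.area p s m) ≤ Φ m) →
      Φ (perform E T op).1.mem ≤ Φ T.mem := by
    intro Φ h1 h2
    cases op with
    | query u => exact find_mono hn h1 u _ _ _
    | insert u => exact insertFrom_mono hn h1 h2 u _ _ _
    | delete u =>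
      have h3 := find_mono hn h1 u T.n 0 T.mem
      unfold perform
      dsimp only
      split
      · exact h3
      · rename_i p hp
        exact (h2 _ p _ (hlt p (by rw [find_some hp]; simp))).trans h3
  have hloads : T.mem.loads ≤ (perform E T op).1.mem.loads := by
    have h1 := gen (fun m => if T.mem.loads ≤ m.loads then 0 else 1)
      (fun m p _ => by
        have := le_touch_loads (E := E) (a := T.area) p m
        split_ifs <;> omega)
      (fun m p s _ => by
        have := le_touch_loads (E := E) (a := T.area) p m
        rw [write_loads]; split_ifs <;> omega)
    simp only [le_refl, if_true] at h1
    by_contra hc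
    rw [if_neg hc] at h1
    omega
  refine ⟨?_, hloads⟩
  have hn' : (perform E T op).1.n = T.n := by
    cases op with
    | query u => rfl
    | insert u => rfl
    | delete u => unfold perform; dsimp only; split <;> rfl
  unfold Table.pot
  rw [hn']
  split_ifs with hB
  · have hzero : ∀ p, p < T.n → p / E.B = (0 : Bool → ℕ) T.area := fun p hp =>
      Nat.div_eq_of_lt (by omega)
    have h1 := gen (fun m => m.loads + Graveyard.pot 0 m)
      (fun m p hp => touch_pot hf 0 m (hzero p hp))
      (fun m p s hp => write_pot hf 0 m (hzero p hp) s)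
    omega
  · exact le_rfl

/-- Amortization of the cost of a rebuild over the preceding `E.window T.n` operations. Only a table
larger than a block pays for its potential, which is why no additive constant remains. The old table
has at most `8 * E.t * E.window T.n` slots, the new one at most three times as many, and
`472 = 8 * (20 + 3 + 3 * 12)`. -/
lemma Inv.rebuild_amortized {K : Set U} (hG : Generic E K) (hf : 2 ≤ E.frames) (ht : 2 ≤ E.t)
    {T : Table U} {X X₀ Y : Finset U} (h : Inv E T X X₀ Y) (hY : ↑Y ⊆ K) (hB : 0 < E.B) :
    ((rebuild E T).mem.loads - T.mem.loads + (rebuild E T).pot E) * E.B ≤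
      T.pot E * E.B + 472 * (E.t * E.window T.n) := by
  obtain ⟨-, hnext⟩ := rebuild_spec hG ht h hY
  have hcost := rebuild_cost hf T hnext
  have hn := h.pos
  have hcard : X.card < T.n := by
    have h1 := Finset.card_le_card h.sub_seen
    have h2 := seen_add_graves_lt ht h.size (y := Y.card) (by have := h.seen; omega)
    exact h1.trans_lt ((Nat.le_add_right _ _).trans_lt h2)
  have hn3 : 3 ≤ T.n := by rw [h.size]; exact size_pos _
  have hsize : E.size T.count ≤ 3 * T.n := by
    rw [h.count]
    have := Nat.div_le_self X.card (E.t - 1)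
    unfold Env.size
    omega
  have hwin : T.n ≤ 8 * (E.t * E.window T.n) := by
    have h1 := Nat.lt_mul_div_succ T.n (show 0 < 4 * E.t by omega)
    have h2 : T.n / (4 * E.t) + 1 ≤ 2 * E.window T.n := by unfold Env.window; omega
    calc T.n ≤ 4 * E.t * (T.n / (4 * E.t) + 1) := h1.le
      _ ≤ 4 * E.t * (2 * E.window T.n) := Nat.mul_le_mul_left _ h2
      _ = 8 * (E.t * E.window T.n) := by ring
  have hn' : (rebuild E T).n = E.size T.count := rfl
  have hα := Nat.div_mul_le_self (T.n - 1) E.B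
  have hβ := Nat.div_mul_le_self (E.size T.count - 1) E.B
  have hle := pot_le 0 T.mem
  have h1 : (rebuild E T).pot E ≤ Graveyard.pot 0 (rebuild E T).mem := by
    unfold Table.pot; split_ifs <;> omega
  have h2 : Graveyard.pot 0 T.mem ≤ T.pot E + 3 * ((T.n - 1) / E.B) := by
    unfold Table.pot
    split_ifs with hB'
    · exact Nat.le_add_right _ _
    · have : 1 ≤ (T.n - 1) / E.B := (Nat.one_le_div_iff hB).2 (by omega)
      omega
  have hmono := loads_le_rebuild (E := E) T
  have h3 : (rebuild E T).mem.loads - T.mem.loads + (rebuild E T).pot E ≤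
      T.pot E + 23 * ((T.n - 1) / E.B) + 12 * ((E.size T.count - 1) / E.B) := by
    generalize (T.n - 1) / E.B = x at *
    generalize (E.size T.count - 1) / E.B = y at *
    omega
  refine (Nat.mul_le_mul_right _ h3).trans ?_
  rw [add_mul, add_mul, mul_assoc, mul_assoc]
  omega

end

/-! ### Backlogs of independent uniform hashes -/

section Backlog

variable {ι : Type*} {n : ℕ} [NeZero n]

/-- Number of items of `A` hashing to the `j` slots that end at slot `e`. -/
def arcCount (A : Finset ι) (f : ι → ZMod n) (e : ZMod n) (j : ℕ) : ℕ :=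
  (A.filter fun v => (e - f v).val < j).card

/-- The backlog at slot `e`: the largest excess of the number of items hashing to an interval that
ends at `e` over `σ` times the length of the interval. -/
noncomputable def backlog (A : Finset ι) (σ : ℝ) (f : ι → ZMod n) (e : ZMod n) : ℝ :=
  (Finset.range n).sup' ⟨0, Finset.mem_range.2 (NeZero.pos n)⟩ fun j => arcCount A f e j - σ * j

lemma backlog_nonneg (A : Finset ι) (σ : ℝ) (f : ι → ZMod n) (e : ZMod n) :
    0 ≤ backlog A σ f e := by
  refine le_trans ?_ (Finset.le_sup' _ (Finset.mem_range.2 (NeZero.pos n)))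
  simp

/-- The interval may be the whole table, too, as long as the load is at most `σ`. -/
lemma le_backlog (A : Finset ι) {σ : ℝ} (hA : (A.card : ℝ) ≤ σ * n) (f : ι → ZMod n) (e : ZMod n)
    {j : ℕ} (hj : j ≤ n) : arcCount A f e j - σ * j ≤ backlog A σ f e := by
  rcases hj.lt_or_eq with hj | rfl
  · exact Finset.le_sup' (fun j : ℕ => (arcCount A f e j : ℝ) - σ * j) (Finset.mem_range.2 hj)
  · refine le_trans ?_ (backlog_nonneg A σ f e)
    have : (arcCount A f e j : ℝ) ≤ A.card := by
      exact_mod_cast Finset.card_filter_le _ _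
    linarith

lemma backlog_add_const (A : Finset ι) (σ : ℝ) (f : ι → ZMod n) (e c : ZMod n) :
    backlog A σ (fun v => f v + c) (e + c) = backlog A σ f e := by
  unfold backlog arcCount
  simp only [add_sub_add_right_eq_sub]

/-- Lindley's recursion: the backlog grows by the number of items hashing to the new slot and falls
by `σ`, but not below zero. -/
lemma backlog_succ_le [DecidableEq ι] (A : Finset ι) (σ : ℝ) (f : ι → ZMod n) (e : ZMod n) :
    backlog A σ f (e + 1) ≤
      max 0 (backlog A σ f e + (A.filter fun v => f v = e + 1).card - σ) := by
  refine Finset.sup'_le _ _ fun j hj => ?_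
  rw [Finset.mem_range] at hj
  rcases j with _ | j
  · refine le_trans ?_ (le_max_left _ _)
    simp [arcCount]
  · refine le_trans ?_ (le_max_right _ _)
    have h1 : arcCount A f (e + 1) (j + 1) ≤
        arcCount A f e j + (A.filter fun v => f v = e + 1).card := by
      unfold arcCount
      refine (Finset.card_le_card ?_).trans (Finset.card_union_le _ _)
      intro v hv
      rw [Finset.mem_filter] at hv
      rw [Finset.mem_union, Finset.mem_filter, Finset.mem_filter]
      by_cases h : f v = e + 1
      · exact Or.inr ⟨hv.1, h⟩
      · refine Or.inl ⟨hv.1, ?_⟩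
        have h2 : (e - f v).val + 1 ≤ (e + 1 - f v).val := by
          have h3 : e + 1 - f v ≠ 0 := fun h0 => h (sub_eq_zero.1 h0).symm
          have h4 : e - f v = (e + 1 - f v) - 1 := by ring
          have h5 : 0 < (e + 1 - f v).val := by
            rw [Nat.pos_iff_ne_zero, Ne, ZMod.val_eq_zero]; exact h3
          have h6 : ((e + 1 - f v) - 1).val = (e + 1 - f v).val - 1 := by
            have h7 : ((e + 1 - f v) - 1 : ZMod n) = (((e + 1 - f v).val - 1 : ℕ) : ZMod n) := by
              rw [Nat.cast_sub h5, ZMod.natCast_zmod_val]; simp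
            rw [h7, ZMod.val_natCast, Nat.mod_eq_of_lt]
            have := ZMod.val_lt (e + 1 - f v)
            omega
          rw [h4, h6]; omega
        have := hv.2
        omega
    have h2 : (arcCount A f e j : ℝ) - σ * j ≤ backlog A σ f e :=
      Finset.le_sup' (fun j : ℕ => (arcCount A f e j : ℝ) - σ * j)
        (Finset.mem_range.2 (by omega))
    have h3 : (arcCount A f (e + 1) (j + 1) : ℝ) ≤
        arcCount A f e j + (A.filter fun v => f v = e + 1).card := by exact_mod_cast h1
    push_cast
    linarith

/-- An item hashing to the slot after `e` does not contribute to the backlog at `e`. -/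
lemma backlog_le_update [DecidableEq ι] (A : Finset ι) (σ : ℝ) (f : ι → ZMod n) {e : ZMod n}
    {v : ι} (hv : f v = e + 1) (x : ZMod n) :
    backlog A σ f e ≤ backlog A σ (Function.update f v x) e := by
  refine Finset.sup'_mono_fun fun j hj => ?_
  rw [Finset.mem_range] at hj
  have : arcCount A f e j ≤ arcCount A (Function.update f v x) e j := by
    refine Finset.card_le_card fun w hw => ?_
    rw [Finset.mem_filter] at hw ⊢
    refine ⟨hw.1, ?_⟩
    by_cases h : w = v
    · subst h
      have h1 := hw.2
      rw [hv, show e - (e + 1) = -1 by ring] at h1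
      obtain ⟨k, rfl⟩ := Nat.exists_eq_succ_of_ne_zero (NeZero.ne n)
      rw [ZMod.val_neg_one] at h1
      omega
    · rw [Function.update_of_ne h]; exact hw.2
  have : (arcCount A f e j : ℝ) ≤ arcCount A (Function.update f v x) e j := by exact_mod_cast this
  linarith

variable [Fintype ι] [DecidableEq ι]

/-- Averaging over the hash of `v`. -/
lemma card_mul_sum_le (v : ι) (c : ZMod n) {G G' : (ι → ZMod n) → ℝ}
    (h : ∀ f, f v = c → ∀ x, G f ≤ G' (Function.update f v x)) :
    n * ∑ f with f v = c, G f ≤ ∑ f, G' f := by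
  have h1 : ∑ p ∈ (Finset.univ.filter fun f : ι → ZMod n => f v = c) ×ˢ
      (Finset.univ : Finset (ZMod n)), G' (Function.update p.1 v p.2) = ∑ f, G' f := by
    refine Finset.sum_bij' (fun p _ => Function.update p.1 v p.2)
      (fun f _ => (Function.update f v c, f v)) ?_ ?_ ?_ ?_ ?_
    · intros; simp
    · intros; simp
    · rintro ⟨f, x⟩ hf
      simp only [Finset.mem_product, Finset.mem_filter, Finset.mem_univ, true_and, and_true] at hf
      simp [← hf]
    · intros; simp
    · intros; rfl
  rw [← h1, Finset.sum_product, Finset.mul_sum]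
  refine Finset.sum_le_sum fun f hf => ?_
  rw [Finset.mem_filter] at hf
  calc (n : ℝ) * G f = ∑ _x : ZMod n, G f := by simp [ZMod.card]
    _ ≤ _ := Finset.sum_le_sum fun x _ => h f hf.2 x

/-- A function `G` of the hashes is multiplied by the number of items hashing to `c`. If rehashing
such an item turns `G` into at most `G'`, independence gives a bound by the expectation of `G'`
times the load. -/
lemma sum_mul_card_le (A : Finset ι) (c : ZMod n) {G G' : (ι → ZMod n) → ℝ}
    (h : ∀ v ∈ A, ∀ f, f v = c → ∀ x, G f ≤ G' (Function.update f v x)) :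
    ∑ f, G f * (A.filter fun v => f v = c).card ≤ A.card / n * ∑ f, G' f := by
  have hn : (0 : ℝ) < n := by exact_mod_cast NeZero.pos n
  have h1 : ∑ f, G f * (A.filter fun v => f v = c).card = ∑ v ∈ A, ∑ f with f v = c, G f := by
    simp only [Finset.card_filter, Nat.cast_sum, Finset.mul_sum, Finset.sum_filter]
    rw [Finset.sum_comm]
    refine Finset.sum_congr rfl fun v _ => Finset.sum_congr rfl fun f _ => ?_
    split_ifs <;> simp
  have h2 : ∀ v ∈ A, ∑ f with f v = c, G f ≤ (∑ f, G' f) / n := fun v hv => by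
    rw [le_div_iff₀ hn, mul_comm]
    exact card_mul_sum_le v c (h v hv)
  rw [h1]
  refine (Finset.sum_le_sum h2).trans (le_of_eq ?_)
  rw [Finset.sum_const, nsmul_eq_mul]
  ring

/-- The expected backlog, from Lindley's recursion and the fact that the second moment of the
backlog is the same at all slots: squaring the recursion and taking expectations, the second moments
cancel, and the linear term remains. -/
lemma sum_backlog_le (A : Finset ι) (σ : ℝ) (hσ : 0 ≤ σ) (e : ZMod n) :
    2 * (σ - A.card / n) * ∑ f, backlog A σ f e ≤
      (A.card / n + (A.card / n) ^ 2 + σ ^ 2) * ∑ _f : ι → ZMod n, (1 : ℝ) := by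
  set ρ : ℝ := A.card / n with hρ
  have hρ0 : 0 ≤ ρ := by positivity
  set N : ℝ := ∑ _f : ι → ZMod n, (1 : ℝ) with hN
  set a : (ι → ZMod n) → ℝ := fun f => (A.filter fun v => f v = e + 1).card with ha
  set Q : (ι → ZMod n) → ℝ := fun f => backlog A σ f e with hQ
  have hrot : ∑ f, backlog A σ f (e + 1) ^ 2 = ∑ f, Q f ^ 2 := by
    rw [← Equiv.sum_comp (Equiv.addRight (fun _ : ι => (1 : ZMod n)))]
    refine Finset.sum_congr rfl fun f _ => ?_
    rw [hQ]
    simp only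
    rw [← backlog_add_const A σ f e 1]
    rfl
  have hsq : ∀ f, backlog A σ f (e + 1) ^ 2 ≤ (Q f + a f - σ) ^ 2 := fun f => by
    have h1 := backlog_succ_le A σ f e
    have h2 := backlog_nonneg A σ f (e + 1)
    rcases le_total 0 (Q f + a f - σ) with h3 | h3
    · rw [max_eq_right h3] at h1
      exact pow_le_pow_left₀ h2 h1 2
    · rw [max_eq_left h3] at h1
      rw [le_antisymm h1 h2, zero_pow two_ne_zero]
      exact sq_nonneg _
  have h1 : ∑ f, a f ≤ ρ * N := by
    have := sum_mul_card_le A (e + 1) (G := fun _ => 1) (G' := fun _ => 1) (by simp)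
    simpa only [one_mul] using this
  have h2 : ∑ f, a f * a f ≤ ρ * (N + ρ * N) := by
    refine (sum_mul_card_le A (e + 1) (G := a) (G' := fun f => 1 + a f) ?_).trans ?_
    · intro v hv f hf x
      have : (A.filter fun w => f w = e + 1) ⊆
          insert v (A.filter fun w => Function.update f v x w = e + 1) := by
        intro w hw
        rw [Finset.mem_filter] at hw
        rw [Finset.mem_insert, Finset.mem_filter]
        by_cases h : w = v
        · exact Or.inl h
        · rw [Function.update_of_ne h]; exact Or.inr hw
      have := (Finset.card_le_card this).trans (Finset.card_insert_le _ _)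
      simp only [ha]
      have h3 : ((A.filter fun w => f w = e + 1).card : ℝ) ≤
        (A.filter fun w => Function.update f v x w = e + 1).card + 1 := by exact_mod_cast this
      linarith
    · rw [Finset.sum_add_distrib]
      exact mul_le_mul_of_nonneg_left (by linarith) hρ0
  have h3 : ∑ f, Q f * a f ≤ ρ * ∑ f, Q f :=
    sum_mul_card_le A (e + 1) fun v _ f hf x => backlog_le_update A σ f hf x
  have h4 : ∑ f, Q f ^ 2 ≤ ∑ f, (Q f + a f - σ) ^ 2 := by
    rw [← hrot]; exact Finset.sum_le_sum fun f _ => hsq f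
  have h5 : ∑ f, (Q f + a f - σ) ^ 2 = ∑ f, Q f ^ 2 + 2 * ∑ f, Q f * a f + ∑ f, a f * a f -
      2 * σ * ∑ f, Q f - 2 * σ * ∑ f, a f + σ ^ 2 * N := by
    rw [hN]
    simp only [Finset.mul_sum, ← Finset.sum_add_distrib, ← Finset.sum_sub_distrib]
    exact Finset.sum_congr rfl fun f _ => by ring
  have h6 : 0 ≤ ∑ f, a f := Finset.sum_nonneg fun f _ => Nat.cast_nonneg _
  nlinarith [mul_nonneg hσ h6]

/-- The distribution of the backlog is the same at all slots. -/
lemma sum_backlog_ge_eq (A : Finset ι) (σ θ : ℝ) (e : ZMod n) :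
    ∑ f : ι → ZMod n, (if θ ≤ backlog A σ f e then (1 : ℝ) else 0) =
      ∑ f : ι → ZMod n, (if θ ≤ backlog A σ f 0 then (1 : ℝ) else 0) := by
  rw [← Equiv.sum_comp (Equiv.addRight (fun _ : ι => e))]
  refine Finset.sum_congr rfl fun f _ => ?_
  rw [← backlog_add_const A σ f 0 e, zero_add]
  rfl

/-- Layer-cake bound for the sum of the probabilities that the backlog reaches `d / s - c`. -/
lemma sum_range_backlog_ge_le (A : Finset ι) (σ : ℝ) {s c : ℝ} (hs : 0 < s) (hc : 0 ≤ c) (k : ℕ) :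
    ∑ d ∈ Finset.range k, ∑ f : ι → ZMod n,
        (if (d : ℝ) / s - c ≤ backlog A σ f 0 then (1 : ℝ) else 0) ≤
      s * ∑ f : ι → ZMod n, backlog A σ f 0 + (s * c + 1) * ∑ _f : ι → ZMod n, (1 : ℝ) := by
  rw [Finset.sum_comm, Finset.mul_sum, Finset.mul_sum, ← Finset.sum_add_distrib]
  refine Finset.sum_le_sum fun f _ => ?_
  have hQ := backlog_nonneg A σ f 0
  rw [← Finset.sum_filter, Finset.sum_const, nsmul_eq_mul, mul_one, mul_one]
  have h1 : ((Finset.range k).filter fun d : ℕ => (d : ℝ) / s - c ≤ backlog A σ f 0) ⊆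
      Finset.range (⌊s * (backlog A σ f 0 + c)⌋₊ + 1) := by
    intro d hd
    rw [Finset.mem_filter] at hd
    rw [Finset.mem_range, Nat.lt_succ_iff]
    refine Nat.le_floor ?_
    have h2 : (d : ℝ) / s ≤ backlog A σ f 0 + c := by linarith [hd.2]
    rw [div_le_iff₀ hs] at h2
    linarith
  have h2 := Finset.card_le_card h1
  rw [Finset.card_range] at h2
  have h3 : ((⌊s * (backlog A σ f 0 + c)⌋₊ : ℕ) : ℝ) ≤ s * (backlog A σ f 0 + c) :=
    Nat.floor_le (by positivity)
  have h4 : (((Finset.range k).filter fun d : ℕ => (d : ℝ) / s - c ≤ backlog A σ f 0).card : ℝ) ≤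
      ⌊s * (backlog A σ f 0 + c)⌋₊ + 1 := by exact_mod_cast h2
  linarith

end Backlog

section

variable {U : Type*} {E : Env U} {n : ℕ}

/-! ### Block boundaries -/

lemma edge_mod (n p : ℕ) : edge E n (p % n) = edge E n p := by
  unfold edge
  rw [Nat.mod_mod, Nat.mod_add_mod]

/-- Going round the table crosses each block boundary once, and finally returns to the first
block. -/
lemma sum_edge_le {n : ℕ} (hn : 0 < n) :
    (∑ p ∈ Finset.range n, edge E n p) * E.B ≤ 2 * n := by
  obtain ⟨k, rfl⟩ := Nat.exists_eq_succ_of_ne_zero hn.ne'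
  have h1 : ∀ j ≤ k, ∑ p ∈ Finset.range j, edge E (k + 1) p ≤ j / E.B := by
    intro j
    induction j with
    | zero => simp
    | succ j ih =>
      intro hj
      rw [Finset.sum_range_succ]
      have h2 := ih (by omega)
      have h3 : j / E.B ≤ (j + 1) / E.B := Nat.div_le_div_right (by omega)
      unfold edge at h2 ⊢
      rw [Nat.mod_eq_of_lt (show j < k + 1 by omega),
        Nat.mod_eq_of_lt (show j + 1 < k + 1 by omega)]
      split_ifs with h4 <;> omega
  rw [Nat.succ_eq_add_one, Finset.sum_range_succ]
  have h2 := h1 k le_rfl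
  have h3 : edge E (k + 1) k ≤ k / E.B := by
    unfold edge
    rw [Nat.mod_self, Nat.mod_eq_of_lt (Nat.lt_succ_self k), Nat.zero_div]
    split_ifs with h4
    · exact Nat.zero_le _
    · exact Nat.pos_of_ne_zero h4
  have h4 := Nat.div_mul_le_self k E.B
  calc _ ≤ (2 * (k / E.B)) * E.B := Nat.mul_le_mul_right _ (by omega)
    _ ≤ 2 * (k + 1) := by rw [mul_assoc]; omega

/-- The step from distance `d` to the next one crosses a block boundary for equally many hashes,
whatever `d` is. -/
lemma sum_edge_zmod (n : ℕ) [NeZero n] (d : ℕ) :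
    ∑ x : ZMod n, edge E n (x.val + d) = ∑ p ∈ Finset.range n, edge E n p := by
  rw [← Equiv.sum_comp (Equiv.subRight (d : ZMod n))]
  have h1 : ∀ x : ZMod n, edge E n ((Equiv.subRight (d : ZMod n) x).val + d) = edge E n x.val := by
    intro x
    rw [← edge_mod n ((Equiv.subRight (d : ZMod n) x).val + d)]
    congr 1
    have : (((Equiv.subRight (d : ZMod n) x).val + d : ℕ) : ZMod n) = x := by
      push_cast
      rw [ZMod.natCast_zmod_val]
      simp
    rw [← ZMod.val_natCast, this]
  rw [Finset.sum_congr rfl fun x _ => h1 x]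
  refine Finset.sum_bij' (fun x _ => x.val) (fun p _ => (p : ZMod n)) ?_ ?_ ?_ ?_ ?_
  · intro x _; exact Finset.mem_range.2 (ZMod.val_lt x)
  · intros; simp
  · intro x _; exact ZMod.natCast_zmod_val x
  · intro p hp; rw [ZMod.val_natCast, Nat.mod_eq_of_lt (Finset.mem_range.1 hp)]
  · intros; rfl

/-! ### The expected number of block boundaries passed by an operation -/

section PassCost

variable {ι : Type*} [NeZero n]

/-- Bound on the number of block boundaries passed by an operation on a key of hash `x`. The items
of `A` have the hashes `g`; those of `A'` are the ones not present after the last rebuild. The three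
indicators correspond to the three cases of `Inv.long_operation` for an operation that passes
`d + 1` slots. The first backlog is relative to the part of the slots left over by the artificial
tombstones, the second one to a rate between the load of new keys and that of artificial
tombstones. -/
noncomputable def passCost (E : Env U) (A A' : Finset ι) (x : ZMod n) (g : ι → ZMod n) : ℝ :=
  ∑ d ∈ Finset.range n, (edge E n (x.val + d) : ℝ) *
    ((if (d : ℝ) / 2 - 3 ≤ backlog A (1 - 1 / (2 * E.t)) g (x + ((d + 1) / 2 : ℕ)) then 1 else 0) +
      (if (d : ℝ) / (16 * E.t) - 4 ≤ backlog A' (3 / (8 * E.t)) g (x + ((d + 1) / 2 : ℕ)) then 1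
        else 0) +
      if n < 2 * E.t then 1 else 0)

lemma passCost_nonneg (A A' : Finset ι) (x : ZMod n) (g : ι → ZMod n) :
    0 ≤ passCost E A A' x g := by
  refine Finset.sum_nonneg fun d _ => mul_nonneg (Nat.cast_nonneg _) ?_
  split_ifs <;> norm_num

/-- The expected number of block boundaries passed. The block boundaries depend on `x` only, and the
distribution of a backlog is the same at all slots, so that the expectations of both may be
multiplied. The expected backlogs are at most `6 * t` and `2`, and the sum over the distances is at
most `(12 * t + 7) + (96 * t + 1) + 2 * t ≤ 114 * t`. -/
lemma sum_passCost_le [Fintype ι] [DecidableEq ι] (ht : 2 ≤ E.t) (hB : 0 < E.B) {A A' : Finset ι}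
    (hA : (A.card : ℝ) ≤ (1 - 3 / (4 * E.t)) * n) (hA' : (A'.card : ℝ) ≤ 1 / (4 * E.t) * n) :
    ∑ x : ZMod n, ∑ g : ι → ZMod n, passCost E A A' x g ≤
      228 * E.t / E.B * (n * ∑ _g : ι → ZMod n, (1 : ℝ)) := by
  have hn : (0 : ℝ) < n := by exact_mod_cast NeZero.pos n
  have hB' : (0 : ℝ) < E.B := by exact_mod_cast hB
  have ht' : (2 : ℝ) ≤ E.t := by exact_mod_cast ht
  have ht0 : (0 : ℝ) < E.t := by linarith
  set t : ℝ := (E.t : ℝ) with htdef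
  set N : ℝ := ∑ _g : ι → ZMod n, (1 : ℝ) with hN
  have hN0 : 0 ≤ N := Finset.sum_nonneg fun _ _ => zero_le_one
  set σ : ℝ := 1 - 1 / (2 * t) with hσ
  set σ' : ℝ := 3 / (8 * t) with hσ'
  have hinv : 1 / t ≤ 1 / 2 := one_div_le_one_div_of_le (by norm_num) ht'
  have hinv0 : 0 < 1 / t := by positivity
  have e1 : σ = 1 - 1 / t / 2 := by rw [hσ]; field_simp
  have e2 : σ' = 3 * (1 / t) / 8 := by rw [hσ']; field_simp
  -- the expected backlogs
  have hQ : ∑ g : ι → ZMod n, backlog A σ g 0 ≤ 6 * t * N := by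
    have h1 := sum_backlog_le A σ (by rw [e1]; linarith) (0 : ZMod n)
    set ρ : ℝ := A.card / n with hρ
    have h2 : ρ ≤ 1 - 3 / 4 * (1 / t) := by
      rw [hρ, div_le_iff₀ hn]
      refine hA.trans (le_of_eq ?_)
      field_simp
    have h3 : 0 ≤ ρ := by positivity
    have h4 : 1 / t / 2 ≤ 2 * (σ - ρ) := by rw [e1]; linarith
    have h5 : 0 ≤ ∑ g : ι → ZMod n, backlog A σ g 0 :=
      Finset.sum_nonneg fun g _ => backlog_nonneg A σ g 0
    have h6 : ρ + ρ ^ 2 + σ ^ 2 ≤ 3 := by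
      have : σ ≤ 1 := by rw [e1]; linarith
      have : 0 ≤ σ := by rw [e1]; linarith
      nlinarith
    have h7 : 1 / t / 2 * ∑ g : ι → ZMod n, backlog A σ g 0 ≤ 3 * N :=
      (mul_le_mul_of_nonneg_right h4 h5).trans (h1.trans (mul_le_mul_of_nonneg_right h6 hN0))
    have h8 : 1 / t / 2 * ∑ g : ι → ZMod n, backlog A σ g 0 =
      (∑ g : ι → ZMod n, backlog A σ g 0) / (2 * t) := by field_simp
    rw [h8, div_le_iff₀ (by positivity)] at h7
    linarith
  have hR : ∑ g : ι → ZMod n, backlog A' σ' g 0 ≤ 2 * N := by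
    have h1 := sum_backlog_le A' σ' (by positivity) (0 : ZMod n)
    set ρ : ℝ := A'.card / n with hρ
    have h2 : ρ ≤ 1 / 4 * (1 / t) := by
      rw [hρ, div_le_iff₀ hn]
      refine hA'.trans (le_of_eq ?_)
      field_simp
    have h3 : 0 ≤ ρ := by positivity
    have h4 : 1 / 4 * (1 / t) ≤ 2 * (σ' - ρ) := by rw [e2]; linarith
    have h5 : 0 ≤ ∑ g : ι → ZMod n, backlog A' σ' g 0 :=
      Finset.sum_nonneg fun g _ => backlog_nonneg A' σ' g 0
    have h6 : ρ + ρ ^ 2 + σ' ^ 2 ≤ 1 / 4 * (1 / t) * 2 := by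
      rw [e2]
      nlinarith
    have h7 := (mul_le_mul_of_nonneg_right h4 h5).trans
      (h1.trans (mul_le_mul_of_nonneg_right h6 hN0))
    rw [mul_assoc (1 / 4 * (1 / t)) 2 N] at h7
    exact le_of_mul_le_mul_left h7 (by positivity)
  -- separate the block boundaries from the backlogs
  set p : ℕ → ℝ := fun d => (∑ g : ι → ZMod n,
      (if (d : ℝ) / 2 - 3 ≤ backlog A σ g 0 then (1 : ℝ) else 0)) +
    (∑ g : ι → ZMod n, (if (d : ℝ) / (16 * t) - 4 ≤ backlog A' σ' g 0 then (1 : ℝ) else 0)) +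
    (if n < 2 * E.t then 1 else 0) * N with hp
  have h1 : ∑ x : ZMod n, ∑ g : ι → ZMod n, passCost E A A' x g =
      (∑ q ∈ Finset.range n, (edge E n q : ℝ)) * ∑ d ∈ Finset.range n, p d := by
    have h2 : ∀ x : ZMod n, ∑ g : ι → ZMod n, passCost E A A' x g =
        ∑ d ∈ Finset.range n, (edge E n (x.val + d) : ℝ) * p d := by
      intro x
      unfold passCost
      rw [Finset.sum_comm]
      refine Finset.sum_congr rfl fun d _ => ?_
      rw [← Finset.mul_sum, Finset.sum_add_distrib, Finset.sum_add_distrib,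
        sum_backlog_ge_eq A, sum_backlog_ge_eq A', hp, hN, Finset.mul_sum]
      simp only [mul_one]
      rfl
    rw [Finset.sum_congr rfl fun x _ => h2 x, Finset.sum_comm, Finset.mul_sum]
    refine Finset.sum_congr rfl fun d _ => ?_
    rw [← Finset.sum_mul]
    congr 1
    exact_mod_cast sum_edge_zmod (E := E) n d
  have h2 : ∑ d ∈ Finset.range n, p d ≤ 114 * t * N := by
    simp only [hp, Finset.sum_add_distrib]
    have h3 := sum_range_backlog_ge_le A σ (s := 2) (c := 3) (by norm_num) (by norm_num) n (n := n)
    have h4 := sum_range_backlog_ge_le A' σ' (s := 16 * t) (c := 4) (by positivity) (by norm_num) n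
      (n := n)
    have h5 : ∑ _d ∈ Finset.range n, (if n < 2 * E.t then (1 : ℝ) else 0) * N ≤ 2 * t * N := by
      rw [Finset.sum_const, Finset.card_range, nsmul_eq_mul]
      split_ifs with h6
      · have : (n : ℝ) ≤ 2 * t := by rw [htdef]; exact_mod_cast h6.le
        nlinarith
      · rw [zero_mul, mul_zero]; positivity
    have h6 : 16 * t * ∑ g : ι → ZMod n, backlog A' σ' g 0 ≤ 16 * t * (2 * N) :=
      mul_le_mul_of_nonneg_left hR (by positivity)
    nlinarith
  have h3 : ∑ q ∈ Finset.range n, (edge E n q : ℝ) ≤ 2 * n / E.B := by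
    rw [le_div_iff₀ hB']
    exact_mod_cast sum_edge_le (E := E) (NeZero.pos n)
  have h4 : 0 ≤ ∑ d ∈ Finset.range n, p d := Finset.sum_nonneg fun d _ => by
    simp only [hp]
    refine add_nonneg (add_nonneg ?_ ?_) ?_
    · exact Finset.sum_nonneg fun g _ => by split_ifs <;> norm_num
    · exact Finset.sum_nonneg fun g _ => by split_ifs <;> norm_num
    · split_ifs <;> simp [hN0]
  rw [h1]
  calc _ ≤ 2 * n / E.B * (114 * t * N) := mul_le_mul h3 h2 h4 (by positivity)
    _ = _ := by ring

end PassCost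

/-- The cost of an operation in terms of the hashes of the keys. The key `u` itself may be left out
of `A` and `A'`, which keeps their hashes independent of that of `u`; the thresholds of `passCost`
allow for one more item. -/
lemma Inv.cost_le [DecidableEq U] {K : Set U} (hG : Generic E K) {T : Table U} {X X₀ Y : Finset U}
    (h : Inv E T X X₀ Y) (ht : 2 ≤ E.t) (hleft : 0 < T.left) {u : U} {l l' : ℕ}
    (hcost : CostBound E T.n u (T.mem.cell T.area) l l') {ι : Type*} {n : ℕ} [NeZero n]
    (hTn : T.n = n)
    (A A' : Finset ι) (φ : ι → U)
    (hA : ∀ v ∈ Y, v ≠ u → ∃ i ∈ A, φ i = v) (hA' : ∀ v ∈ Y \ X₀, v ≠ u → ∃ i ∈ A', φ i = v)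
    (hAc : (A.card : ℝ) ≤ (1 - 3 / (4 * E.t)) * n) (hAc' : (A'.card : ℝ) ≤ 1 / (4 * E.t) * n) :
    (l' : ℝ) ≤ l + 1 + passCost E A A' (E.home n (.key u) : ZMod n)
      (fun i => (E.home n (.key (φ i)) : ZMod n)) := by
  subst hTn
  classical
  obtain ⟨D, hp, hl⟩ := hcost
  have hlt := home_key_lt (E := E) hG.mem_Ico h.pos
  set x : ZMod T.n := (E.home T.n (.key u) : ZMod T.n) with hx
  set g : ι → ZMod T.n := fun i => (E.home T.n (.key (φ i)) : ZMod T.n) with hg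
  have hxv : x.val = E.home T.n (.key u) := by
    rw [hx, ZMod.val_natCast, Nat.mod_eq_of_lt (hlt u)]
  have ht' : (2 : ℝ) ≤ E.t := by exact_mod_cast ht
  have ht0 : (0 : ℝ) < E.t := by linarith
  have hn0 : (0 : ℝ) < T.n := by exact_mod_cast h.pos
  have hoff : ∀ m v, E.offset T.n m (.key v) =
      ((m : ZMod T.n) - (E.home T.n (.key v) : ZMod T.n)).val := by
    intro m v
    have h1 : ((m : ZMod T.n) - (E.home T.n (.key v) : ZMod T.n)) =
        ((m + T.n - E.home T.n (.key v) : ℕ) : ZMod T.n) := by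
      rw [Nat.cast_sub (by have := hlt v; omega)]; simp
    rw [h1, ZMod.val_natCast]
    rfl
  have hcount : ∀ (Z : Finset U) (I : Finset ι), (∀ v ∈ Z, v ≠ u → ∃ i ∈ I, φ i = v) → ∀ m j,
      (Z.filter fun v => E.offset T.n m (.key v) ≤ j).card ≤
        arcCount I g (m : ZMod T.n) (j + 1) + 1 := by
    intro Z I hI m j
    have h1 : (Z.filter fun v => E.offset T.n m (.key v) ≤ j) ⊆
        insert u ((I.filter fun i => ((m : ZMod T.n) - g i).val < j + 1).image φ) := by
      intro v hv
      rw [Finset.mem_filter] at hv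
      rw [Finset.mem_insert]
      by_cases hvu : v = u
      · exact Or.inl hvu
      · obtain ⟨i, hi, rfl⟩ := hI v hv.1 hvu
        right
        rw [Finset.mem_image]
        refine ⟨i, ?_, rfl⟩
        rw [Finset.mem_filter]
        refine ⟨hi, ?_⟩
        have := hv.2
        rw [hoff] at this
        simp only [hg]
        omega
    exact ((Finset.card_le_card h1).trans (Finset.card_insert_le _ _)).trans
      (Nat.add_le_add_right Finset.card_image_le 1)
  have key : ∀ d < D, d < T.n ∧ ((d : ℝ) / 2 - 3 ≤
        backlog A (1 - 1 / (2 * E.t)) g (x + ((d + 1) / 2 : ℕ)) ∨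
      (d : ℝ) / (16 * E.t) - 4 ≤ backlog A' (3 / (8 * E.t)) g (x + ((d + 1) / 2 : ℕ)) ∨
      T.n < 2 * E.t) := by
    intro d hd
    -- the operation passes `d + 1` slots, too
    obtain ⟨h1, h2⟩ := h.long_operation ht hleft (hlt u) (D := d + 1) (by omega)
      fun j hj => hp j (by omega)
    refine ⟨by omega, ?_⟩
    have hm : x + ((d + 1) / 2 : ℕ) = ((E.home T.n (.key u) + (d + 1) / 2 : ℕ) : ZMod T.n) := by
      rw [Nat.cast_add]
    rw [hm]
    set m := E.home T.n (.key u) + (d + 1) / 2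
    rcases h2 with ⟨j, hj, h3⟩ | ⟨j, hj, h4, h3⟩ | h3
    · left
      have h5 := le_backlog A (σ := 1 - 1 / (2 * E.t)) (hAc.trans (mul_le_mul_of_nonneg_right (by
        have e1 : 1 / (2 * (E.t : ℝ)) = 2 / (4 * E.t) := by field_simp; norm_num
        have e2 : 2 / (4 * (E.t : ℝ)) ≤ 3 / (4 * E.t) :=
          div_le_div_of_nonneg_right (by norm_num) (by positivity)
        linarith) hn0.le)) g (m : ZMod T.n) (show j + 1 ≤ T.n by omega)
      refine le_trans ?_ h5
      have h6 := hcount Y A hA m j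
      have h7 : 2 * j + d + 1 ≤
          2 * (arcCount A g (m : ZMod T.n) (j + 1) + 1 + (j / (2 * E.t) + 1)) := by
        have h8 : j + (d + 1 - (d + 1) / 2) ≤
          arcCount A g (m : ZMod T.n) (j + 1) + 1 + (j / (2 * E.t) + 1) :=
          h3.trans (Nat.add_le_add_right h6 _)
        generalize j / (2 * E.t) = y at *
        omega
      have h8 : ((j / (2 * E.t) : ℕ) : ℝ) ≤ j * (1 / (2 * E.t)) := by
        refine Nat.cast_div_le.trans (le_of_eq ?_)
        push_cast; ring
      have h9 : (2 * j + d + 1 : ℝ) ≤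
        2 * (arcCount A g (m : ZMod T.n) (j + 1) + 1 + (((j / (2 * E.t) : ℕ) : ℝ) + 1)) := by
        exact_mod_cast h7
      have h10 : 0 ≤ 1 / (2 * (E.t : ℝ)) := by positivity
      push_cast
      nlinarith
    · right; left
      have h5 := le_backlog A' (σ := 3 / (8 * E.t)) (hAc'.trans (mul_le_mul_of_nonneg_right (by
        have e1 : 1 / (4 * (E.t : ℝ)) = 2 / (8 * E.t) := by field_simp; norm_num
        rw [e1]
        exact div_le_div_of_nonneg_right (by norm_num) (by positivity)) hn0.le)) g (m : ZMod T.n)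
        (show j + 1 ≤ T.n by omega)
      refine le_trans ?_ h5
      have h6 := hcount (Y \ X₀) A' hA' m j
      have h7 : j ≤ 2 * E.t * (arcCount A' g (m : ZMod T.n) (j + 1) + 3) :=
        h3.trans (Nat.mul_le_mul_left _ (by omega))
      have h8 : (j : ℝ) ≤ 2 * E.t * (arcCount A' g (m : ZMod T.n) (j + 1) + 3) := by
        exact_mod_cast h7
      have h9 : (d : ℝ) ≤ 2 * j := by
        have : d ≤ 2 * j := by omega
        exact_mod_cast this
      have e3 : (d : ℝ) / (16 * E.t) ≤ j / (8 * E.t) := by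
        rw [div_le_div_iff₀ (by positivity) (by positivity)]
        nlinarith
      have e4 : 3 / (8 * (E.t : ℝ)) * ((j + 1 : ℕ) : ℝ) = 3 * (j / (8 * E.t)) + 3 / (8 * E.t) := by
        push_cast; ring
      have e5 : 3 / (8 * (E.t : ℝ)) ≤ 1 := by rw [div_le_one (by positivity)]; linarith
      have e6 : 4 * ((j : ℝ) / (8 * E.t)) ≤ arcCount A' g (m : ZMod T.n) (j + 1) + 3 := by
        rw [← mul_div_assoc, div_le_iff₀ (by positivity)]
        linarith
      rw [e4]
      linarith
    · exact Or.inr (Or.inr h3)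
  have hDn : D ≤ T.n := by
    by_contra hc
    exact absurd (key T.n (by omega)).1 (lt_irrefl _)
  have hsum : ((∑ d ∈ Finset.range D, edge E T.n (E.home T.n (.key u) + d) : ℕ) : ℝ) ≤
      passCost E A A' x g := by
    unfold passCost
    push_cast
    refine (Finset.sum_le_sum fun d hd => ?_).trans (Finset.sum_le_sum_of_subset_of_nonneg
      (Finset.range_mono hDn) fun d _ _ => mul_nonneg (Nat.cast_nonneg _) ?_)
    · rw [hxv]
      refine le_mul_of_one_le_right (Nat.cast_nonneg _) ?_
      rcases (key d (Finset.mem_range.1 hd)).2 with h1 | h1 | h1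
      · rw [if_pos h1]; split_ifs <;> norm_num
      · rw [if_pos h1]; split_ifs <;> norm_num
      · rw [if_pos h1]; split_ifs <;> norm_num
    · split_ifs <;> norm_num
  have : (l' : ℝ) ≤ l + 1 +
      ((∑ d ∈ Finset.range D, edge E T.n (E.home T.n (.key u) + d) : ℕ) : ℝ) := by
    exact_mod_cast hl
  linarith

/-! ### The load of the table -/

section Load

variable {T : Table U} {X X₀ Y : Finset U}

/-- A rebuild makes the load factor `1 - 1 / t`, up to three slots. -/
lemma card_base_bounds (ht : 2 ≤ E.t) {N : ℕ} (hn : n = E.size N) :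
    (N : ℝ) * E.t ≤ n * (E.t - 1) ∧ ((n : ℝ) - 3) * (E.t - 1) ≤ N * E.t := by
  obtain ⟨s, hs⟩ := Nat.exists_eq_add_of_le ht
  have h1 := Nat.lt_mul_div_succ N (show 0 < E.t - 1 by omega)
  have h2 := Nat.mul_div_le N (E.t - 1)
  have hn' : n = N + N / (E.t - 1) + 3 := hn
  have hs' : E.t - 1 = s + 1 := by omega
  have h5 : (E.t : ℝ) = s + 2 := by rw [hs]; push_cast; ring
  rw [hs'] at h1 h2 hn'
  set q := N / (s + 1)
  have h3 : (N : ℝ) < (s + 1) * (q + 1) := by exact_mod_cast h1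
  have h4 : ((s : ℝ) + 1) * q ≤ N := by exact_mod_cast h2
  rw [h5, hn']
  push_cast
  constructor <;> nlinarith

/-- Fewer than `E.window n` insertions and deletions have taken place while a rebuild is not yet
due, so that the lower bound `1` on the window does not matter. -/
lemma window_sub_one_le (E : Env U) (n : ℕ) : ((E.window n - 1 : ℕ) : ℝ) ≤ n / (4 * E.t) := by
  have h1 : E.window n - 1 ≤ n / (4 * E.t) := by
    unfold Env.window
    generalize n / (4 * E.t) = w
    omega
  refine (Nat.cast_le.2 h1).trans (Nat.cast_div_le.trans (le_of_eq ?_))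
  push_cast; ring

namespace Inv

lemma card_seen_le (h : Inv E T X X₀ Y) (ht : 2 ≤ E.t) (hleft : 0 < T.left) :
    (Y.card : ℝ) ≤ (1 - 3 / (4 * E.t)) * T.n := by
  have h1 := (card_base_bounds ht h.size).1
  have h2 := window_sub_one_le E T.n
  have h3 : Y.card ≤ X₀.card + (E.window T.n - 1) := by have := h.seen; omega
  have h4 : (Y.card : ℝ) ≤ X₀.card + (E.window T.n - 1 : ℕ) := by exact_mod_cast h3
  have ht0 : (0 : ℝ) < E.t := by exact_mod_cast (by omega : 0 < E.t)
  have h5 : (X₀.card : ℝ) ≤ T.n * (E.t - 1) / E.t := by rwa [le_div_iff₀ ht0]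
  refine h4.trans ((add_le_add h5 h2).trans (le_of_eq ?_))
  field_simp
  ring

lemma card_new_le [DecidableEq U] (h : Inv E T X X₀ Y) (hleft : 0 < T.left) :
    ((Y \ X₀).card : ℝ) ≤ 1 / (4 * E.t) * T.n := by
  have h2 := window_sub_one_le E T.n
  have h3 : (Y \ X₀).card ≤ E.window T.n - 1 := by
    rw [Finset.card_sdiff_of_subset h.base_sub]
    have := h.seen
    omega
  refine (Nat.cast_le.2 h3).trans (h2.trans (le_of_eq ?_))
  ring

lemma le_card (h : Inv E T X X₀ Y) (ht : 2 ≤ E.t) (hleft : 0 < T.left) :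
    (1 - 5 / (4 * E.t)) * T.n - 3 ≤ (X.card : ℝ) := by
  have h1 := (card_base_bounds ht h.size).2
  have h2 := window_sub_one_le E T.n
  have h3 : X₀.card ≤ X.card + (E.window T.n - 1) := by have := h.kept; omega
  have h4 : (X₀.card : ℝ) ≤ X.card + (E.window T.n - 1 : ℕ) := by exact_mod_cast h3
  have ht0 : (0 : ℝ) < E.t := by exact_mod_cast (by omega : 0 < E.t)
  have h5 : ((T.n : ℝ) - 3) * (E.t - 1) / E.t ≤ X₀.card := by rwa [div_le_iff₀ ht0]
  have h6 : (1 - 5 / (4 * (E.t : ℝ))) * T.n - 3 ≤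
      ((T.n : ℝ) - 3) * (E.t - 1) / E.t - T.n / (4 * E.t) := by
    have : ((T.n : ℝ) - 3) * (E.t - 1) / E.t - T.n / (4 * E.t) =
        (1 - 5 / (4 * (E.t : ℝ))) * T.n - 3 + 3 / E.t := by
      field_simp
      ring
    rw [this]
    have : 0 < 3 / (E.t : ℝ) := by positivity
    linarith
  linarith

lemma stores (h : Inv E T X X₀ Y) : T.Stores X := by
  refine ⟨fun u hu => ?_, fun u p hp => (h.key u).2 ⟨p, hp⟩, h.outside⟩
  obtain ⟨p, hp⟩ := (h.key u).1 hu
  refine ⟨p, hp, fun q hq => ?_⟩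
  exact h.ordered.eq_of_val_eq (h.lt_of_cell (by rw [hq]; simp)) (h.lt_of_cell (by rw [hp]; simp))
    (by rw [hq]; simp) (by rw [hp]; simp) (by rw [hp, hq])

lemma loadFactor_eq (h : Inv E T X X₀ Y) : T.loadFactor = X.card / T.n := by
  classical
  unfold Table.loadFactor
  congr 2
  symm
  refine Finset.card_bij (fun u hu => ((h.key u).1 hu).choose) ?_ ?_ ?_
  · intro u hu
    have hp := ((h.key u).1 hu).choose_spec
    rw [Finset.mem_filter, Finset.mem_range]
    exact ⟨h.lt_of_cell (by rw [hp]; simp), u, hp⟩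
  · intro u hu v hv he
    have hp := ((h.key u).1 hu).choose_spec
    have hq := ((h.key v).1 hv).choose_spec
    rw [he, hq] at hp
    simpa using hp.symm
  · intro p hp
    rw [Finset.mem_filter] at hp
    obtain ⟨-, u, hu⟩ := hp
    have hX := (h.key u).2 ⟨p, hu⟩
    refine ⟨u, hX, ?_⟩
    have hq := ((h.key u).1 hX).choose_spec
    exact h.ordered.eq_of_val_eq (h.lt_of_cell (by rw [hq]; simp)) (h.lt_of_cell (by rw [hu]; simp))
      (by rw [hq]; simp) (by rw [hu]; simp) (by rw [hq, hu])

end Inv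

end Load

/-! ### Sequences of operations -/

/-- The part of the history that determines the size of the table and when it is rebuilt: the keys
at the last rebuild, all keys held since then, and the time left until the next rebuild. -/
structure Epoch (U : Type*) where
  base : Finset U
  seen : Finset U
  left : ℕ

/-- The history after `k` operations. It does not depend on the hash function (`epoch_congr`). -/
def epoch [DecidableEq U] (E : Env U) (S : ℕ → Op U) : ℕ → Epoch U
  | 0 => ⟨∅, ∅, E.window (E.size 0)⟩
  | k + 1 =>
    if (S k).tick (epoch E S k).left = 0 then
      ⟨contents S (k + 1), contents S (k + 1), E.window (E.size (contents S (k + 1)).card)⟩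
    else ⟨(epoch E S k).base, (S k).see (epoch E S k).seen, (S k).tick (epoch E S k).left⟩

lemma epoch_congr [DecidableEq U] {E' : Env U} (h : E.t = E'.t) (S : ℕ → Op U) (k : ℕ) :
    epoch E S k = epoch E' S k := by
  have h1 : ∀ N, E.size N = E'.size N := fun N => by unfold Env.size; rw [h]
  have h2 : ∀ n, E.window n = E'.window n := fun n => by unfold Env.window; rw [h]
  induction k with
  | zero => simp only [epoch, h1, h2]
  | succ k ih => simp only [epoch, h1, h2, ih]

lemma window_pos (E : Env U) (n : ℕ) : 0 < E.window n := lt_of_lt_of_le one_pos (le_max_left _ _)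

lemma inv_empty (ht : 2 ≤ E.t) : Inv E E.empty ∅ ∅ ∅ := by
  have hsize : E.size 0 = 3 := by simp [Env.size]
  have hitems : items (E.size 0) (fun _ => (.free : Slot U)) = ∅ := by
    ext s
    rw [mem_items]
    simp only [Finset.notMem_empty, iff_false, not_and]
    rintro hs ⟨p, -, rfl⟩
    exact hs rfl
  refine ⟨fun a p hp => absurd rfl hp, ⟨fun p => ?_, fun p hp => absurd rfl hp⟩,
    fun p => trivial, fun u => ?_, rfl, rfl, subset_refl _, ?_, ?_, fun m g hg => ?_, ?_⟩
  · have : (0 : ℕ) < E.size 0 := by omega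
    simpa [Env.empty, Env.home, Env.val] using this
  · simp [Env.empty]
  · simp [Env.empty]
  · simp [Env.empty]
  · simp only [Env.empty] at hg
    rw [hitems] at hg
    simp at hg
  · have h3 : E.size 0 / (2 * E.t) = 0 := Nat.div_eq_of_lt (by omega)
    simp [Env.empty, card_graves (show 0 < E.t by omega), h3]

lemma Op.apply_subset [DecidableEq U] {K : Set U} {X : Finset U} (hX : ↑X ⊆ K) {op : Op U}
    (hop : op.key ∈ K) : ↑(op.apply X) ⊆ K := by
  cases op with
  | query u => exact hX
  | insert u => simpa [Op.apply, Set.insert_subset_iff] using ⟨hop, hX⟩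
  | delete u => exact (Finset.coe_subset.2 (Finset.erase_subset u X)).trans hX

lemma Op.see_subset [DecidableEq U] {K : Set U} {Y : Finset U} (hY : ↑Y ⊆ K) {op : Op U}
    (hop : op.key ∈ K) : ↑(op.see Y) ⊆ K := by
  cases op with
  | query u => exact hY
  | insert u => simpa [Op.see, Set.insert_subset_iff] using ⟨hop, hY⟩
  | delete u => exact hY

lemma contents_subset [DecidableEq U] {K : Set U} {S : ℕ → Op U} (hS : ∀ k, (S k).key ∈ K)
    (k : ℕ) : ↑(contents S k) ⊆ K := by
  induction k with
  | zero => simp [contents]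
  | succ k ih => rw [contents_succ]; exact Op.apply_subset ih (hS k)

section Run

variable [DecidableEq U] {K : Set U} {S : ℕ → Op U}

/-- The invariant holds throughout, with the history as given by `epoch`. -/
lemma run_inv (hG : Generic E K) (hf : 0 < E.frames) (ht : 2 ≤ E.t) (hS : ∀ k, (S k).key ∈ K)
    (k : ℕ) :
    Inv E (run E S k) (contents S k) (epoch E S k).base (epoch E S k).seen ∧
      ↑(epoch E S k).seen ⊆ K ∧ (run E S k).left = (epoch E S k).left ∧ 0 < (run E S k).left := by
  induction k with
  | zero => exact ⟨inv_empty ht, by simp [epoch], rfl, window_pos E _⟩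
  | succ k ih =>
    obtain ⟨h, hY, hl, hleft⟩ := ih
    obtain ⟨h1, -, -, hn, -, hl'⟩ := perform_spec hG hf ht h hY (hS k) hleft
    have hY' := Op.see_subset hY (hS k)
    rw [← contents_succ] at h1
    rw [hl] at hl'
    simp only [run, maintain, epoch, hl']
    split_ifs with h0
    · obtain ⟨h2, -⟩ := rebuild_spec hG ht h1 hY'
      refine ⟨h2, contents_subset hS _, ?_, window_pos E _⟩
      change E.window (E.size _) = _
      rw [h1.count]
    · exact ⟨h1, hY', hl', by omega⟩

/-- Amortized cost of all rebuilds: each insertion or deletion pays `472 * t / B` for the next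
rebuild. -/
lemma sum_rebuildCost_le (hG : Generic E K) (hf : 2 ≤ E.frames) (ht : 2 ≤ E.t) (hB : 0 < E.B)
    (hS : ∀ k, (S k).key ∈ K) (k : ℕ) :
    (∑ i ∈ Finset.range k, rebuildCost E S i) * E.B ≤ 472 * (E.t * k) := by
  -- the operations since the last rebuild have paid already, which is what the two terms with the
  -- window and `left` account for
  have main : (∑ i ∈ Finset.range k, rebuildCost E S i + (run E S k).pot E) * E.B +
      472 * (E.t * E.window (run E S k).n) ≤ 472 * (E.t * (k + (run E S k).left)) := by
    induction k with
    | zero =>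
      have h1 : (run E S 0).pot E = 0 := by
        unfold Table.pot
        split_ifs
        · simp [run, Env.empty, pot]
        · rfl
      rw [h1]
      simp [run, Env.empty]
    | succ k ih =>
      obtain ⟨h, hY, -, hleft⟩ := run_inv hG (by omega) ht hS k
      obtain ⟨h1, -, -, hn, -, hl'⟩ := perform_spec hG (by omega) ht h hY (hS k) hleft
      have hY' := Op.see_subset hY (hS k)
      obtain ⟨hpot, -⟩ := perform_pot hf h.pos (fun p hp => h.lt_of_cell hp) (S k)
      have htick : (run E S k).left ≤ (S k).tick (run E S k).left + 1 := by
        cases S k <;> simp only [Op.tick] <;> omega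
      rw [Finset.sum_range_succ]
      have hrun : run E S (k + 1) = maintain E (perform E (run E S k) (S k)).1 := rfl
      set R := ∑ i ∈ Finset.range k, rebuildCost E S i
      have step : (R + (perform E (run E S k) (S k)).1.pot E) * E.B +
          472 * (E.t * E.window (run E S k).n) ≤
          472 * (E.t * (k + 1 + (perform E (run E S k) (S k)).1.left)) := by
        rw [hl']
        have e1 : (R + (perform E (run E S k) (S k)).1.pot E) * E.B ≤
          (R + (run E S k).pot E) * E.B := Nat.mul_le_mul_right _ (by omega)
        have e2 : E.t * (k + (run E S k).left) ≤
            E.t * (k + 1 + (S k).tick (run E S k).left) := Nat.mul_le_mul_left _ (by omega)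
        omega
      unfold rebuildCost
      rw [hrun]
      unfold maintain
      split_ifs with h0
      · have h2 := h1.rebuild_amortized hG hf ht hY' hB
        rw [h0, add_zero] at step
        rw [hn] at h2
        have h3 : (rebuild E (perform E (run E S k) (S k)).1).left =
          E.window (rebuild E (perform E (run E S k) (S k)).1).n := rfl
        rw [h3, mul_add E.t, mul_add 472, add_mul, add_mul]
        rw [add_mul] at h2 step
        omega
      · rw [Nat.sub_self, add_zero, hn]
        exact step
  obtain ⟨h, -⟩ := run_inv hG (by omega) ht hS k
  have hw : (run E S k).left ≤ E.window (run E S k).n := by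
    have h1 := h.seen
    have h2 := Finset.card_le_card h.base_sub
    omega
  have h3 := Nat.mul_le_mul_left E.t hw
  rw [add_mul, mul_add E.t, mul_add 472] at main
  omega

end Run

end

/-! ### The hash function is uniform and independent -/

section Hash

variable {U Ω : Type*} [MeasurableSpace Ω] {P : Measure Ω} {H : U → Ω → ℝ}

/-- With probability one, countably many keys have hash values in general position. -/
lemma IsIdealHash.ae_generic [IsProbabilityMeasure P] (hH : IsIdealHash P H) {K : Set U}
    (hK : K.Countable) {E : Ω → Env U} (hE : ∀ ω, (E ω).H = fun u => H u ω) :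
    ∀ᵐ ω ∂P, Generic (E ω) K := by
  have h1 : ∀ᵐ ω ∂P, ∀ u ∈ K, Irrational (H u ω) := by
    rw [ae_ball_iff hK]
    intro u _
    have h2 : ∀ᵐ y ∂(P.map (H u)), Irrational y := by
      rw [hH.uniform u]
      refine ae_restrict_of_ae ?_
      have : (Set.range ((↑) : ℚ → ℝ)).Countable := Set.countable_range _
      exact measure_mono_null (fun y hy => by simpa [Irrational] using hy)
        (this.measure_zero volume)
    exact ae_of_ae_map (hH.measurable u).aemeasurable h2
  have h3 : ∀ᵐ ω ∂P, ∀ u ∈ K, ∀ v ∈ K, u ≠ v → H u ω ≠ H v ω := by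
    rw [ae_ball_iff hK]
    intro u _
    rw [ae_ball_iff hK]
    intro v _
    by_cases huv : u = v
    · exact Filter.Eventually.of_forall fun ω h => absurd huv h
    have h4 := (indepFun_iff_map_prod_eq_prod_map_map (hH.measurable u).aemeasurable
      (hH.measurable v).aemeasurable).1 (hH.indep.indepFun huv)
    have h5 : ∀ᵐ y ∂(P.map fun ω => (H u ω, H v ω)), y.1 ≠ y.2 := by
      rw [h4, ae_iff]
      have hm : MeasurableSet {y : ℝ × ℝ | ¬ y.1 ≠ y.2} := by
        simpa using measurableSet_eq_fun measurable_fst measurable_snd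
      have : IsProbabilityMeasure (P.map (H v)) :=
        Measure.isProbabilityMeasure_map (hH.measurable v).aemeasurable
      rw [Measure.measure_prod_null hm]
      refine Filter.Eventually.of_forall fun y => ?_
      have h6 : Prod.mk y ⁻¹' {y : ℝ × ℝ | ¬ y.1 ≠ y.2} = {y} := by
        ext z; simp [eq_comm]
      change P.map (H v) (Prod.mk y ⁻¹' _) = 0
      rw [h6, hH.uniform v]
      exact (nonpos_iff_eq_zero.1 ((Measure.restrict_apply_le _ _).trans (by simp)))
    filter_upwards [ae_of_ae_map ((hH.measurable u).prodMk (hH.measurable v)).aemeasurable h5]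
      with ω hω _ using hω
  filter_upwards [h1, h3] with ω hω1 hω3
  refine ⟨fun u => ?_, fun u hu => ?_, fun u hu v hv huv => ?_⟩
  · rw [hE]; exact hH.mem_Ico u ω
  · rw [hE]; exact hω1 u hu
  · rw [hE] at huv
    by_contra hne
    exact hω3 u hu v hv hne huv

/-- The hashes of the keys in `s` are independent and uniform. -/
lemma IsIdealHash.measure_floor_eq (hH : IsIdealHash P H) {n : ℕ} (hn : 0 < n) (s : Finset U)
    {G : U → ℕ} (hG : ∀ v ∈ s, G v < n) :
    P (⋂ v ∈ s, {ω | ⌊H v ω * n⌋₊ = G v}) = (n : ENNReal)⁻¹ ^ s.card := by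
  have hn' : (0 : ℝ) < n := by exact_mod_cast hn
  have hset : ∀ v, {ω | ⌊H v ω * n⌋₊ = G v} =
      H v ⁻¹' Set.Ico ((G v : ℝ) / n) (((G v : ℝ) + 1) / n) := by
    intro v
    ext ω
    have h0 := (hH.mem_Ico v ω).1
    simp only [Set.mem_ofPred_eq, Set.mem_preimage, Set.mem_Ico]
    rw [Nat.floor_eq_iff (by positivity), div_le_iff₀ hn', lt_div_iff₀ hn']
  simp only [hset]
  rw [hH.indep.measure_inter_preimage_eq_mul s (fun v _ => measurableSet_Ico)]
  rw [← Finset.prod_const]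
  refine Finset.prod_congr rfl fun v hv => ?_
  rw [← Measure.map_apply (hH.measurable v) measurableSet_Ico, hH.uniform v,
    Measure.restrict_apply measurableSet_Ico, Set.inter_eq_left.2, Real.volume_Ico]
  · rw [← sub_div, add_sub_cancel_left, one_div, ENNReal.ofReal_inv_of_pos hn',
      ENNReal.ofReal_natCast]
  · intro y hy
    refine ⟨le_trans (by positivity) hy.1, hy.2.trans_le ?_⟩
    rw [div_le_one hn']
    exact_mod_cast hG v hv

/-- The expectation of a function of the hashes of `u` and of the keys in `s` is its average over
all values of these hashes. -/
lemma IsIdealHash.lintegral_hashes [DecidableEq U] (hH : IsIdealHash P H) {n : ℕ} [NeZero n] {u : U}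
    {s : Finset U} (hu : u ∉ s) {Φ : ZMod n → (s → ZMod n) → ℝ} (hΦ : ∀ x g, 0 ≤ Φ x g) :
    ∫⁻ ω, ENNReal.ofReal (Φ (⌊H u ω * n⌋₊ : ℕ) fun i => (⌊H i ω * n⌋₊ : ℕ)) ∂P =
      ENNReal.ofReal ((∑ x, ∑ g, Φ x g) / (n * ∑ _g : s → ZMod n, (1 : ℝ))) := by
  have hn : 0 < n := NeZero.pos n
  have hn' : (0 : ℝ) < n := by exact_mod_cast hn
  have hlt : ∀ v ω, ⌊H v ω * n⌋₊ < n := fun v ω => by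
    have h := hH.mem_Ico v ω
    rw [Nat.floor_lt (mul_nonneg h.1 hn'.le)]
    nlinarith [h.2]
  -- `W x g`: the event that `u` has the hash `x` and the keys in `s` have the hashes `g`
  let F : ZMod n → (s → ZMod n) → U → ℕ := fun x g v =>
    if h : v ∈ s then (g ⟨v, h⟩).val else x.val
  let W : ZMod n → (s → ZMod n) → Set Ω := fun x g =>
    ⋂ v ∈ insert u s, {ω | ⌊H v ω * n⌋₊ = F x g v}
  have hWm : ∀ x g, MeasurableSet (W x g) := fun x g =>
    Finset.measurableSet_biInter _ fun v _ => by
      have : Measurable fun ω => ⌊H v ω * n⌋₊ :=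
        Nat.measurable_floor.comp ((hH.measurable v).mul_const _)
      exact this (measurableSet_singleton _)
  have hWP : ∀ x g, P (W x g) = ENNReal.ofReal ((n * ∑ _g : s → ZMod n, (1 : ℝ))⁻¹) := by
    intro x g
    rw [hH.measure_floor_eq hn (insert u s) (G := F x g)
      (fun v _ => by simp only [F]; split_ifs <;> exact ZMod.val_lt _),
      Finset.card_insert_of_notMem hu, ← ENNReal.inv_pow, ENNReal.ofReal_inv_of_pos]
    · congr 1
      simp only [Finset.sum_const, Finset.card_univ, Fintype.card_fun, ZMod.card,
        Fintype.card_coe, nsmul_eq_mul, mul_one]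
      rw [show (n : ℝ) * ((n ^ s.card : ℕ) : ℝ) = ((n ^ (s.card + 1) : ℕ) : ℝ) by push_cast; ring,
        ENNReal.ofReal_natCast]
      push_cast
      rfl
    · refine mul_pos hn' ?_
      simp only [Finset.sum_const, nsmul_eq_mul, mul_one]
      exact_mod_cast Finset.card_pos.2 Finset.univ_nonempty
  have hmem : ∀ ω x g, ω ∈ W x g ↔
      x = (⌊H u ω * n⌋₊ : ℕ) ∧ g = fun i : s => ((⌊H i ω * n⌋₊ : ℕ) : ZMod n) := by
    intro ω x g
    simp only [W, Set.mem_iInter, Set.mem_ofPred_eq]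
    constructor
    · intro h
      refine ⟨?_, funext fun i => ?_⟩
      · have := h u (Finset.mem_insert_self _ _)
        simp only [F, dif_neg hu] at this
        rw [this, ZMod.natCast_zmod_val]
      · have := h i (Finset.mem_insert_of_mem i.2)
        simp only [F, dif_pos i.2] at this
        rw [this, ZMod.natCast_zmod_val]
    · rintro ⟨rfl, rfl⟩ v hv
      simp only [F]
      split_ifs with h
      · rw [ZMod.val_natCast, Nat.mod_eq_of_lt (hlt _ _)]
      · obtain rfl : v = u := (Finset.mem_insert.1 hv).resolve_right h
        rw [ZMod.val_natCast, Nat.mod_eq_of_lt (hlt _ _)]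
  have hpt : ∀ ω, ENNReal.ofReal (Φ (⌊H u ω * n⌋₊ : ℕ) fun i => (⌊H i ω * n⌋₊ : ℕ)) =
      ∑ x, ∑ g, (W x g).indicator (fun _ => ENNReal.ofReal (Φ x g)) ω := by
    intro ω
    rw [Finset.sum_eq_single ((⌊H u ω * n⌋₊ : ℕ) : ZMod n), Finset.sum_eq_single
      fun i : s => ((⌊H i ω * n⌋₊ : ℕ) : ZMod n), Set.indicator_of_mem ((hmem _ _ _).2 ⟨rfl, rfl⟩)]
    · intro g _ hg
      exact Set.indicator_of_notMem (fun h => hg ((hmem _ _ _).1 h).2) _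
    · simp
    · intro x _ hx
      refine Finset.sum_eq_zero fun g _ => ?_
      exact Set.indicator_of_notMem (fun h => hx ((hmem _ _ _).1 h).1) _
    · simp
  simp only [hpt]
  rw [lintegral_finsetSum _ fun x _ => Finset.measurable_sum _ fun g _ =>
    measurable_const.indicator (hWm x g)]
  have hint : ∀ x, ∫⁻ ω, ∑ g, (W x g).indicator (fun _ => ENNReal.ofReal (Φ x g)) ω ∂P =
      ∑ g, ENNReal.ofReal (Φ x g * (n * ∑ _g : s → ZMod n, (1 : ℝ))⁻¹) := by
    intro x
    rw [lintegral_finsetSum _ fun g _ => measurable_const.indicator (hWm x g)]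
    refine Finset.sum_congr rfl fun g _ => ?_
    rw [lintegral_indicator_const (hWm x g), hWP, ENNReal.ofReal_mul (hΦ x g)]
  have hN : 0 ≤ (n * ∑ _g : s → ZMod n, (1 : ℝ))⁻¹ := by positivity
  simp only [hint]
  rw [div_eq_mul_inv, Finset.sum_mul, ENNReal.ofReal_sum_of_nonneg fun x _ =>
    mul_nonneg (Finset.sum_nonneg fun g _ => hΦ x g) hN]
  refine Finset.sum_congr rfl fun x _ => ?_
  rw [Finset.sum_mul, ENNReal.ofReal_sum_of_nonneg fun g _ => mul_nonneg (hΦ x g) hN]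

end Hash

/-! ### The expected cost of an operation -/

/-- The expected cost of an operation. The size of the table and the sets of keys that may have left
items in it are determined by the history (`epoch`), so that the hashes in `passCost` are those of
fixed keys, which are independent and uniform. -/
lemma lintegral_opCost_le {U Ω : Type*} [DecidableEq U] [MeasurableSpace Ω] {P : Measure Ω}
    [IsProbabilityMeasure P] {H : U → Ω → ℝ} (hH : IsIdealHash P H) {B M t : ℕ} {S : ℕ → Op U}
    {E : Ω → Env U} (hE : ∀ ω, E ω = { B := B, M := M, t := t, H := fun u => H u ω })
    (hf : ∀ ω, 0 < (E ω).frames) (ht : 2 ≤ t) (hB : 0 < B) (k : ℕ) :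
    ∫⁻ ω, (opCost (E ω) S k : ENNReal) ∂P ≤ ENNReal.ofReal (1 + 228 * t / B) := by
  classical
  -- the size of the table and the keys that matter do not depend on the hash function
  set E₀ : Env U := { B := B, M := M, t := t, H := fun _ => 0 } with hE₀
  set ep := epoch E₀ S k with hep
  set n := E₀.size ep.base.card with hn
  have hn0 : 0 < n := by have := size_pos (E := E₀) ep.base.card; omega
  have : NeZero n := ⟨hn0.ne'⟩
  set u := (S k).key with hu
  set s := ep.seen.erase u with hs
  set A' : Finset s := Finset.univ.filter fun i : s => (i : U) ∉ ep.base with hA'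
  have hepE : ∀ ω, epoch (E ω) S k = ep := fun ω => epoch_congr (by rw [hE]) S k
  have hgen := hH.ae_generic (Set.countable_range fun k => (S k).key) (E := E)
    (fun ω => by rw [hE])
  have hS : ∀ j, (S j).key ∈ Set.range fun k => (S k).key := fun j => ⟨j, rfl⟩
  have htE : ∀ ω, (E ω).t = t := fun ω => by rw [hE]
  have hsize : ∀ ω, Generic (E ω) (Set.range fun k => (S k).key) → (run (E ω) S k).n = n := by
    intro ω hG
    obtain ⟨h, -⟩ := run_inv hG (hf ω) (by rw [htE]; exact ht) hS k
    rw [h.size, hepE, hE]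
    rfl
  have hcards : ∀ ω, Generic (E ω) (Set.range fun k => (S k).key) →
      ((Finset.univ : Finset s).card : ℝ) ≤ (1 - 3 / (4 * (E₀.t : ℝ))) * n ∧
      (A'.card : ℝ) ≤ 1 / (4 * (E₀.t : ℝ)) * n := by
    intro ω hG
    obtain ⟨h, -, -, hleft⟩ := run_inv hG (hf ω) (by rw [htE]; exact ht) hS k
    have h1 := h.card_seen_le (by rw [htE]; exact ht) hleft
    have h2 := h.card_new_le hleft
    rw [hepE, hsize ω hG, htE] at h1 h2
    constructor
    · refine le_trans ?_ h1
      rw [Finset.card_univ, Fintype.card_coe]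
      exact_mod_cast Finset.card_le_card (Finset.erase_subset _ _)
    · refine le_trans ?_ h2
      rw [Nat.cast_le]
      refine Finset.card_le_card_of_injOn (fun i : s => (i : U)) ?_ Subtype.val_injective.injOn
      intro i hi
      rw [Finset.mem_coe, hA', Finset.mem_filter] at hi
      rw [Finset.mem_coe, Finset.mem_sdiff]
      exact ⟨Finset.mem_of_mem_erase i.2, hi.2⟩
  have hpt : ∀ᵐ ω ∂P, (opCost (E ω) S k : ENNReal) ≤
      1 + ENNReal.ofReal (passCost E₀ Finset.univ A' ((⌊H u ω * n⌋₊ : ℕ) : ZMod n)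
        fun i : s => ((⌊H i ω * n⌋₊ : ℕ) : ZMod n)) := by
    filter_upwards [hgen] with ω hG
    obtain ⟨h, hY, -, hleft⟩ := run_inv hG (hf ω) (by rw [htE]; exact ht) hS k
    obtain ⟨-, -, hcost, -⟩ := perform_spec hG (hf ω) (by rw [htE]; exact ht) h hY (hS k) hleft
    obtain ⟨hc1, hc2⟩ := hcards ω hG
    have hnω := hsize ω hG
    rw [hepE] at h
    have h1 := h.cost_le hG (by rw [htE]; exact ht) hleft hcost hnω Finset.univ A'
      (fun i : s => (i : U))
      (fun v hv hvu => ⟨⟨v, Finset.mem_erase.2 ⟨hvu, hv⟩⟩, Finset.mem_univ _, rfl⟩)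
      (fun v hv hvu => ⟨⟨v, Finset.mem_erase.2 ⟨hvu, (Finset.mem_sdiff.1 hv).1⟩⟩,
        Finset.mem_filter.2 ⟨Finset.mem_univ _, (Finset.mem_sdiff.1 hv).2⟩, rfl⟩)
      (by rw [htE]; exact hc1) (by rw [htE]; exact hc2)
    have h2 : passCost (E ω) Finset.univ A' ((E ω).home n (.key u) : ZMod n)
        (fun i : s => ((E ω).home n (.key (i : U)) : ZMod n)) =
        passCost E₀ Finset.univ A' ((⌊H u ω * n⌋₊ : ℕ) : ZMod n)
        fun i : s => ((⌊H i ω * n⌋₊ : ℕ) : ZMod n) := by rw [hE]; rfl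
    rw [h2] at h1
    have h3 := passCost_nonneg (E := E₀) Finset.univ A' ((⌊H u ω * n⌋₊ : ℕ) : ZMod n)
        fun i : s => ((⌊H i ω * n⌋₊ : ℕ) : ZMod n)
    rw [← ENNReal.ofReal_one, ← ENNReal.ofReal_add zero_le_one h3, ← ENNReal.ofReal_natCast]
    refine ENNReal.ofReal_le_ofReal ?_
    unfold opCost
    rcases le_total (run (E ω) S k).mem.loads (perform (E ω) (run (E ω) S k) (S k)).1.mem.loads
      with h4 | h4
    · rw [Nat.cast_sub h4]; linarith
    · rw [Nat.sub_eq_zero_of_le h4, Nat.cast_zero]; linarith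
  refine (lintegral_mono_ae hpt).trans ?_
  rw [lintegral_add_left measurable_const, lintegral_const, measure_univ, mul_one,
    hH.lintegral_hashes (Finset.notMem_erase u _) fun x g => passCost_nonneg _ _ x g,
    ENNReal.ofReal_add zero_le_one (by positivity), ENNReal.ofReal_one]
  refine add_le_add le_rfl (ENNReal.ofReal_le_ofReal ?_)
  obtain ⟨ω, hG⟩ := hgen.exists
  obtain ⟨hc1, hc2⟩ := hcards ω hG
  have hpos : 0 < (n : ℝ) * ∑ _g : s → ZMod n, (1 : ℝ) := by
    refine mul_pos (by exact_mod_cast hn0) ?_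
    simp only [Finset.sum_const, nsmul_eq_mul, mul_one]
    exact_mod_cast Finset.card_pos.2 Finset.univ_nonempty
  rw [div_le_iff₀ hpos]
  exact sum_passCost_le (E := E₀) ht hB hc1 hc2

end Graveyard

theorem mainTheorem7 :
    ∃ C : ℝ, 0 < C ∧
      ∀ (U : Type*) [DecidableEq U] (Ω : Type*) [MeasurableSpace Ω] (P : Measure Ω)
        [IsProbabilityMeasure P] (H : U → Ω → ℝ), Graveyard.IsIdealHash P H →
      ∀ (B M : ℕ) (x r : ℝ), 1 ≤ x → 1 ≤ r → (B : ℝ) = r * x → C * B ≤ M →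
      ∀ (S : ℕ → Graveyard.Op U) (E : Ω → Graveyard.Env U),
        (∀ ω, E ω = { B := B, M := M, t := 2 * ⌈x⌉₊, H := fun u => H u ω }) →
        -- correctness, load factor and cost of rebuilds, with probability one
        (∀ᵐ ω ∂P, ∀ k : ℕ,
          (Graveyard.run (E ω) S k).Stores (Graveyard.contents S k) ∧
          (Graveyard.answer (E ω) S k = true ↔ (S k).key ∈ Graveyard.contents S k) ∧
          (Graveyard.run (E ω) S k).loadFactor ≤ 1 - 1 / (C * x) ∧
          (C * x ≤ (Graveyard.contents S k).card →
            1 - 1 / x ≤ (Graveyard.run (E ω) S k).loadFactor) ∧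
          ((∑ i ∈ Finset.range k, Graveyard.rebuildCost (E ω) S i : ℕ) : ℝ) ≤ C / r * k) ∧
        -- expected cost of each operation
        (∀ k : ℕ,
          ∫⁻ ω, (Graveyard.opCost (E ω) S k : ENNReal) ∂P ≤ ENNReal.ofReal (1 + C / r)) := by
  -- `1888 = 472 * 4`, as rebuilds cost `472 * t / B` per operation and `t ≤ 4 * x`; the bound
  -- `228 * t / B` on the operations themselves is less
  refine ⟨1888, by norm_num, ?_⟩
  intro U _ Ω _ P _ H hH B M x r hx hr hBrx hM S E hE
  have hx0 : 0 < x := by linarith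
  have hr0 : 0 < r := by linarith
  have hBpos : (0 : ℝ) < B := by rw [hBrx]; positivity
  have hB : 0 < B := by exact_mod_cast hBpos
  set t := 2 * ⌈x⌉₊ with ht
  have hceil := Nat.le_ceil x
  have hceil' := Nat.ceil_lt_add_one hx0.le
  have ht2 : 2 ≤ t := by
    have := Nat.ceil_pos.2 hx0
    omega
  have htR : (t : ℝ) = 2 * ⌈x⌉₊ := by rw [ht]; push_cast; rfl
  have htlo : 2 * x ≤ t := by rw [htR]; linarith
  have hthi : (t : ℝ) ≤ 4 * x := by rw [htR]; linarith
  -- a rebuild works on one block of each area at a time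
  have hframes : ∀ ω, 2 ≤ (E ω).frames := by
    intro ω
    rw [hE]
    have h1 : 1888 * B ≤ M := by exact_mod_cast hM
    unfold Graveyard.Env.frames
    rw [Nat.le_div_iff_mul_le hB]
    simp only
    omega
  have htB : (t : ℝ) / B ≤ 4 / r := by
    rw [div_le_div_iff₀ hBpos hr0, hBrx]
    nlinarith
  refine ⟨?_, fun k => ?_⟩
  · have hgen := hH.ae_generic (Set.countable_range fun k => (S k).key) (E := E)
      (fun ω => by rw [hE])
    have hS : ∀ j, (S j).key ∈ Set.range fun k => (S k).key := fun j => ⟨j, rfl⟩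
    filter_upwards [hgen] with ω hG k
    have htE : (E ω).t = t := by rw [hE]
    have hBE : (E ω).B = B := by rw [hE]
    have hf := hframes ω
    obtain ⟨h, hY, -, hleft⟩ := Graveyard.run_inv hG (by omega) (by omega) hS k
    obtain ⟨-, hans, -⟩ := Graveyard.perform_spec hG (by omega) (by omega) h hY (hS k) hleft
    have hn : (0 : ℝ) < (Graveyard.run (E ω) S k).n := by exact_mod_cast h.pos
    have ht0 : (0 : ℝ) < t := by linarith
    refine ⟨h.stores, hans, ?_, fun hk => ?_, ?_⟩
    · rw [h.loadFactor_eq, div_le_iff₀ hn]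
      have h1 := h.card_seen_le (by omega) hleft
      have h2 : ((Graveyard.contents S k).card : ℝ) ≤ (Graveyard.epoch (E ω) S k).seen.card := by
        exact_mod_cast Finset.card_le_card h.sub_seen
      refine (h2.trans h1).trans (mul_le_mul_of_nonneg_right ?_ hn.le)
      rw [htE]
      have : 1 / (1888 * x) ≤ 3 / (4 * (t : ℝ)) := by
        rw [div_le_div_iff₀ (by positivity) (by positivity)]
        linarith
      linarith
    · rw [h.loadFactor_eq, le_div_iff₀ hn]
      have h1 := h.le_card (by omega) hleft
      rw [htE] at h1
      refine le_trans ?_ h1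
      have h2 : ((Graveyard.contents S k).card : ℝ) ≤ (Graveyard.run (E ω) S k).n := by
        have h3 := h.card_seen_le (by omega) hleft
        have h4 : ((Graveyard.contents S k).card : ℝ) ≤ (Graveyard.epoch (E ω) S k).seen.card := by
          exact_mod_cast Finset.card_le_card h.sub_seen
        have h5 : 0 ≤ 3 / (4 * ((E ω).t : ℝ)) := by positivity
        nlinarith
      have h3 : 5 / (4 * (t : ℝ)) ≤ 5 / 8 * (1 / x) := by
        rw [div_mul_div_comm, div_le_div_iff₀ (by positivity) (by positivity)]
        linarith
      have h4 : 3 ≤ 3 / 8 * (1 / x) * (Graveyard.run (E ω) S k).n := by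
        have h5 : 8 * x ≤ (Graveyard.run (E ω) S k).n := by linarith
        have h6 : 3 / 8 * (1 / x) * (8 * x) = 3 := by field_simp
        exact h6.symm.le.trans (mul_le_mul_of_nonneg_left h5 (by positivity))
      nlinarith
    · have h1 := Graveyard.sum_rebuildCost_le hG hf (by omega) (by omega) hS k
      rw [htE, hBE] at h1
      have h2 : ((∑ i ∈ Finset.range k, Graveyard.rebuildCost (E ω) S i : ℕ) : ℝ) * B ≤
          472 * (t * k) := by exact_mod_cast h1
      rw [← le_div_iff₀ hBpos] at h2
      refine h2.trans ?_
      have h3 : 472 * ((t : ℝ) * k) / B = 472 * (t / B) * k := by ring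
      have h4 : (1888 : ℝ) / r = 472 * (4 / r) := by ring
      rw [h3, h4]
      gcongr
  · refine (Graveyard.lintegral_opCost_le hH hE (fun ω => by have := hframes ω; omega) ht2 hB
      k).trans (ENNReal.ofReal_le_ofReal ?_)
    have h1 : 228 * (t : ℝ) / B = 228 * (t / B) := by ring
    have h2 : (912 : ℝ) / r = 228 * (4 / r) := by ring
    have h3 : (912 : ℝ) / r ≤ 1888 / r := div_le_div_of_nonneg_right (by norm_num) hr0.le
    rw [h1]
    linarith
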